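/- Let $\varepsilon>0$ be a constant and let $(G_k)_{k\ge 1}$ be a sequence of finite simple graphs, where $G_k$ is bipartite and $d_k$-regular on $n_k$ vertices, with $n_k\to\infty$ as $k\to\infty$. Let $\lambda_1(G_k)\ge\lambda_2(G_k)\ge\cdots\ge\lambda_{n_k}(G_k)$ be the eigenvalues of the adjacency matrix of $G_k$, counted with multiplicity, and let $\lambda^{(k)}>0$ be real numbers with $\lambda_i(G_k)\le\lambda^{(k)}$ for all $i\ne 1$. Suppose that $$\frac{d_k}{\lambda^{(k)}}\ge(\log n_k)^{1+\varepsilon}\ \text{ for all sufficiently large } k,\qquad\text{and}\qquad \log n_k=o\!\left(\log d_k\cdot\log\frac{d_k}{\lambda^{(k)}}\right)\ \text{ as } k\to\infty.$$ Then the number of Hamilton cycles of $G_k$ (counted as subgraphs, i.e. without starting point or orientation) is $$n_k!\left(\frac{d_k}{n_k}\right)^{n_k}(1+o(1))^{n_k}\qquad\text{as } k\to\infty;$$ that is, there is a sequence $\delta_k\to 0$ such that for all sufficiently large $k$ this number equals $n_k!\,(d_k/n_k)^{n_k}(1+\delta_k)^{n_k}$. -/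

import Mathlib

open Filter Topology Asymptotics

namespace SimpleGraph

/-- The real adjacency matrix of a graph is Hermitian. -/
theorem adjMatrix_real_isHermitian {V : Type*} (G : SimpleGraph V) [DecidableRel G.Adj] :
    (G.adjMatrix ℝ).IsHermitian := by
  rw [Matrix.IsHermitian, Matrix.conjTranspose_eq_transpose_of_trivial]
  exact G.isSymm_adjMatrix

/-- The adjacency eigenvalues of `G`, with multiplicity, in non-increasing order; the largest one
has index `0`. -/
noncomputable def adjEigenvalues {V : Type*} [Fintype V] [DecidableEq V] (G : SimpleGraph V)
    [DecidableRel G.Adj] : Fin (Fintype.card V) → ℝ :=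
  G.adjMatrix_real_isHermitian.eigenvalues₀

/-- Every adjacency eigenvalue other than the largest one (counted with multiplicity) is at most
`lam`. -/
def NontrivialEigenvaluesLE {V : Type*} [Fintype V] [DecidableEq V] (G : SimpleGraph V)
    [DecidableRel G.Adj] (lam : ℝ) : Prop :=
  ∀ i : Fin (Fintype.card V), (i : ℕ) ≠ 0 → G.adjEigenvalues i ≤ lam

/-- The number of Hamilton cycles of `G`. A Hamilton cycle is a subgraph of `G`, so that neither the
starting vertex nor the orientation of a closed walk tracing it counts. -/
noncomputable def numHamiltonCycles {V : Type*} [DecidableEq V] (G : SimpleGraph V) : ℕ :=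
  {H : G.Subgraph | ∃ (a : V) (p : G.Walk a a), p.IsHamiltonianCycle ∧ p.toSubgraph = H}.ncard

end SimpleGraph

set_option linter.unusedSectionVars false

/-! Up to a factor (1 + o(1))^n, the number n! (d/n)^n is (d/e)^n. This is also the order of the
permanent of the adjacency matrix, that is, of the number of permutations moving every vertex along
an edge (`factorPerms` of the whole vertex set). The upper bound follows at once: an oriented
Hamilton cycle is such a permutation, and the Bregman–Minc inequality bounds the permanent by ((d +
2 + 2 log d)/e)^n.

For the lower bound, Gurvits's capacity argument shows that the permanent is at least (d/e)^n
(`le_mixedDeriv_columns`), and it remains to turn most of these permutations into Hamilton cycles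
cheaply. Put x = log n, L ≈ x^(2 + ε/4) and t ≈ n/x^5, and call a permutation bad if some t vertices
lie in distinct orbits of length at most L. A given vertex lies on at most d^k candidate orbits with
k + 1 vertices. Deleting such an orbit lowers the Bregman–Minc bound by a factor of about
d^(-(k+1)), because the spectral gap controls the mean degree inside the remaining set. Each short
orbit thus costs a factor of about L/d, which beats the roughly (e n/t)^t choices of the t vertices.
The correction exp(L λ/d) is harmless because the two hypotheses together give L λ/d ≤ (log d)/4;
the second also forces log d ≥ sqrt(log n) - 1. So at most half of (d/e)^n permutations are bad
(`card_manyShortOrbits_le_half`).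

A permutation that is not bad has at most s = t + n/L orbits. These are merged one at a time by Pósa
rotations and absorption, each merge changing O(log n) edges
(`SideLinked.exists_hamiltonian_of_path`). The delicate point is closing a path in O(log n) edits
(`SideLinked.exists_closing_of_mem`). The path is cut into two halves, each holding a reserved block
that still expands, and each half is rotated with pivots in its own block only. The two large sets
of ends are then available independently and span an edge.

The permutation is recovered from the Hamilton cycle, the edited edges and one vertex per orbit
(`card_le_numHamiltonCycles_mul`). The correspondence is therefore at most exp(O(s log² n)) =
exp(o(n)) to one, which is why L has to exceed log² n. -/

/-! ### The Bregman–Minc inequality and its averaged form. -/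

/-- The log-sum inequality for nonnegative reals. -/
theorem sum_mul_log_sum_le {ι : Type*} (s : Finset ι) (x : ι → ℝ) (hx : ∀ i ∈ s, 0 ≤ x i) :
    (∑ i ∈ s, x i) * Real.log (∑ i ∈ s, x i) ≤
      (∑ i ∈ s, x i) * Real.log s.card + ∑ i ∈ s, x i * Real.log (x i) := by
  rcases s.eq_empty_or_nonempty with rfl | hs
  · simp
  have hc : (0 : ℝ) < s.card := by exact_mod_cast hs.card_pos
  have h := Real.convexOn_mul_log.map_sum_le (t := s) (w := fun _ => (s.card : ℝ)⁻¹) (p := x)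
    (fun i _ => by positivity) (by simp [hc.ne']) (fun i hi => hx i hi)
  simp only [smul_eq_mul, ← Finset.mul_sum] at h
  rcases (Finset.sum_nonneg hx).eq_or_lt with h0 | h0
  · rw [← h0] at h ⊢
    simp only [mul_zero, zero_mul, zero_add] at h ⊢
    exact nonneg_of_mul_nonneg_right h (by positivity)
  · rw [Real.log_mul (by positivity) h0.ne', Real.log_inv, mul_assoc] at h
    have := le_of_mul_le_mul_left h (by positivity)
    linarith

/-- The exponent contributed by a row of size `r` in the Bregman–Minc bound. -/
noncomputable def bregmanExponent (r : ℕ) : ℝ := Real.log (r.factorial : ℝ) / r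

theorem natCast_mul_bregmanExponent (r : ℕ) :
    (r : ℝ) * bregmanExponent r = Real.log (r.factorial : ℝ) := by
  rcases Nat.eq_zero_or_pos r with rfl | hr
  · simp
  · unfold bregmanExponent
    field_simp

/-- The bijections `α ≃ β` that send every `a` into `N a`. -/
def perfectMatchings {α β : Type*} [Fintype α] [Fintype β] [DecidableEq α] [DecidableEq β]
    (N : α → Finset β) : Finset (α ≃ β) :=
  Finset.univ.filter fun e => ∀ a, e a ∈ N a

theorem mem_perfectMatchings {α β : Type*} [Fintype α] [Fintype β] [DecidableEq α] [DecidableEq β]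
    {N : α → Finset β} {e : α ≃ β} : e ∈ perfectMatchings N ↔ ∀ a, e a ∈ N a := by
  simp [perfectMatchings]

theorem card_filter_perfectMatchings_le {α β : Type*} [Fintype α] [Fintype β] [DecidableEq α]
    [DecidableEq β] (N : α → Finset β) (i : α) (j : β) :
    ((perfectMatchings N).filter fun e => e i = j).card ≤
      (perfectMatchings fun a : {a // a ≠ i} => (N a).subtype (· ≠ j)).card := by
  classical
  rcases ((perfectMatchings N).filter fun e => e i = j).eq_empty_or_nonempty with h0 | ⟨e₀, he₀⟩
  · simp [h0]
  have restrict : ∀ e : α ≃ β, e i = j → ∀ a, a ≠ i ↔ e a ≠ j := fun e h a => by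
    rw [← h]; simp
  -- The `else` branch is never used on the filtered set; `e₀` only supplies a default value.
  refine Finset.card_le_card_of_injOn
    (fun e => if h : e i = j then e.subtypeEquiv (restrict e h)
      else e₀.subtypeEquiv (restrict e₀ (Finset.mem_filter.mp he₀).2)) ?_ ?_
  · intro e he
    simp only [Finset.coe_filter, Set.mem_ofPred_eq, mem_perfectMatchings] at he
    simp only [he.2, dite_true, Finset.mem_coe, mem_perfectMatchings, Finset.mem_subtype]
    intro a
    exact he.1 a
  · intro e he e' he' h
    simp only [Finset.coe_filter, Set.mem_ofPred_eq, mem_perfectMatchings] at he he'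
    simp only [he.2, he'.2, dite_true] at h
    ext a
    by_cases ha : a = i
    · rw [ha, he.2, he'.2]
    · have := congrArg (fun f : {a // a ≠ i} ≃ {b // b ≠ j} => (f ⟨a, ha⟩ : β)) h
      simpa using this

/-- Schrijver's argument: the log-sum inequality is applied to the image of each row, the induction
hypothesis to each minor, and the results are averaged over all rows. Averaging makes the exponents
of the smaller minors recombine exactly. -/
theorem log_card_perfectMatchings_le_aux (n : ℕ) : ∀ {α β : Type*} [Fintype α] [Fintype β]
    [DecidableEq α] [DecidableEq β] (N : α → Finset β), Fintype.card α = n →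
    (perfectMatchings N).Nonempty →
    Real.log (perfectMatchings N).card ≤ ∑ a, bregmanExponent (N a).card := by
  induction n with
  | zero =>
    intro α β _ _ _ _ N hα hne
    have : IsEmpty α := Fintype.card_eq_zero_iff.mp hα
    obtain ⟨e, -⟩ := hne
    have : IsEmpty β := e.symm.isEmpty
    have h1 : (perfectMatchings N).card ≤ 1 := Finset.card_le_one.mpr fun a _ b _ =>
      Subsingleton.elim a b
    have : Real.log (perfectMatchings N).card ≤ 0 :=
      Real.log_nonpos (by positivity) (by exact_mod_cast h1)
    simpa using this
  | succ n ih =>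
    intro α β _ _ _ _ N hα hne
    set M := perfectMatchings N with hM
    let c : α → β → ℕ := fun i j => (M.filter fun e => e i = j).card
    have hMpos : (0 : ℝ) < M.card := by exact_mod_cast hne.card_pos
    have hsum : ∀ i, ∑ j ∈ N i, (c i j : ℝ) = M.card := fun i => by
      rw [Finset.card_eq_sum_card_fiberwise (f := fun e : α ≃ β => e i) (t := N i)]
      · push_cast; rfl
      · intro e he
        exact mem_perfectMatchings.mp he i
    have hrow : ∀ i, (M.card : ℝ) * Real.log M.card ≤
        ∑ e ∈ M, (Real.log (N i).card + Real.log (c i (e i))) := fun i => by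
      have h := sum_mul_log_sum_le (N i) (fun j => (c i j : ℝ)) (fun _ _ => by positivity)
      rw [hsum] at h
      refine h.trans (le_of_eq ?_)
      rw [Finset.sum_add_distrib, Finset.sum_const, nsmul_eq_mul]
      congr 1
      rw [← Finset.sum_fiberwise_of_maps_to (g := fun e : α ≃ β => e i) (t := N i)
        (fun e he => mem_perfectMatchings.mp he i)]
      refine Finset.sum_congr rfl fun j _ => ?_
      rw [Finset.sum_congr rfl (g := fun _ => Real.log (c i j)), Finset.sum_const, nsmul_eq_mul]
      intro e he
      rw [(Finset.mem_filter.mp he).2]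
    have hcol : ∀ e ∈ M, ∀ i, Real.log (c i (e i)) ≤
        ∑ p ∈ Finset.univ.erase i, bregmanExponent ((N p).erase (e i)).card := fun e he i => by
      have hle := card_filter_perfectMatchings_le N i (e i)
      have hpos : 0 < c i (e i) := Finset.card_pos.mpr ⟨e, by simp [he]⟩
      have h := ih (fun a : {a // a ≠ i} => (N a).subtype (· ≠ e i)) (by simp [hα])
        (Finset.card_pos.mp (hpos.trans_le hle))
      refine (Real.log_le_log (by exact_mod_cast hpos) (by exact_mod_cast hle)).trans
        (h.trans (le_of_eq ?_))
      have he : (Finset.univ.erase i : Finset α) = Finset.univ.filter (· ≠ i) := by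
        ext; simp
      rw [he, ← Finset.sum_subtype_eq_sum_filter]
      refine Finset.sum_congr (by simp) fun a _ => ?_
      congr 1
      rw [Finset.card_subtype]
      congr 1
      ext b
      simp [and_comm]
    -- Fix a matching and a row `p` with r + 1 entries, and delete each other row `i` together with
    -- the column `e i`. Exactly r of these deletions shorten row `p`, the other n - r leave it
    -- alone, and log r! + log (r + 1) = log (r + 1)! closes the identity.
    have hfix : ∀ e ∈ M, ∀ p, Real.log (N p).card +
        ∑ i ∈ Finset.univ.erase p, bregmanExponent ((N p).erase (e i)).card =
        (n + 1 : ℝ) * bregmanExponent (N p).card := fun e he p => by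
      have hep : e p ∈ N p := mem_perfectMatchings.mp he p
      have h1 : ∑ i ∈ Finset.univ.erase p, bregmanExponent ((N p).erase (e i)).card =
          ∑ j ∈ Finset.univ.erase (e p), bregmanExponent ((N p).erase j).card := by
        refine Finset.sum_bij (fun i _ => e i) (by simp) (by simp) ?_ (by simp)
        intro b hb
        exact ⟨e.symm b, by simpa [Equiv.symm_apply_eq] using hb, by simp⟩
      have h2 : (Finset.univ.erase (e p) : Finset β) = (N p).erase (e p) ∪ (N p)ᶜ := by
        ext b
        by_cases hb : b ∈ N p
        · simp [hb]
        · simp only [Finset.mem_erase, Finset.mem_univ, and_true, Finset.mem_union, hb, and_false,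
            Finset.mem_compl, not_false_eq_true, or_true, iff_true]
          rintro rfl
          exact hb hep
      have h3 : Disjoint ((N p).erase (e p)) (N p)ᶜ :=
        Finset.disjoint_left.mpr fun b hb hb' =>
          (Finset.mem_compl.mp hb') (Finset.mem_of_mem_erase hb)
      obtain ⟨r, hr⟩ : ∃ r, (N p).card = r + 1 :=
        Nat.exists_eq_succ_of_ne_zero (Finset.card_pos.mpr ⟨_, hep⟩).ne'
      have hβ : Fintype.card β = n + 1 := (Fintype.card_congr e).symm.trans hα
      have hrn : r + 1 ≤ n + 1 := by rw [← hr, ← hβ]; exact Finset.card_le_univ _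
      have h4 : ∑ j ∈ (N p).erase (e p), bregmanExponent ((N p).erase j).card =
          r * bregmanExponent r := by
        rw [Finset.sum_congr rfl (g := fun _ => bregmanExponent r), Finset.sum_const,
          Finset.card_erase_of_mem hep, hr, nsmul_eq_mul, Nat.add_sub_cancel]
        intro j hj
        rw [Finset.card_erase_of_mem (Finset.mem_of_mem_erase hj), hr, Nat.add_sub_cancel]
      have h5 : ∑ j ∈ (N p)ᶜ, bregmanExponent ((N p).erase j).card =
          ((n : ℝ) - r) * bregmanExponent (r + 1) := by
        rw [Finset.sum_congr rfl (g := fun _ => bregmanExponent (r + 1)), Finset.sum_const,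
          Finset.card_compl, hr, hβ, nsmul_eq_mul, Nat.cast_sub hrn]
        · push_cast; ring
        intro j hj
        rw [Finset.erase_eq_of_notMem (Finset.mem_compl.mp hj), hr]
      rw [h1, h2, Finset.sum_union h3, h4, h5, hr, natCast_mul_bregmanExponent]
      have h6 := natCast_mul_bregmanExponent (r + 1)
      rw [Nat.factorial_succ, Nat.cast_mul, Real.log_mul (by positivity)
        (by positivity)] at h6
      push_cast at h6 ⊢
      linarith
    have hall : (n + 1 : ℝ) * (M.card * Real.log M.card) ≤
        M.card * ((n + 1 : ℝ) * ∑ p, bregmanExponent (N p).card) := by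
      calc (n + 1 : ℝ) * (M.card * Real.log M.card)
          = ∑ i : α, (M.card * Real.log M.card : ℝ) := by
            rw [Finset.sum_const, Finset.card_univ, hα, nsmul_eq_mul]; push_cast; ring
        _ ≤ ∑ i : α, ∑ e ∈ M, (Real.log (N i).card + Real.log (c i (e i))) :=
            Finset.sum_le_sum fun i _ => hrow i
        _ = ∑ e ∈ M, ∑ i : α, (Real.log (N i).card + Real.log (c i (e i))) := Finset.sum_comm
        _ ≤ ∑ e ∈ M, (n + 1 : ℝ) * ∑ p, bregmanExponent (N p).card := by
            refine Finset.sum_le_sum fun e he => ?_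
            calc ∑ i : α, (Real.log (N i).card + Real.log (c i (e i)))
                ≤ ∑ i : α, Real.log (N i).card + ∑ i : α, ∑ p ∈ Finset.univ.erase i,
                    bregmanExponent ((N p).erase (e i)).card := by
                  rw [Finset.sum_add_distrib]
                  gcongr with i
                  exact hcol e he i
              _ = ∑ p : α, (Real.log (N p).card + ∑ i ∈ Finset.univ.erase p,
                    bregmanExponent ((N p).erase (e i)).card) := by
                  rw [Finset.sum_add_distrib]
                  congr 1
                  refine Finset.sum_comm' ?_
                  intro x y
                  simp [eq_comm]
              _ = _ := by
                  rw [Finset.sum_congr rfl fun p _ => hfix e he p, Finset.mul_sum]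
        _ = _ := by rw [Finset.sum_const, nsmul_eq_mul]
    have hn : (0 : ℝ) < n + 1 := by positivity
    have : ((n + 1 : ℝ) * M.card) * Real.log M.card ≤
        ((n + 1 : ℝ) * M.card) * ∑ p, bregmanExponent (N p).card := by linarith
    exact le_of_mul_le_mul_left this (by positivity)

/-- **Bregman–Minc inequality**, in logarithmic form. -/
theorem log_card_perfectMatchings_le {α β : Type*} [Fintype α] [Fintype β]
    [DecidableEq α] [DecidableEq β] (N : α → Finset β) (hne : (perfectMatchings N).Nonempty) :
    Real.log (perfectMatchings N).card ≤ ∑ a, bregmanExponent (N a).card :=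
  log_card_perfectMatchings_le_aux _ N rfl hne

theorem Nat.log_factorial_le (r : ℕ) (hr : 1 ≤ r) :
    Real.log (r.factorial : ℝ) ≤ r * (Real.log r - 1) + 1 + Real.log r := by
  induction r, hr using Nat.le_induction with
  | base => simp
  | succ r hr ih =>
    have hr0 : (0 : ℝ) < r := by exact_mod_cast hr
    rw [Nat.factorial_succ, Nat.cast_mul, Real.log_mul (by positivity) (by positivity)]
    have h : 1 - ((r + 1 : ℝ) / r)⁻¹ ≤ Real.log ((r + 1 : ℝ) / r) :=
      Real.one_sub_inv_le_log_of_pos (by positivity)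
    rw [Real.log_div (by positivity) (by positivity), inv_div] at h
    have h2 : 1 - (r : ℝ) / (r + 1) = 1 / (r + 1) := by field_simp; ring
    rw [h2] at h
    have h3 := mul_le_mul_of_nonneg_left h (by positivity : (0 : ℝ) ≤ r + 1)
    rw [mul_one_div_cancel (by positivity)] at h3
    push_cast
    nlinarith

/-- Stirling's factor is moved inside the logarithm as an additive term, so that the bound on each
row is affine in its size and a product over rows can be averaged. The term uses `log d` rather than
`log r` to be the same for all rows. -/
theorem bregmanExponent_le {r d : ℕ} (hr : 1 ≤ r) (hrd : r ≤ d) :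
    bregmanExponent r ≤ Real.log ((r + (2 + 2 * Real.log d)) / Real.exp 1) := by
  have hr0 : (0 : ℝ) < r := by exact_mod_cast hr
  have hl : Real.log r ≤ Real.log d := Real.log_le_log hr0 (by exact_mod_cast hrd)
  have hl0 : 0 ≤ Real.log r := Real.log_nonneg (by exact_mod_cast hr)
  have hlr : Real.log r ≤ r - 1 := Real.log_le_sub_one_of_pos hr0
  set x := (1 + Real.log r) / r with hx
  have hx0 : 0 ≤ x := by positivity
  have hx1 : x ≤ 1 := by rw [hx, div_le_one hr0]; linarith
  have hexp : Real.exp x ≤ 1 + 2 * x := by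
    have := Real.abs_exp_sub_one_le (x := x) (by rw [abs_of_nonneg hx0]; exact hx1)
    rw [abs_of_nonneg hx0] at this
    linarith [le_abs_self (Real.exp x - 1)]
  have h1 : bregmanExponent r ≤ Real.log r - 1 + x := by
    unfold bregmanExponent
    rw [div_le_iff₀ hr0]
    have : (Real.log r - 1 + x) * r = r * (Real.log r - 1) + 1 + Real.log r := by
      rw [hx]; field_simp; ring
    rw [this]
    exact Nat.log_factorial_le r hr
  have hpos : (0 : ℝ) < r + (2 + 2 * Real.log d) := by linarith
  rw [Real.log_div hpos.ne' (Real.exp_pos 1).ne', Real.log_exp]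
  have h2 : Real.log r + x ≤ Real.log (r + (2 + 2 * Real.log d)) := by
    rw [Real.le_log_iff_exp_le hpos, Real.exp_add, Real.exp_log hr0]
    calc (r : ℝ) * Real.exp x ≤ r * (1 + 2 * x) := by gcongr
      _ = r + (2 + 2 * Real.log r) := by rw [hx]; field_simp
      _ ≤ _ := by linarith
  linarith

theorem prod_le_mean_pow_card {ι : Type*} (s : Finset ι) (z : ι → ℝ) (hz : ∀ i ∈ s, 0 ≤ z i) :
    ∏ i ∈ s, z i ≤ ((∑ i ∈ s, z i) / s.card) ^ s.card := by
  rcases s.eq_empty_or_nonempty with rfl | hs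
  · simp
  have hc : (0 : ℝ) < s.card := by exact_mod_cast hs.card_pos
  have h := Real.geom_mean_le_arith_mean_weighted s (fun _ => (s.card : ℝ)⁻¹) z
    (fun i _ => by positivity) (by simp [hc.ne']) hz
  rw [← Finset.mul_sum, inv_mul_eq_div] at h
  have h2 := pow_le_pow_left₀ (Finset.prod_nonneg fun i hi => Real.rpow_nonneg (hz i hi) _) h s.card
  rw [← Finset.prod_pow] at h2
  refine le_of_eq_of_le (Finset.prod_congr rfl fun i hi => ?_) h2
  exact (Real.rpow_inv_natCast_pow (hz i hi) hs.card_pos.ne').symm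

/-- The Bregman–Minc bound combined with the inequality of the means. -/
theorem card_perfectMatchings_le {α β : Type*} [Fintype α] [Fintype β]
    [DecidableEq α] [DecidableEq β] (N : α → Finset β) (d : ℕ) (hd : ∀ a, (N a).card ≤ d)
    (s : ℝ) (hs : (∑ a, ((N a).card : ℝ)) ≤ Fintype.card α * s) :
    ((perfectMatchings N).card : ℝ) ≤
      ((s + (2 + 2 * Real.log d)) / Real.exp 1) ^ Fintype.card α := by
  classical
  rcases isEmpty_or_nonempty α with hα | hα
  · have h1 : (perfectMatchings N).card ≤ 1 := Finset.card_le_one.mpr fun a _ b _ => by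
      ext x; exact hα.elim x
    simpa using h1
  have hc : (0 : ℝ) < Fintype.card α := by exact_mod_cast Fintype.card_pos
  have hs0 : 0 ≤ s := by
    by_contra h
    have h1 : (0 : ℝ) ≤ ∑ a, ((N a).card : ℝ) := by positivity
    nlinarith [not_le.mp h]
  have hl0 : 0 ≤ Real.log d := Real.log_natCast_nonneg d
  rcases (perfectMatchings N).eq_empty_or_nonempty with he | hne
  · rw [he]; simp only [Finset.card_empty, Nat.cast_zero]; positivity
  have hr : ∀ a, 1 ≤ (N a).card := fun a => by
    obtain ⟨e, he⟩ := hne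
    exact Finset.card_pos.mpr ⟨_, mem_perfectMatchings.mp he a⟩
  have hMpos : (0 : ℝ) < (perfectMatchings N).card := by exact_mod_cast hne.card_pos
  set z : α → ℝ := fun a => ((N a).card + (2 + 2 * Real.log d)) / Real.exp 1 with hz
  have hzpos : ∀ a, 0 < z a := fun a => by
    have : (0 : ℝ) < (N a).card := by exact_mod_cast hr a
    simp only [hz]; positivity
  have h1 : ((perfectMatchings N).card : ℝ) ≤ ∏ a, z a := by
    rw [← Real.log_le_log_iff hMpos (Finset.prod_pos fun a _ => hzpos a),
      Real.log_prod (fun a _ => (hzpos a).ne')]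
    exact (log_card_perfectMatchings_le N hne).trans
      (Finset.sum_le_sum fun a _ => bregmanExponent_le (hr a) (hd a))
  refine h1.trans ((prod_le_mean_pow_card _ z fun a _ => (hzpos a).le).trans ?_)
  rw [Finset.card_univ]
  refine pow_le_pow_left₀ (div_nonneg (Finset.sum_nonneg fun a _ => (hzpos a).le) hc.le) ?_ _
  rw [div_le_iff₀ hc]
  simp only [hz]
  rw [← Finset.sum_div, Finset.sum_add_distrib, Finset.sum_const, Finset.card_univ, nsmul_eq_mul,
    div_mul_eq_mul_div]
  gcongr
  linarith

/-! ### Lower bound for the permanent by stable polynomials and capacity. -/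

/-- The iterated directional derivative, in the directions listed in `ws`, of the monomial
`∏ i ∈ S, y i`, evaluated at `y`. -/
def mixedDeriv {V R : Type*} [DecidableEq V] [CommRing R] :
    List (V → R) → Finset V → (V → R) → R
  | [], S, y => ∏ i ∈ S, y i
  | w :: ws, S, y => ∑ i ∈ S, w i * mixedDeriv ws (S.erase i) y

/-- Weighted AM–GM in each row, with weights `a i j / d`; the column sums make every variable occur
with total exponent one. This is the initial capacity bound. -/
theorem prod_le_prod_mulVec {V : Type*} [Fintype V] (a : V → V → ℝ) (ha : ∀ i j, 0 ≤ a i j) (d : ℝ) (hd : 0 < d)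
    (hrow : ∀ i, ∑ j, a i j = d) (hcol : ∀ j, ∑ i, a i j = d) (x : V → ℝ) (hx : ∀ i, 0 < x i) :
    d ^ Fintype.card V * ∏ j, x j ≤ ∏ i, ∑ j, a i j * x j := by
  have h1 : ∀ i, d * ∏ j, x j ^ (a i j / d) ≤ ∑ j, a i j * x j := fun i => by
    have h := Real.geom_mean_le_arith_mean_weighted Finset.univ (fun j => a i j / d) x
      (fun j _ => div_nonneg (ha i j) hd.le) (by rw [← Finset.sum_div, hrow, div_self hd.ne'])
      (fun j _ => (hx j).le)
    calc d * ∏ j, x j ^ (a i j / d) ≤ d * ∑ j, a i j / d * x j := by gcongr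
      _ = ∑ j, a i j * x j := by
        rw [Finset.mul_sum]
        refine Finset.sum_congr rfl fun j _ => ?_
        field_simp
  calc d ^ Fintype.card V * ∏ j, x j = ∏ i, (d * ∏ j, x j ^ (a i j / d)) := by
        rw [Finset.prod_mul_distrib, Finset.prod_const, Finset.card_univ, Finset.prod_comm]
        congr 1
        refine Finset.prod_congr rfl fun j _ => ?_
        rw [← Real.rpow_sum_of_pos (hx j), ← Finset.sum_div, hcol, div_self hd.ne', Real.rpow_one]
    _ ≤ _ := Finset.prod_le_prod (fun i _ => mul_nonneg hd.le
        (Finset.prod_nonneg fun j _ => Real.rpow_nonneg (hx j).le _)) fun i _ => h1 i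

section mixedDeriv

variable {V : Type*} [DecidableEq V]

theorem map_mixedDeriv {R R' : Type*} [CommRing R] [CommRing R'] (φ : R →+* R')
    (ws : List (V → R)) (S : Finset V) (y : V → R) :
    φ (mixedDeriv ws S y) = mixedDeriv (ws.map (φ ∘ ·)) S (φ ∘ y) := by
  induction ws generalizing S with
  | nil => simp [mixedDeriv]
  | cons w ws ih => simp [mixedDeriv, ih]

theorem mixedDeriv_swap {R : Type*} [CommRing R] (u w : V → R) (ws : List (V → R)) (S : Finset V)
    (y : V → R) : mixedDeriv (u :: w :: ws) S y = mixedDeriv (w :: u :: ws) S y := by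
  simp only [mixedDeriv, Finset.mul_sum]
  rw [Finset.sum_comm' (t' := S) (s' := fun i => S.erase i)]
  · refine Finset.sum_congr rfl fun i _ => Finset.sum_congr rfl fun j _ => ?_
    rw [Finset.erase_right_comm]
    ring
  · intro i j
    simp only [Finset.mem_erase, ne_eq]
    tauto

/-- Restricting to a line makes a directional derivative the derivative of a polynomial in one
variable, so that the location of its roots can be exploited. -/
theorem derivative_mixedDeriv {R : Type*} [CommRing R] (ws : List (V → R)) (S : Finset V)
    (y w : V → R) :
    Polynomial.derivative (mixedDeriv (ws.map (Polynomial.C ∘ ·)) S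
      (fun i => Polynomial.C (y i) + Polynomial.X * Polynomial.C (w i))) =
    mixedDeriv ((w :: ws).map (Polynomial.C ∘ ·)) S
      (fun i => Polynomial.C (y i) + Polynomial.X * Polynomial.C (w i)) := by
  induction ws generalizing S with
  | nil =>
    simp only [List.map_nil, List.map_cons, mixedDeriv, Polynomial.derivative_prod_finset]
    refine Finset.sum_congr rfl fun i _ => ?_
    rw [mul_comm]
    simp
  | cons u ws ih =>
    simp only [List.map_cons]
    rw [mixedDeriv_swap]
    simp only [mixedDeriv, Polynomial.derivative_sum, Polynomial.derivative_mul, ih,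
      Function.comp_apply, Polynomial.derivative_C, zero_mul, zero_add, List.map_cons]

theorem eval_mixedDeriv {R : Type*} [CommRing R] (ws : List (V → R)) (S : Finset V)
    (y w : V → R) (t : R) :
    (mixedDeriv (ws.map (Polynomial.C ∘ ·)) S
      (fun i => Polynomial.C (y i) + Polynomial.X * Polynomial.C (w i))).eval t =
    mixedDeriv ws S (fun i => y i + t * w i) := by
  rw [← Polynomial.coe_evalRingHom, map_mixedDeriv]
  simp only [List.map_map]
  congr 1
  · convert List.map_id ws
    ext w i
    simp
  · ext i
    simp only [Function.comp_apply, Polynomial.coe_evalRingHom, Polynomial.eval_add,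
      Polynomial.eval_mul, Polynomial.eval_C, Polynomial.eval_X]

theorem mixedDeriv_smul {R : Type*} [CommRing R] (ws : List (V → R)) (S : Finset V)
    (hS : ws.length ≤ S.card) (c : R) (y : V → R) :
    mixedDeriv ws S (fun i => c * y i) = c ^ (S.card - ws.length) * mixedDeriv ws S y := by
  induction ws generalizing S with
  | nil => simp [mixedDeriv, Finset.prod_mul_distrib]
  | cons w ws ih =>
    simp only [mixedDeriv, List.length_cons, Finset.mul_sum] at hS ⊢
    refine Finset.sum_congr rfl fun i hi => ?_
    have h1 := Finset.card_erase_of_mem hi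
    rw [ih _ (by omega), h1, show S.card - 1 - ws.length = S.card - (ws.length + 1) by omega]
    ring

theorem mixedDeriv_pos (ws : List (V → ℝ)) (hws : ∀ w ∈ ws, ∀ i, 0 < w i) (S : Finset V)
    (hS : ws.length ≤ S.card) (y : V → ℝ) (hy : ∀ i, 0 < y i) : 0 < mixedDeriv ws S y := by
  induction ws generalizing S with
  | nil => exact Finset.prod_pos fun i _ => hy i
  | cons w ws ih =>
    simp only [List.length_cons] at hS
    refine Finset.sum_pos (fun i hi => mul_pos (hws w (by simp) i)
      (ih (fun w hw => hws w (by simp [hw])) _ ?_)) (Finset.card_pos.mp (by omega))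
    rw [Finset.card_erase_of_mem hi]
    omega

theorem continuous_mixedDeriv {X R : Type*} [TopologicalSpace X] [CommRing R] [TopologicalSpace R]
    [IsTopologicalRing R] (ws : List (X → V → R)) (hws : ∀ w ∈ ws, Continuous w) (S : Finset V)
    (y : X → V → R) (hy : Continuous y) :
    Continuous fun x => mixedDeriv (ws.map fun w => w x) S (y x) := by
  induction ws generalizing S with
  | nil =>
    simp only [List.map_nil, mixedDeriv]
    fun_prop
  | cons w ws ih =>
    simp only [List.map_cons, mixedDeriv]
    have h1 : Continuous w := hws w (by simp)
    have h2 := ih fun w hw => hws w (by simp [hw])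
    refine continuous_finsetSum _ fun i _ => Continuous.mul (by fun_prop) (h2 _)

/-- Directional derivatives of a monomial in positive directions have no zero in the product of
open right half-planes. -/
theorem mixedDeriv_ne_zero (ws : List (V → ℝ)) (hws : ∀ w ∈ ws, ∀ i, 0 < w i) (S : Finset V)
    (hS : ws.length ≤ S.card) (y : V → ℂ) (hy : ∀ i, 0 < (y i).re) :
    mixedDeriv (ws.map (Complex.ofRealHom ∘ ·)) S y ≠ 0 := by
  induction ws generalizing y with
  | nil =>
    simp only [List.map_nil, mixedDeriv]
    refine Finset.prod_ne_zero_iff.mpr fun i _ h => ?_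
    simpa [h] using hy i
  | cons w ws ih =>
    have hws' : ∀ w ∈ ws, ∀ i, 0 < w i := fun w hw => hws w (by simp [hw])
    have hw : ∀ i, 0 < w i := hws w (by simp)
    simp only [List.length_cons] at hS
    replace ih := ih hws' (by omega)
    set ws' := ws.map (Complex.ofRealHom ∘ · : (V → ℝ) → V → ℂ) with hws'
    set w' : V → ℂ := Complex.ofRealHom ∘ w with hw'
    set f : Polynomial ℂ := mixedDeriv (ws'.map (Polynomial.C ∘ ·)) S
      (fun i => Polynomial.C (y i) + Polynomial.X * Polynomial.C (w' i)) with hf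
    have hf0 : ∀ t, f.eval t = mixedDeriv ws' S (fun i => y i + t * w' i) := fun t =>
      eval_mixedDeriv _ _ _ _ _
    have hf1 : f.derivative.eval 0 = mixedDeriv (w' :: ws') S y := by
      rw [hf, derivative_mixedDeriv, eval_mixedDeriv]
      simp
    -- Moving along the positive direction `w` by `t` with nonnegative real part stays inside the
    -- half-planes, so all roots of `f` have negative real part.
    have hne : ∀ t : ℂ, 0 ≤ t.re → f.eval t ≠ 0 := fun t ht => by
      rw [hf0]
      refine ih _ fun i => ?_
      have : (t * w' i).re = t.re * w i := by simp [hw']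
      rw [Complex.add_re, this]
      have := mul_nonneg ht (hw i).le
      linarith [hy i]
    -- If `f` were constant, homogeneity would give g(s y + w) = s^m c for s ≠ 0 with m > 0, where g
    -- is the previous derivative. Letting s = 0 then gives g(w) = 0, against the induction
    -- hypothesis.
    have hdeg : f.natDegree ≠ 0 := fun h => by
      obtain ⟨c, hc⟩ := Polynomial.natDegree_eq_zero.mp h
      have h1 : (fun s : ℂ => mixedDeriv ws' S (fun i => s * y i + w' i)) =
          fun s => s ^ (S.card - ws'.length) * c := by
        refine Continuous.ext_on (dense_compl_singleton (0 : ℂ)) ?_ (by fun_prop) ?_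
        · have := continuous_mixedDeriv (X := ℂ) (ws'.map fun w _ => w) (by
            intro w hw
            obtain ⟨w, -, rfl⟩ := List.mem_map.mp hw
            exact continuous_const) S (fun s i => s * y i + w' i) (by fun_prop)
          simpa [Function.comp_def] using this
        · intro s hs
          have hs : s ≠ 0 := hs
          have h2 := hf0 s⁻¹
          rw [← hc, Polynomial.eval_C] at h2
          simp only
          rw [h2, ← mixedDeriv_smul ws' S (by simp [ws']; omega)]
          congr 1
          ext i
          field_simp
      have h2 := congrFun h1 0
      rw [zero_pow (by simp [ws']; omega), zero_mul] at h2
      simp only [zero_mul, zero_add] at h2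
      refine ih w' (fun i => by simpa [hw'] using hw i) h2
    -- Gauss–Lucas: f'/f at 0 is the sum of 1/(0 - r) over the roots, and every term has positive
    -- real part.
    have hlog := (IsAlgClosed.splits f).eval_derivative_div_eval_of_ne_zero (x := 0)
      (hne 0 (by simp))
    obtain ⟨z, hz⟩ := Multiset.exists_mem_of_ne_zero (s := f.roots) (by
      intro h
      have := (IsAlgClosed.splits f).natDegree_eq_card_roots
      rw [h] at this
      exact hdeg (by simpa using this))
    have hroots : ∀ r ∈ f.roots, 0 < (1 / (0 - r)).re := fun r hr => by
      have h1 : ¬ 0 ≤ r.re := fun h => hne r h (Polynomial.isRoot_of_mem_roots hr)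
      have h2 : r ≠ 0 := fun h => h1 (by simp [h])
      rw [zero_sub, one_div, Complex.inv_re, Complex.neg_re]
      exact div_pos (by linarith [not_le.mp h1]) (Complex.normSq_pos.mpr (neg_ne_zero.mpr h2))
    have hsum : 0 < ((f.roots.map fun r => 1 / (0 - r)).sum).re := by
      rw [← Complex.coe_reAddGroupHom, map_multiset_sum, Multiset.map_map]
      obtain ⟨m, hm⟩ := Multiset.exists_cons_of_mem hz
      rw [hm, Multiset.map_cons, Multiset.sum_cons]
      refine add_pos_of_pos_of_nonneg (hroots z hz) (Multiset.sum_nonneg ?_)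
      intro x hx
      obtain ⟨r, hr, rfl⟩ := Multiset.mem_map.mp hx
      exact (hroots r (by rw [hm]; simp [hr])).le
    rw [List.map_cons, ← hf1]
    intro h
    rw [h, zero_div] at hlog
    rw [← hlog] at hsum
    simp at hsum

/-- Factor by factor, t + ρ ≤ ρ exp(t/ρ). A real-rooted polynomial with negative roots thus grows no
faster than its logarithmic derivative at 0 predicts; the loss against the sharp bound is
affordable, as only the factor e per column matters. -/
theorem norm_prod_map_sub_le (s : Multiset ℂ) (hs : ∀ r ∈ s, ∃ ρ : ℝ, 0 < ρ ∧ r = -ρ) (t : ℝ)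
    (ht : 0 ≤ t) : ‖(s.map fun r => (t : ℂ) - r).prod‖ ≤
      ‖(s.map fun r => 0 - r).prod‖ * Real.exp (t * (s.map fun r => 1 / (0 - r)).sum.re) := by
  induction s using Multiset.induction with
  | empty => simp
  | cons r s ih =>
    obtain ⟨ρ, hρ, rfl⟩ := hs r (by simp)
    have ih := ih fun r hr => hs r (by simp [hr])
    simp only [Multiset.map_cons, Multiset.prod_cons, Multiset.sum_cons, norm_mul, Complex.add_re,
      mul_add, Real.exp_add]
    have h1 : ‖(t : ℂ) - -(ρ : ℂ)‖ = t + ρ := by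
      rw [sub_neg_eq_add, ← Complex.ofReal_add, Complex.norm_real, Real.norm_eq_abs,
        abs_of_pos (by linarith)]
    have h2 : ‖(0 : ℂ) - -(ρ : ℂ)‖ = ρ := by
      rw [zero_sub, neg_neg, Complex.norm_real, Real.norm_eq_abs, abs_of_pos hρ]
    have h3 : (1 / (0 - -(ρ : ℂ))).re = 1 / ρ := by
      rw [zero_sub, neg_neg, ← Complex.ofReal_one, ← Complex.ofReal_div, Complex.ofReal_re]
    rw [h1, h2, h3]
    have h4 : t + ρ ≤ ρ * Real.exp (t * (1 / ρ)) := by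
      have := Real.add_one_le_exp (t * (1 / ρ))
      calc t + ρ = ρ * (t * (1 / ρ) + 1) := by field_simp
        _ ≤ _ := by gcongr
    calc _ ≤ (ρ * Real.exp (t * (1 / ρ))) * (‖(s.map fun r => 0 - r).prod‖ *
          Real.exp (t * (s.map fun r => 1 / (0 - r)).sum.re)) := by gcongr
      _ = _ := by ring

/-- Along a positive direction, a mixed derivative of a monomial grows at most as its logarithmic
derivative at the base point predicts. -/
theorem mixedDeriv_add_le (ws : List (V → ℝ)) (hws : ∀ w ∈ ws, ∀ i, 0 < w i) (S : Finset V)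
    (hS : ws.length ≤ S.card) (y w : V → ℝ) (hy : ∀ i, 0 < y i) (hw : ∀ i, 0 < w i) (t : ℝ)
    (ht : 0 ≤ t) : mixedDeriv ws S (fun i => y i + t * w i) ≤ mixedDeriv ws S y *
      Real.exp (t * (mixedDeriv (w :: ws) S y / mixedDeriv ws S y)) := by
  set ws' := ws.map (Complex.ofRealHom ∘ · : (V → ℝ) → V → ℂ) with hws'
  set w' : V → ℂ := Complex.ofRealHom ∘ w with hw'
  set y' : V → ℂ := Complex.ofRealHom ∘ y with hy'
  set f : Polynomial ℂ := mixedDeriv (ws'.map (Polynomial.C ∘ ·)) S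
    (fun i => Polynomial.C (y' i) + Polynomial.X * Polynomial.C (w' i)) with hf
  have hf0 : ∀ t, f.eval t = mixedDeriv ws' S (fun i => y' i + t * w' i) := fun t =>
    eval_mixedDeriv _ _ _ _ _
  have hft : ∀ t : ℝ, f.eval (t : ℂ) = (mixedDeriv ws S (fun i => y i + t * w i) : ℝ) := fun t => by
    rw [hf0]
    refine Eq.trans ?_ (map_mixedDeriv Complex.ofRealHom _ _ _).symm
    congr 1
    ext i
    simp [y', w']
  have hf00 : f.eval 0 = (mixedDeriv ws S y : ℝ) := by
    have := hft 0
    simpa using this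
  have hf1 : f.derivative.eval 0 = (mixedDeriv (w :: ws) S y : ℝ) := by
    rw [hf, derivative_mixedDeriv, eval_mixedDeriv, ← Complex.ofRealHom_eq_coe, map_mixedDeriv]
    simp [ws', w', y']
    rfl
  have hroots : ∀ r ∈ f.roots, ∃ ρ : ℝ, 0 < ρ ∧ r = -ρ := fun r hr => by
    have hr0 : f.eval r = 0 := Polynomial.isRoot_of_mem_roots hr
    by_contra hcon
    -- By homogeneity a zero may be multiplied by ζ. If ζ and ζ r both have positive real part, this
    -- puts a zero in the forbidden product of half-planes.
    have key : ∀ ζ : ℂ, 0 < ζ.re → 0 < (ζ * r).re → False := fun ζ h1 h2 => by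
      refine mixedDeriv_ne_zero ws hws S hS (fun i => ζ * (y' i + r * w' i)) (fun i => ?_) ?_
      · have h3 : (ζ * (y' i + r * w' i)).re = ζ.re * y i + (ζ * r).re * w i := by
          simp [y', w']; ring
        rw [h3]
        exact add_pos (mul_pos h1 (hy i)) (mul_pos h2 (hw i))
      · rw [mixedDeriv_smul _ _ (by simpa using hS)]
        rw [hf0] at hr0
        rw [hr0, mul_zero]
    by_cases hrz : r = 0
    · subst hrz
      rw [hf00] at hr0
      have := mixedDeriv_pos ws hws S hS y hy
      rw [Complex.ofReal_eq_zero] at hr0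
      linarith
    have hn : 0 < ‖r‖ := norm_pos_iff.mpr hrz
    have hre : -‖r‖ < r.re := by
      refine lt_of_le_of_ne (neg_le_of_abs_le (Complex.abs_re_le_norm r)) fun h => hcon
        ⟨‖r‖, hn, ?_⟩
      have h1 : ‖r‖ ^ 2 = r.re ^ 2 + r.im ^ 2 := by
        rw [← Complex.normSq_eq_norm_sq, Complex.normSq_apply]; ring
      have h2 : r.im = 0 := by
        rw [← h] at h1
        exact pow_eq_zero_iff (two_ne_zero) |>.mp (by linarith)
      apply Complex.ext
      · simp [h]
      · simp [h2]
    -- This ζ turns `r` halfway back towards the positive axis: Re ζ = |r| + Re r and Re (ζ r) = |r|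
    -- (|r| + Re r), both positive unless `r` is a negative real.
    refine key (‖r‖ + (starRingEnd ℂ) r) ?_ ?_
    · simp; linarith
    · rw [add_mul, mul_comm ((starRingEnd ℂ) r), Complex.mul_conj, Complex.normSq_eq_norm_sq,
        Complex.add_re, Complex.ofReal_re, Complex.re_ofReal_mul]
      nlinarith
  have hne : f.eval 0 ≠ 0 := by
    rw [hf00]
    exact_mod_cast (mixedDeriv_pos ws hws S hS y hy).ne'
  have hlog := (IsAlgClosed.splits f).eval_derivative_div_eval_of_ne_zero hne
  have hprod : ∀ t, f.eval t = f.leadingCoeff * (f.roots.map fun r => t - r).prod := fun t =>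
    (IsAlgClosed.splits f).eval_eq_prod_roots t
  have hmain := norm_prod_map_sub_le f.roots hroots t ht
  have h1 := mul_le_mul_of_nonneg_left hmain (norm_nonneg f.leadingCoeff)
  rw [← norm_mul, ← mul_assoc, ← norm_mul, ← hprod, ← hprod, ← hlog, hf00, hf1, hft,
    ← Complex.ofReal_div, Complex.ofReal_re, Complex.norm_real, Complex.norm_real,
    Real.norm_of_nonneg (mixedDeriv_pos ws hws S hS y hy).le] at h1
  exact (le_abs_self _).trans h1

/-- One derivative in the direction of a perturbed basis vector costs a factor `e` in capacity. -/
theorem capacity_step [Fintype V] (a : V → V → ℝ) (ha : ∀ i j, 0 ≤ a i j) (d : ℝ) (hd : 0 < d)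
    (hrow : ∀ i, ∑ j, a i j = d) (ε : ℝ) (hε : 0 < ε) (ws : List (V → ℝ))
    (hws : ∀ w ∈ ws, ∀ i, 0 < w i) (hlen : ws.length < Fintype.card V) (T : Finset V) (c : ℝ)
    (hc : 0 ≤ c)
    (hcap : ∀ x : V → ℝ, (∀ i, 0 < x i) →
      c * ∏ j ∈ T, x j ≤ mixedDeriv ws Finset.univ (fun i => ∑ j, a i j * x j))
    (j : V) (hj : j ∈ T) (x : V → ℝ) (hx : ∀ i, 0 < x i) :
    c / Real.exp 1 * ∏ k ∈ T.erase j, x k ≤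
      mixedDeriv ((fun i => a i j + ε * d) :: ws) Finset.univ (fun i => ∑ j, a i j * x j) := by
  set y : V → ℝ := fun i => ∑ j, a i j * x j with hy
  set w : V → ℝ := fun i => a i j + ε * d with hw
  have hw0 : ∀ i, 0 < w i := fun i => by
    have := ha i j
    simp only [hw]; positivity
  have hy0 : ∀ i, 0 < y i := fun i => by
    refine Finset.sum_pos' (fun k _ => mul_nonneg (ha i k) (hx k).le) ?_
    by_contra! h
    have : ∑ k, a i k ≤ 0 := Finset.sum_nonpos fun k hk => by
      by_contra! h2
      exact absurd (h k hk) (not_le.mpr (mul_pos h2 (hx k)))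
    rw [hrow] at this
    linarith
  have hf0 : 0 < mixedDeriv ws Finset.univ y :=
    mixedDeriv_pos ws hws _ (by rw [Finset.card_univ]; omega) y hy0
  have hf1 : 0 < mixedDeriv (w :: ws) Finset.univ y :=
    mixedDeriv_pos _ (by
      intro u hu
      rcases List.mem_cons.mp hu with rfl | hu
      · exact hw0
      · exact hws u hu) _ (by rw [Finset.card_univ, List.length_cons]; omega) y hy0
  -- The step length is the reciprocal logarithmic derivative, so that the growth factor is exactly
  -- e.
  set t := mixedDeriv ws Finset.univ y / mixedDeriv (w :: ws) Finset.univ y with ht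
  have ht0 : 0 < t := div_pos hf0 hf1
  have h1 := mixedDeriv_add_le ws hws Finset.univ (by rw [Finset.card_univ]; omega) y w hy0 hw0 t
    ht0.le
  have h2 : t * (mixedDeriv (w :: ws) Finset.univ y / mixedDeriv ws Finset.univ y) = 1 := by
    rw [ht]; field_simp
  rw [h2] at h1
  -- Moving `y` by `t` along the perturbed column is the same as moving `x` by t(e_j + ε 1), since
  -- all row sums are `d`. The coordinate `j` of the new point is at least `t`, which replaces `x j`
  -- in the product.
  set x' : V → ℝ := fun k => x k + t * ((if k = j then 1 else 0) + ε) with hx'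
  have hx'0 : ∀ k, x k ≤ x' k := fun k => by
    simp only [hx']
    have : (0 : ℝ) ≤ (if k = j then 1 else 0) + ε := by split_ifs <;> linarith
    nlinarith
  have h3 : (fun i => ∑ k, a i k * x' k) = fun i => y i + t * w i := by
    ext i
    simp only [hx', hy, hw, mul_add, Finset.sum_add_distrib]
    congr 1
    rw [← hrow i, Finset.mul_sum, Finset.mul_sum]
    simp only [mul_ite, mul_one, mul_zero, Finset.sum_ite_eq', Finset.mem_univ, if_true]
    exact congrArg₂ (· + ·) (mul_comm _ _) (Finset.sum_congr rfl fun k _ => by ring)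
  have h4 := hcap x' fun k => (hx k).trans_le (hx'0 k)
  rw [h3] at h4
  have h5 : t * ∏ k ∈ T.erase j, x k ≤ ∏ k ∈ T, x' k := by
    rw [← Finset.mul_prod_erase T x' hj]
    refine mul_le_mul ?_ (Finset.prod_le_prod (fun k _ => (hx k).le) fun k _ => hx'0 k)
      (Finset.prod_nonneg fun k _ => (hx k).le) ((hx j).le.trans (hx'0 j))
    simp only [hx', if_true]
    nlinarith [hx j]
  have h6 : c * (t * ∏ k ∈ T.erase j, x k) ≤ mixedDeriv ws Finset.univ y * Real.exp 1 :=
    (mul_le_mul_of_nonneg_left h5 hc).trans (h4.trans h1)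
  have h7 : mixedDeriv ws Finset.univ y = t * mixedDeriv (w :: ws) Finset.univ y := by
    rw [ht]; field_simp
  rw [h7] at h6
  have h8 : t * (c * ∏ k ∈ T.erase j, x k) ≤
      t * (mixedDeriv (w :: ws) Finset.univ y * Real.exp 1) := by linarith
  have h9 := le_of_mul_le_mul_left h8 ht0
  rw [div_mul_eq_mul_div, div_le_iff₀ (Real.exp_pos 1)]
  exact h9

/-- Each column removes one variable from the capacity bound at the cost of a factor e. The shift by
ε d keeps the directions strictly positive, as stability requires; it is removed by continuity once
all columns have been used. -/
theorem capacity_iterate [Fintype V] (a : V → V → ℝ) (ha : ∀ i j, 0 ≤ a i j) (d : ℝ) (hd : 0 < d)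
    (hrow : ∀ i, ∑ j, a i j = d) (hcol : ∀ j, ∑ i, a i j = d) (ε : ℝ) (hε : 0 < ε)
    (js : List V) (hjs : js.Nodup) (x : V → ℝ) (hx : ∀ i, 0 < x i) :
    d ^ Fintype.card V / Real.exp 1 ^ js.length * ∏ k ∈ js.toFinsetᶜ, x k ≤
      mixedDeriv (js.map fun j i => a i j + ε * d) Finset.univ (fun i => ∑ j, a i j * x j) := by
  induction js generalizing x with
  | nil => simpa [mixedDeriv] using prod_le_prod_mulVec a ha d hd hrow hcol x hx
  | cons j js ih =>
    obtain ⟨hj, hjs⟩ := List.nodup_cons.mp hjs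
    have hlen : js.length < Fintype.card V := by
      have h := List.Nodup.length_le_card (l := j :: js) (List.nodup_cons.mpr ⟨hj, hjs⟩)
      simpa using h
    have h := capacity_step a ha d hd hrow ε hε (js.map fun j i => a i j + ε * d) (by
      intro w hw i
      obtain ⟨k, -, rfl⟩ := List.mem_map.mp hw
      have := ha i k
      positivity) (by simpa using hlen) js.toFinsetᶜ (d ^ Fintype.card V / Real.exp 1 ^ js.length)
      (by positivity) (ih hjs) j (by simpa using hj) x hx
    convert h using 2
    · rw [List.length_cons, pow_succ, div_div]
    · congr 1
      ext k
      simp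
    · simp

theorem mixedDeriv_univ_const (ws : List (V → ℝ)) (S : Finset V) (hS : S.card = ws.length)
    (y y' : V → ℝ) : mixedDeriv ws S y = mixedDeriv ws S y' := by
  induction ws generalizing S with
  | nil => simp [Finset.card_eq_zero.mp hS, mixedDeriv]
  | cons w ws ih =>
    simp only [mixedDeriv]
    refine Finset.sum_congr rfl fun i hi => ?_
    rw [ih _ (by rw [Finset.card_erase_of_mem hi, hS]; simp)]

/-- The mixed derivative in all coordinate columns is at least the van der Waerden value. -/
theorem le_mixedDeriv_columns [Fintype V] (a : V → V → ℝ) (ha : ∀ i j, 0 ≤ a i j) (d : ℝ) (hd : 0 < d)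
    (hrow : ∀ i, ∑ j, a i j = d) (hcol : ∀ j, ∑ i, a i j = d) :
    (d / Real.exp 1) ^ Fintype.card V ≤
      mixedDeriv (Finset.univ.toList.map fun j i => a i j) Finset.univ (fun _ => 1) := by
  have h1 : ∀ ε : ℝ, 0 < ε → (d / Real.exp 1) ^ Fintype.card V ≤
      mixedDeriv (Finset.univ.toList.map fun j i => a i j + ε * d) Finset.univ (fun _ => 1) := by
    intro ε hε
    have h := capacity_iterate a ha d hd hrow hcol ε hε Finset.univ.toList (Finset.nodup_toList _)
      (fun _ => 1) (fun _ => one_pos)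
    rw [mixedDeriv_univ_const _ _ (by simp) _ (fun _ => 1)] at h
    simpa [div_pow] using h
  have hcont : Continuous fun ε : ℝ =>
      mixedDeriv (Finset.univ.toList.map fun j i => a i j + ε * d) Finset.univ (fun _ => 1) := by
    have := continuous_mixedDeriv (X := ℝ)
      ((Finset.univ : Finset V).toList.map fun j ε i => a i j + ε * d) (by
        intro w hw
        obtain ⟨k, -, rfl⟩ := List.mem_map.mp hw
        fun_prop) Finset.univ (fun _ _ => 1) (by fun_prop)
    simpa [Function.comp_def] using this
  have h2 := (hcont.tendsto 0).mono_left (nhdsWithin_le_nhds (s := Set.Ioi 0))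
  have h3 := ge_of_tendsto h2 (Filter.eventually_of_mem self_mem_nhdsWithin fun ε hε => h1 ε hε)
  simpa using h3

/-- The lists `m` of distinct elements of `S` matched entry by entry with `l` along `r`. -/
def matchingLists (r : V → V → Prop) [DecidableRel r] : List V → Finset V → Finset (List V)
  | [], _ => {[]}
  | v :: l, S => (S.filter fun i => r i v).biUnion fun i =>
      (matchingLists r l (S.erase i)).image (i :: ·)

/-- Expanding the derivatives one column at a time picks a new row each time; when `l` lists all
vertices and `S` is everything, this is the permanent. -/
theorem card_matchingLists (r : V → V → Prop) [DecidableRel r] (l : List V) (S : Finset V) :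
    ((matchingLists r l S).card : ℝ) =
      mixedDeriv (l.map fun j i => if r i j then (1 : ℝ) else 0) S (fun _ => 1) := by
  induction l generalizing S with
  | nil => simp [matchingLists, mixedDeriv]
  | cons v l ih =>
    simp only [matchingLists, mixedDeriv, List.map_cons]
    rw [Finset.card_biUnion]
    · rw [Finset.sum_filter]
      push_cast
      refine Finset.sum_congr rfl fun i _ => ?_
      split_ifs
      · rw [Finset.card_image_of_injective _ (List.cons_injective), ih]; simp
      · simp
    · intro i _ j _ hij
      rw [Function.onFun, Finset.disjoint_left]
      intro m h1 h2
      obtain ⟨m1, -, rfl⟩ := Finset.mem_image.mp h1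
      obtain ⟨m2, -, h⟩ := Finset.mem_image.mp h2
      exact hij (List.cons.inj h).1.symm

theorem matchingLists_spec (r : V → V → Prop) [DecidableRel r] (l : List V) (S : Finset V)
    (m : List V) (hm : m ∈ matchingLists r l S) :
    m.Nodup ∧ (∀ i ∈ m, i ∈ S) ∧ List.Forall₂ (fun j i => r i j) l m := by
  induction l generalizing S m with
  | nil =>
    simp only [matchingLists, Finset.mem_singleton] at hm
    subst hm
    simp
  | cons v l ih =>
    simp only [matchingLists, Finset.mem_biUnion, Finset.mem_filter, Finset.mem_image] at hm
    obtain ⟨i, ⟨hi, hr⟩, m, hm, rfl⟩ := hm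
    obtain ⟨h1, h2, h3⟩ := ih _ _ hm
    refine ⟨List.nodup_cons.mpr ⟨fun h => by simpa using h2 i h, h1⟩, ?_, .cons hr h3⟩
    intro k hk
    rcases List.mem_cons.mp hk with rfl | hk
    · exact hi
    · exact Finset.mem_of_mem_erase (h2 k hk)

/-- The number of perfect matchings of a symmetric relation all of whose degrees are `d` is at
least `(d / e) ^ n`. -/
theorem le_card_perfectMatchings [Fintype V] (r : V → V → Prop) [DecidableRel r] (hsymm : ∀ u v, r u v → r v u) (d : ℕ)
    (hd : 0 < d) (hdeg : ∀ v, (Finset.univ.filter fun u => r v u).card = d) :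
    ((d : ℝ) / Real.exp 1) ^ Fintype.card V ≤
      (perfectMatchings fun v => Finset.univ.filter fun u => r v u).card := by
  have hrow : ∀ i, ∑ j, (if r i j then (1 : ℝ) else 0) = d := fun i => by
    rw [Finset.sum_boole, hdeg]
  have hcol : ∀ j, ∑ i, (if r i j then (1 : ℝ) else 0) = d := fun j => by
    rw [← hrow j]
    refine Finset.sum_congr rfl fun i _ => ?_
    rw [if_congr (Iff.intro (hsymm i j) (hsymm j i)) rfl rfl]
  refine (le_mixedDeriv_columns (fun i j => if r i j then (1 : ℝ) else 0)
    (fun i j => by split_ifs <;> norm_num) d (by exact_mod_cast hd) hrow hcol).trans ?_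
  rw [← card_matchingLists]
  have hex : ∀ m ∈ matchingLists r Finset.univ.toList Finset.univ,
      ∃ e : V ≃ V, (∀ v, r v (e v)) ∧ Finset.univ.toList.map e = m := fun m hm => by
    obtain ⟨h1, -, h3⟩ := matchingLists_spec r _ _ m hm
    have hlen := h3.length_eq
    set l : List V := Finset.univ.toList with hl
    have hlm : ∀ v : V, l.idxOf v < l.length := fun v =>
      List.idxOf_lt_length_iff.mpr (by simp [hl])
    -- The list `m` records the rows chosen for the columns in the order of `l`, so a column is sent
    -- to the entry at its own position. Symmetry of `r` exchanges the roles of rows and columns.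
    let f : V → V := fun v => m[l.idxOf v]'(hlen ▸ hlm v)
    have hf : Function.Injective f := fun u v huv => by
      have := (List.Nodup.getElem_inj_iff h1).mp huv
      exact (List.idxOf_inj (by simp [hl])).mp this
    refine ⟨Equiv.ofBijective f (Finite.injective_iff_bijective.mp hf), fun v => ?_, ?_⟩
    · have := (List.forall₂_iff_get.mp h3).2 (l.idxOf v) (hlm v) (hlen ▸ hlm v)
      simp only [List.get_eq_getElem, List.getElem_idxOf] at this
      exact hsymm _ _ this
    · refine List.ext_getElem (by simpa using hlen) fun k h1 h2 => ?_
      simp only [List.getElem_map, Equiv.ofBijective_apply, f]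
      congr 1
      exact List.Nodup.idxOf_getElem (Finset.nodup_toList _) _ _
  choose! e he using hex
  exact_mod_cast Finset.card_le_card_of_injOn e
    (fun m hm => by
      simp only [Finset.mem_coe, mem_perfectMatchings, Finset.mem_filter, Finset.mem_univ, true_and]
      exact (he m hm).1)
    (fun m hm m' hm' h => by rw [← (he m hm).2, ← (he m' hm').2, h])

end mixedDeriv

/-! ### Consequences of the eigenvalue bound: edge distribution, expansion, connectedness. -/

namespace SimpleGraph

open Matrix

variable {V : Type*} [Fintype V] [DecidableEq V] (G : SimpleGraph V) [DecidableRel G.Adj]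

/-- The number of ordered pairs `(s, t)` with `s ∈ S`, `t ∈ T` and `s` adjacent to `t`. -/
def edgeCount (S T : Finset V) : ℕ := ∑ v ∈ S, (G.neighborFinset v ∩ T).card

/-- The real indicator vector of a finset. -/
def indVec (S : Finset V) : V → ℝ := fun v => if v ∈ S then 1 else 0

variable {G}

theorem indVec_dotProduct (S : Finset V) (x : V → ℝ) : indVec S ⬝ᵥ x = ∑ v ∈ S, x v := by
  simp [dotProduct, indVec, Finset.sum_ite_mem]

theorem adjMatrix_mulVec_indVec_apply (T : Finset V) (v : V) :
    (G.adjMatrix ℝ *ᵥ indVec T) v = (G.neighborFinset v ∩ T).card := by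
  rw [adjMatrix_mulVec_apply]
  simp [indVec, Finset.sum_ite_mem]

theorem indVec_dotProduct_adjMatrix (S T : Finset V) :
    indVec S ⬝ᵥ (G.adjMatrix ℝ *ᵥ indVec T) = G.edgeCount S T := by
  rw [indVec_dotProduct, edgeCount]
  push_cast
  exact Finset.sum_congr rfl fun v _ => adjMatrix_mulVec_indVec_apply T v

theorem indVec_dotProduct_indVec_self (S : Finset V) : indVec S ⬝ᵥ indVec S = S.card := by
  rw [indVec_dotProduct, Finset.sum_congr rfl (g := fun _ => (1 : ℝ))]
  · simp
  · intro v hv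
    simp [indVec, hv]

theorem dotProduct_adjMatrix_mulVec_comm (x y : V → ℝ) :
    x ⬝ᵥ (G.adjMatrix ℝ *ᵥ y) = y ⬝ᵥ (G.adjMatrix ℝ *ᵥ x) := by
  rw [dotProduct_mulVec, ← mulVec_transpose, transpose_adjMatrix, dotProduct_comm]

theorem adjMatrix_mulVec_one {d : ℕ} (hreg : G.IsRegularOfDegree d) :
    G.adjMatrix ℝ *ᵥ (fun _ => (1 : ℝ)) = fun _ => (d : ℝ) := by
  ext v
  rw [adjMatrix_mulVec_apply]
  simp [hreg v]

/-- The quadratic form of the adjacency matrix is bounded by the second eigenvalue on vectors of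
sum zero. -/
theorem dotProduct_adjMatrix_mulVec_le {d : ℕ} (hreg : G.IsRegularOfDegree d) {lam : ℝ}
    (hlam : G.NontrivialEigenvaluesLE lam) (hlt : lam < d) (x : V → ℝ) (hx : ∑ v, x v = 0) :
    x ⬝ᵥ (G.adjMatrix ℝ *ᵥ x) ≤ lam * (x ⬝ᵥ x) := by
  rcases isEmpty_or_nonempty V with hV | hV
  · simp [dotProduct]
  let hH := G.adjMatrix_real_isHermitian
  let b : V → V → ℝ := fun i => (hH.eigenvectorBasis i).ofLp
  have hb : ∀ i, G.adjMatrix ℝ *ᵥ b i = hH.eigenvalues i • b i := fun i => hH.mulVec_eigenvectorBasis i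
  have hpars : ∀ y z : V → ℝ, ∑ i, (b i ⬝ᵥ y) * (b i ⬝ᵥ z) = y ⬝ᵥ z := fun y z => by
    have h := hH.eigenvectorBasis.sum_inner_mul_inner (WithLp.toLp 2 y) (WithLp.toLp 2 z)
    simp only [EuclideanSpace.inner_eq_star_dotProduct, star_trivial] at h
    rw [dotProduct_comm y z, ← h]
    refine Finset.sum_congr rfl fun i _ => ?_
    rw [dotProduct_comm (b i) z]
  have heig : ∀ i y, b i ⬝ᵥ (G.adjMatrix ℝ *ᵥ y) = hH.eigenvalues i * (b i ⬝ᵥ y) := fun i y => by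
    rw [dotProduct_adjMatrix_mulVec_comm, hb, dotProduct_smul, dotProduct_comm,
      smul_eq_mul]
  obtain ⟨i₀, hi₀⟩ : ∃ i₀ : V, ∀ i ≠ i₀, hH.eigenvalues i ≤ lam := by
    refine ⟨Fintype.equivOfCardEq (Fintype.card_fin _) ⟨0, Fintype.card_pos⟩, fun i hi => ?_⟩
    refine hlam _ fun h => hi ?_
    rw [← Equiv.symm_apply_eq]
    exact Fin.ext h
  -- The constant vector has eigenvalue `d`, and the eigenvalues other than that of `i₀` are at most
  -- `lam < d`; so it is orthogonal to their eigenvectors and spans the line of `b i₀`. No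
  -- Perron–Frobenius argument is needed.
  have hone : ∀ i ≠ i₀, b i ⬝ᵥ (fun _ => 1) = 0 := fun i hi => by
    have h := heig i (fun _ => 1)
    rw [adjMatrix_mulVec_one hreg, show (fun _ : V => (d : ℝ)) = (d : ℝ) • (fun _ => (1 : ℝ)) by
      ext; simp, dotProduct_smul, smul_eq_mul] at h
    by_contra h0
    have := mul_right_cancel₀ h0 h
    linarith [hi₀ i hi]
  have hsum1 : (fun _ => (1 : ℝ)) ⬝ᵥ x = 0 := by simpa [dotProduct] using hx
  have h0 : b i₀ ⬝ᵥ x = 0 := by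
    have h1 := hpars (fun _ => 1) x
    rw [hsum1, Finset.sum_eq_single i₀ (fun i _ hi => by rw [hone i hi, zero_mul]) (by simp)] at h1
    have h2 := hpars (fun _ => 1) (fun _ => 1)
    rw [Finset.sum_eq_single i₀ (fun i _ hi => by rw [hone i hi, zero_mul]) (by simp)] at h2
    rcases mul_eq_zero.mp h1 with h3 | h3
    · rw [h3] at h2
      simp [dotProduct, eq_comm] at h2
    · exact h3
  rw [← hpars x, ← hpars x x, Finset.mul_sum]
  refine Finset.sum_le_sum fun i _ => ?_
  rw [heig]
  rcases eq_or_ne i i₀ with rfl | hi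
  · simp [h0]
  · nlinarith [hi₀ i hi, mul_self_nonneg (b i ⬝ᵥ x)]

variable {d : ℕ} {lam : ℝ}

/-- The quadratic form is evaluated at the indicator of `U` minus its mean. Only an upper bound on
the eigenvalues enters, so very negative ones, such as `-d` in the bipartite case, do no harm. -/
theorem edgeCount_self_le (hreg : G.IsRegularOfDegree d)
    (hlam : G.NontrivialEigenvaluesLE lam) (hlt : lam < d) (U : Finset V) :
    (G.edgeCount U U : ℝ) ≤ U.card * (d * (U.card / Fintype.card V) +
      lam * (1 - U.card / Fintype.card V)) := by
  rcases isEmpty_or_nonempty V with hV | hV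
  · simp [edgeCount, Subsingleton.elim U ∅]
  have hn : (0 : ℝ) < Fintype.card V := by exact_mod_cast Fintype.card_pos
  set n : ℝ := (Fintype.card V : ℝ) with hn'
  set u : ℝ := (U.card : ℝ) with hu
  have h := dotProduct_adjMatrix_mulVec_le hreg hlam hlt
    (indVec U - (u / n) • fun _ => (1 : ℝ)) (by
      simp [indVec, Finset.sum_sub_distrib, ← hn', ← hu]; field_simp; simp)
  have h1 : indVec U ⬝ᵥ (fun _ => (1 : ℝ)) = u := by rw [indVec_dotProduct]; simp [hu]
  have h2 : (fun _ : V => (1 : ℝ)) ⬝ᵥ (fun _ => (1 : ℝ)) = n := by simp [dotProduct, hn']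
  have h3 : (fun _ : V => (d : ℝ)) = (d : ℝ) • (fun _ => (1 : ℝ)) := by ext; simp
  simp only [mulVec_sub, mulVec_smul, sub_dotProduct, dotProduct_sub, smul_dotProduct,
    dotProduct_smul, adjMatrix_mulVec_one hreg, h3, smul_eq_mul, indVec_dotProduct_adjMatrix,
    indVec_dotProduct_indVec_self, h1, h2, dotProduct_comm (fun _ => (1 : ℝ)) (indVec U),
    dotProduct_adjMatrix_mulVec_comm (fun _ => (1 : ℝ)) (indVec U)] at h
  rw [← hu] at h
  have e1 : u / n * n = u := by field_simp
  rw [e1] at h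
  have e2 : u * (d * (u / n) + lam * (1 - u / n)) =
    u / n * (d * u) + lam * (u - u / n * u) := by ring
  rw [e2]
  linarith

/-- `A` is one side of a bipartition of `G`. -/
def IsSide (G : SimpleGraph V) (A : Finset V) : Prop := ∀ u v, G.Adj u v → (u ∈ A ↔ v ∉ A)

theorem IsSide.compl {A : Finset V} (hA : IsSide G A) : IsSide G Aᶜ := fun u v h => by
  have := hA u v h
  simp only [Finset.mem_compl]
  tauto

theorem IsSide.mulVec_indVec {A : Finset V} (hA : IsSide G A) (hreg : G.IsRegularOfDegree d) :
    G.adjMatrix ℝ *ᵥ indVec A = (d : ℝ) • indVec Aᶜ := by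
  ext v
  rw [adjMatrix_mulVec_indVec_apply]
  by_cases hv : v ∈ A
  · have : G.neighborFinset v ∩ A = ∅ := by
      ext u
      simp only [Finset.mem_inter, mem_neighborFinset, Finset.notMem_empty, iff_false, not_and]
      exact fun h => (hA v u h).mp hv
    simp [this, indVec, hv]
  · have : G.neighborFinset v ∩ A = G.neighborFinset v := by
      refine Finset.inter_eq_left.mpr fun u hu => ?_
      have := hA v u ((G.mem_neighborFinset v u).mp hu)
      tauto
    rw [this, card_neighborFinset_eq_degree, hreg v]
    simp [indVec, hv]

theorem IsSide.card_eq {A : Finset V} (hA : IsSide G A) (hreg : G.IsRegularOfDegree d)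
    (hd : 0 < d) : A.card = Aᶜ.card := by
  have h1 : indVec A ⬝ᵥ (G.adjMatrix ℝ *ᵥ indVec Aᶜ) = d * A.card := by
    rw [hA.compl.mulVec_indVec hreg, compl_compl, dotProduct_smul, indVec_dotProduct_indVec_self,
      smul_eq_mul]
  have h2 : indVec Aᶜ ⬝ᵥ (G.adjMatrix ℝ *ᵥ indVec A) = d * Aᶜ.card := by
    rw [hA.mulVec_indVec hreg, dotProduct_smul, indVec_dotProduct_indVec_self, smul_eq_mul]
  rw [dotProduct_adjMatrix_mulVec_comm, h2] at h1
  have := mul_left_cancel₀ (by positivity) h1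
  exact_mod_cast this.symm

/-- The bipartite expander mixing lemma. -/
theorem IsSide.mixing {A : Finset V} (hA : IsSide G A) (hreg : G.IsRegularOfDegree d)
    (hd : 0 < d) (hlam0 : 0 < lam) (hlam : G.NontrivialEigenvaluesLE lam) (hlt : lam < d)
    {S T : Finset V} (hS : S ⊆ A) (hT : T ⊆ Aᶜ) :
    ((G.edgeCount S T : ℝ) - d * S.card * T.card / A.card) ^ 2 ≤ lam ^ 2 * S.card * T.card := by
  rcases S.eq_empty_or_nonempty with rfl | hne
  · simp [edgeCount]
  have hs : (0 : ℝ) < S.card := by exact_mod_cast hne.card_pos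
  have hm : (0 : ℝ) < A.card := by exact_mod_cast (hne.mono hS).card_pos
  have hmc : (Aᶜ.card : ℝ) = A.card := by exact_mod_cast (hA.card_eq hreg hd).symm
  set s : ℝ := (S.card : ℝ)
  set τ : ℝ := (T.card : ℝ)
  set m : ℝ := (A.card : ℝ)
  set Δ : ℝ := (G.edgeCount S T : ℝ) - d * s * τ / m with hΔ
  set f : V → ℝ := indVec S - (s / m) • indVec A with hf
  set g : V → ℝ := indVec T - (τ / m) • indVec Aᶜ with hg
  have hSA : indVec S ⬝ᵥ indVec A = s := by
    rw [indVec_dotProduct, Finset.sum_congr rfl (g := fun _ => (1 : ℝ))]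
    · simp [s]
    · intro v hv; simp [indVec, hS hv]
  have hSA' : indVec S ⬝ᵥ indVec Aᶜ = 0 := by
    rw [indVec_dotProduct]
    exact Finset.sum_eq_zero fun v hv => by simp [indVec, hS hv]
  have hTA : indVec T ⬝ᵥ indVec Aᶜ = τ := by
    rw [indVec_dotProduct, Finset.sum_congr rfl (g := fun _ => (1 : ℝ))]
    · simp [τ]
    · intro v hv
      have := hT hv
      simp only [indVec, this, if_true]
  have hTA' : indVec T ⬝ᵥ indVec A = 0 := by
    rw [indVec_dotProduct]
    refine Finset.sum_eq_zero fun v hv => ?_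
    have := Finset.mem_compl.mp (hT hv)
    simp [indVec, this]
  have hAA : indVec A ⬝ᵥ indVec Aᶜ = 0 := by
    rw [indVec_dotProduct]
    exact Finset.sum_eq_zero fun v hv => by simp [indVec, hv]
  have hST : indVec S ⬝ᵥ indVec T = 0 := by
    rw [indVec_dotProduct]
    refine Finset.sum_eq_zero fun v hv => ?_
    have : v ∉ T := fun h => Finset.mem_compl.mp (hT h) (hS hv)
    simp [indVec, this]
  have hSS : (G.edgeCount S S : ℝ) = 0 := by
    norm_cast
    refine Finset.sum_eq_zero fun v hv => Finset.card_eq_zero.mpr ?_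
    ext u
    simp only [Finset.mem_inter, mem_neighborFinset, Finset.notMem_empty, iff_false, not_and]
    exact fun h h' => (hA v u h).mp (hS hv) (hS h')
  have hTT : (G.edgeCount T T : ℝ) = 0 := by
    norm_cast
    refine Finset.sum_eq_zero fun v hv => Finset.card_eq_zero.mpr ?_
    ext u
    simp only [Finset.mem_inter, mem_neighborFinset, Finset.notMem_empty, iff_false, not_and]
    exact fun h h' => (hA.compl v u h).mp (hT hv) (hT h')
  have hM1 := hA.mulVec_indVec hreg
  have hM2 := hA.compl.mulVec_indVec hreg
  rw [compl_compl] at hM2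
  have hff : f ⬝ᵥ f = s - s ^ 2 / m := by
    simp only [hf, sub_dotProduct, dotProduct_sub, smul_dotProduct, dotProduct_smul, smul_eq_mul,
      indVec_dotProduct_indVec_self, hSA, dotProduct_comm (indVec A) (indVec S)]
    field_simp
    ring
  have hgg : g ⬝ᵥ g = τ - τ ^ 2 / m := by
    simp only [hg, sub_dotProduct, dotProduct_sub, smul_dotProduct, dotProduct_smul, smul_eq_mul,
      indVec_dotProduct_indVec_self, hTA, dotProduct_comm (indVec Aᶜ) (indVec T), hmc]
    field_simp
    ring
  have hfg : f ⬝ᵥ g = 0 := by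
    simp only [hf, hg, sub_dotProduct, dotProduct_sub, smul_dotProduct, dotProduct_smul,
      smul_eq_mul, hST, hSA', hAA, dotProduct_comm (indVec A) (indVec T), hTA']
    ring
  have hAST : indVec A ⬝ᵥ (G.adjMatrix ℝ *ᵥ indVec T) = d * τ := by
    rw [dotProduct_adjMatrix_mulVec_comm, hM1, dotProduct_smul, hTA, smul_eq_mul]
  have hfAg : f ⬝ᵥ (G.adjMatrix ℝ *ᵥ g) = Δ := by
    simp only [hf, hg, mulVec_sub, mulVec_smul, sub_dotProduct, dotProduct_sub, smul_dotProduct,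
      dotProduct_smul, smul_eq_mul, indVec_dotProduct_adjMatrix, hM2, hAST, hSA,
      indVec_dotProduct_indVec_self, hΔ]
    rw [show (A.card : ℝ) = m from rfl]
    field_simp
    ring
  have hfAf : f ⬝ᵥ (G.adjMatrix ℝ *ᵥ f) = 0 := by
    simp only [hf, mulVec_sub, mulVec_smul, sub_dotProduct, dotProduct_sub, smul_dotProduct,
      dotProduct_smul, smul_eq_mul, indVec_dotProduct_adjMatrix, hM1, hAA, hSA', hSS,
      dotProduct_adjMatrix_mulVec_comm (indVec A) (indVec S)]
    ring
  have hgAg : g ⬝ᵥ (G.adjMatrix ℝ *ᵥ g) = 0 := by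
    simp only [hg, mulVec_sub, mulVec_smul, sub_dotProduct, dotProduct_sub, smul_dotProduct,
      dotProduct_smul, smul_eq_mul, indVec_dotProduct_adjMatrix, hM2, hTA', hTT,
      dotProduct_adjMatrix_mulVec_comm (indVec Aᶜ) (indVec T), dotProduct_comm (indVec Aᶜ), hAA]
    ring
  have hsum : ∀ x : V → ℝ, ∑ v, x v = x ⬝ᵥ (indVec A + indVec Aᶜ) := fun x => by
    refine Finset.sum_congr rfl fun v _ => ?_
    by_cases hv : v ∈ A <;> simp [indVec, hv]
  -- The forms of `f` and `g` with themselves vanish because the graph is bipartite, leaving the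
  -- cross term 2 lam s Δ². Half of it is absorbed by the right-hand side. Putting Δ into the
  -- coefficient handles both signs of the deviation at once, so the one-sided eigenvalue bound
  -- suffices.
  have h := dotProduct_adjMatrix_mulVec_le hreg hlam hlt (Δ • f + (lam * s) • g) (by
    rw [hsum]
    simp only [hf, hg, add_dotProduct, sub_dotProduct, smul_dotProduct, dotProduct_add, hSA, hSA',
      hTA, hTA', hAA, dotProduct_comm (indVec Aᶜ) (indVec A), indVec_dotProduct_indVec_self, hmc,
      smul_eq_mul]
    field_simp
    ring)
  simp only [mulVec_add, mulVec_smul, add_dotProduct, dotProduct_add, smul_dotProduct,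
    dotProduct_smul, smul_eq_mul, hfAg, hfAf, hgAg, hff, hgg, hfg, dotProduct_comm g f,
    dotProduct_adjMatrix_mulVec_comm g f] at h
  have h1 : 0 ≤ Δ ^ 2 * (s ^ 2 / m) := by positivity
  have h2 : 0 ≤ (lam * s) ^ 2 * (τ ^ 2 / m) := by positivity
  have h3 : (lam * s) * Δ ^ 2 ≤ (lam * s) * (lam ^ 2 * s * τ) := by nlinarith
  exact le_of_mul_le_mul_left h3 (by positivity)

theorem edgeCount_eq_zero {S T : Finset V} (h : ∀ u ∈ S, ∀ v ∈ T, ¬ G.Adj u v) :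
    G.edgeCount S T = 0 := by
  refine Finset.sum_eq_zero fun v hv => Finset.card_eq_zero.mpr ?_
  ext u
  simp only [Finset.mem_inter, mem_neighborFinset, Finset.notMem_empty, iff_false, not_and]
  exact fun h1 h2 => h v hv u h2 h1

theorem edgeCount_of_subset (hreg : G.IsRegularOfDegree d) {S T : Finset V}
    (h : ∀ u ∈ S, ∀ v, G.Adj u v → v ∈ T) : G.edgeCount S T = d * S.card := by
  rw [edgeCount, Finset.sum_congr rfl (g := fun _ => d)]
  · simp [mul_comm]
  · intro v hv
    rw [Finset.inter_eq_left.mpr fun u hu => h v hv u ((G.mem_neighborFinset v u).mp hu),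
      card_neighborFinset_eq_degree, hreg v]

/-- Large sets in opposite sides span an edge. -/
theorem IsSide.card_mul_card_le {A : Finset V} (hA : IsSide G A) (hreg : G.IsRegularOfDegree d)
    (hd : 0 < d) (hlam0 : 0 < lam) (hlam : G.NontrivialEigenvaluesLE lam) (hlt : lam < d)
    {S T : Finset V} (hS : S ⊆ A) (hT : T ⊆ Aᶜ) (h : ∀ u ∈ S, ∀ v ∈ T, ¬ G.Adj u v) :
    (d : ℝ) ^ 2 * (S.card * T.card) ≤ lam ^ 2 * A.card ^ 2 := by
  rcases (S.card * T.card).eq_zero_or_pos with h0 | h0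
  · have : ((S.card * T.card : ℕ) : ℝ) = 0 := by exact_mod_cast h0
    push_cast at this
    rw [this, mul_zero]
    positivity
  have hp : (0 : ℝ) < S.card * T.card := by exact_mod_cast h0
  have hs : 0 < S.card := Nat.pos_of_mul_pos_right h0
  have hm : (0 : ℝ) < A.card := by exact_mod_cast hs.trans_le (Finset.card_le_card hS)
  have hmix := hA.mixing hreg hd hlam0 hlam hlt hS hT
  rw [edgeCount_eq_zero h] at hmix
  have h1 : ((0 : ℕ) - (d : ℝ) * S.card * T.card / A.card) ^ 2 =
      (S.card * T.card) * (d ^ 2 * (S.card * T.card)) / A.card ^ 2 := by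
    push_cast; ring
  rw [h1, div_le_iff₀ (by positivity)] at hmix
  refine le_of_mul_le_mul_left (hmix.trans (le_of_eq ?_)) hp
  ring

/-- Small sets inside one side expand by a factor of eight. -/
theorem IsSide.card_neighbors_ge {A : Finset V} (hA : IsSide G A) (hreg : G.IsRegularOfDegree d)
    (hd : 0 < d) (hlam0 : 0 < lam) (hlam : G.NontrivialEigenvaluesLE lam) (hgap : 6 * lam < d)
    {S T : Finset V} (hS : S ⊆ A) (hcard : 16 * S.card ≤ A.card)
    (hT : ∀ u ∈ S, ∀ v, G.Adj u v → v ∈ T) : 8 * S.card ≤ T.card := by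
  rcases S.eq_empty_or_nonempty with rfl | hne
  · simp
  by_contra! hlt
  set T' := T ∩ Aᶜ with hT'
  have hN : ∀ u ∈ S, ∀ v, G.Adj u v → v ∈ T' := fun u hu v huv =>
    Finset.mem_inter.mpr ⟨hT u hu v huv, Finset.mem_compl.mpr ((hA u v huv).mp (hS hu))⟩
  have hle : T'.card ≤ T.card := Finset.card_le_card Finset.inter_subset_left
  have hmix := hA.mixing hreg hd hlam0 hlam (by linarith) hS (T := T') Finset.inter_subset_right
  rw [edgeCount_of_subset hreg hN] at hmix
  have hs : (0 : ℝ) < S.card := by exact_mod_cast hne.card_pos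
  have hm : (0 : ℝ) < A.card := by exact_mod_cast (hne.mono hS).card_pos
  have ht : (T'.card : ℝ) ≤ 8 * S.card := by exact_mod_cast hle.trans hlt.le
  have hsm : 16 * (S.card : ℝ) ≤ A.card := by exact_mod_cast hcard
  have hd0 : (0 : ℝ) < d := by exact_mod_cast hd
  have h1 : (d : ℝ) * S.card * T'.card / A.card ≤ d * S.card / 2 := by
    rw [div_le_iff₀ hm]
    have : 2 * (T'.card : ℝ) ≤ A.card := by linarith
    nlinarith [mul_pos hd0 hs]
  push_cast at hmix
  -- With fewer than 8|S| neighbors at most half of the d|S| edges are expected, so the deviation is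
  -- at least half of them. The mixing lemma then gives d² ≤ 32 lam², against 6 lam < d.
  have h2 : ((d : ℝ) * S.card / 2) ^ 2 ≤
      ((d : ℝ) * S.card - d * S.card * T'.card / A.card) ^ 2 := by
    refine pow_le_pow_left₀ (by positivity) (by linarith) 2
  have h3 : lam ^ 2 * S.card * T'.card ≤ lam ^ 2 * S.card * (8 * S.card) := by gcongr
  have h4 : (S.card : ℝ) ^ 2 * (d ^ 2) ≤ S.card ^ 2 * (32 * lam ^ 2) := by nlinarith
  have h5 := le_of_mul_le_mul_left h4 (by positivity)
  nlinarith

/-- A graph with a spectral gap has no proper nonempty vertex set without leaving edges. -/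
theorem eq_univ_of_closed (hreg : G.IsRegularOfDegree d)
    (hlam : G.NontrivialEigenvaluesLE lam) (hlt : lam < d) {U : Finset V} (hU : U.Nonempty)
    (hcl : ∀ u ∈ U, ∀ v, G.Adj u v → v ∈ U) : U = Finset.univ := by
  have h := edgeCount_self_le hreg hlam hlt U
  rw [edgeCount_of_subset hreg hcl] at h
  have hu : (0 : ℝ) < U.card := by exact_mod_cast hU.card_pos
  have hn : (0 : ℝ) < Fintype.card V := by exact_mod_cast hU.card_pos.trans_le (Finset.card_le_univ U)
  push_cast at h
  rw [mul_comm] at h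
  have h2 := le_of_mul_le_mul_left h hu
  have h3 : 1 ≤ (U.card : ℝ) / Fintype.card V := by nlinarith
  rw [le_div_iff₀ hn, one_mul] at h3
  exact Finset.eq_univ_of_card U (le_antisymm (Finset.card_le_univ U) (by exact_mod_cast h3))

/-- The second eigenvalue is not small unless the graph is dense. -/
theorem one_sub_le_of_adj (hreg : G.IsRegularOfDegree d) (hlam0 : 0 < lam)
    (hlam : G.NontrivialEigenvaluesLE lam) (hlt : lam < d) {a b : V} (hab : G.Adj a b) :
    1 - 2 * (d : ℝ) / Fintype.card V ≤ lam := by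
  have h := edgeCount_self_le hreg hlam hlt {a, b}
  have hn : (0 : ℝ) < Fintype.card V := by
    have : Nonempty V := ⟨a⟩
    exact_mod_cast Fintype.card_pos
  have h1 : G.neighborFinset a ∩ {a, b} = {b} := by
    ext v
    simp only [Finset.mem_inter, mem_neighborFinset, Finset.mem_insert, Finset.mem_singleton]
    constructor
    · rintro ⟨h1, rfl | rfl⟩
      · exact absurd h1 (G.loopless.irrefl _)
      · rfl
    · rintro rfl
      exact ⟨hab, Or.inr rfl⟩
  have h2 : G.neighborFinset b ∩ {a, b} = {a} := by
    ext v
    simp only [Finset.mem_inter, mem_neighborFinset, Finset.mem_insert, Finset.mem_singleton]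
    constructor
    · rintro ⟨h1, rfl | rfl⟩
      · rfl
      · exact absurd h1 (G.loopless.irrefl _)
    · rintro rfl
      exact ⟨hab.symm, Or.inl rfl⟩
  rw [edgeCount, Finset.sum_pair hab.ne, h1, h2, Finset.card_pair hab.ne] at h
  simp only [Finset.card_singleton] at h
  push_cast at h
  have h3 : 0 ≤ lam * (2 / Fintype.card V) := by positivity
  have h4 : 2 * (d : ℝ) / Fintype.card V = d * (2 / Fintype.card V) := by ring
  rw [h4]
  linarith

end SimpleGraph

/-! ### Permutations along edges and vertex lists of walks. -/

namespace SimpleGraph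

variable {V : Type*} [Fintype V] [DecidableEq V] (G : SimpleGraph V) [DecidableRel G.Adj]

/-- The permutations that move every vertex of `R` along an edge and fix all other vertices. -/
def factorPerms (R : Finset V) : Finset (Equiv.Perm V) :=
  Finset.univ.filter fun σ => ∀ v, if v ∈ R then G.Adj v (σ v) else σ v = v

variable {G} {d : ℕ} {lam : ℝ}

theorem adj_of_mem_factorPerms {R : Finset V} {σ : Equiv.Perm V} (hσ : σ ∈ G.factorPerms R) {v : V}
    (hv : v ∈ R) : G.Adj v (σ v) := by
  have := (Finset.mem_filter.mp hσ).2 v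
  rwa [if_pos hv] at this

theorem apply_eq_of_mem_factorPerms {R : Finset V} {σ : Equiv.Perm V} (hσ : σ ∈ G.factorPerms R)
    {v : V} (hv : v ∉ R) : σ v = v := by
  have := (Finset.mem_filter.mp hσ).2 v
  rwa [if_neg hv] at this

theorem apply_mem_of_mem_factorPerms {R : Finset V} {σ : Equiv.Perm V} (hσ : σ ∈ G.factorPerms R)
    (v : V) : σ v ∈ R ↔ v ∈ R := by
  refine ⟨fun h => ?_, fun h => ?_⟩
  · by_contra hv
    rw [apply_eq_of_mem_factorPerms hσ hv] at h
    exact hv h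
  · by_contra hv
    have := σ.injective (apply_eq_of_mem_factorPerms hσ hv)
    rw [this] at hv
    exact hv h

/-- In its averaged form the Bregman–Minc bound needs only the mean degree inside `R`, and
`edgeCount_self_le` controls exactly that. -/
theorem card_factorPerms_le (hreg : G.IsRegularOfDegree d)
    (hlam : G.NontrivialEigenvaluesLE lam) (hlt : lam < d) (R : Finset V) :
    ((G.factorPerms R).card : ℝ) ≤ ((d * (R.card / Fintype.card V) +
      lam * (1 - R.card / Fintype.card V) + (2 + 2 * Real.log d)) / Real.exp 1) ^ R.card := by
  have h1 : (G.factorPerms R).card ≤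
      (perfectMatchings fun v : R => (G.neighborFinset v).subtype (· ∈ R)).card := by
    rcases (G.factorPerms R).eq_empty_or_nonempty with h0 | ⟨σ₀, hσ₀⟩
    · simp [h0]
    -- As before, `σ₀` only fills in the unused branch.
    refine Finset.card_le_card_of_injOn
      (fun σ => if h : ∀ v, σ v ∈ R ↔ v ∈ R then σ.subtypePerm h
        else σ₀.subtypePerm (apply_mem_of_mem_factorPerms hσ₀)) ?_ ?_
    · intro σ hσ
      have hσ : σ ∈ G.factorPerms R := hσ
      simp only [apply_mem_of_mem_factorPerms hσ, implies_true, dite_true, Finset.mem_coe,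
        mem_perfectMatchings, Finset.mem_subtype, mem_neighborFinset]
      exact fun a => adj_of_mem_factorPerms hσ a.2
    · intro σ hσ τ hτ h
      have hσ : σ ∈ G.factorPerms R := hσ
      have hτ : τ ∈ G.factorPerms R := hτ
      simp only [apply_mem_of_mem_factorPerms hσ, apply_mem_of_mem_factorPerms hτ, implies_true,
        dite_true] at h
      ext v
      by_cases hv : v ∈ R
      · have := congrArg (fun f : Equiv.Perm R => (f ⟨v, hv⟩ : V)) h
        simpa using this
      · rw [apply_eq_of_mem_factorPerms hσ hv, apply_eq_of_mem_factorPerms hτ hv]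
  have hcard : ∀ v : R, ((G.neighborFinset v).subtype (· ∈ R)).card =
      (G.neighborFinset v ∩ R).card := fun v => by
    rw [Finset.card_subtype, Finset.filter_mem_eq_inter]
  have h2 := card_perfectMatchings_le (fun v : R => (G.neighborFinset v).subtype (· ∈ R)) d
    (fun v => by
      rw [hcard]
      refine (Finset.card_le_card Finset.inter_subset_left).trans ?_
      rw [card_neighborFinset_eq_degree, hreg v])
    (d * (R.card / Fintype.card V) + lam * (1 - R.card / Fintype.card V)) (by
      have h3 := edgeCount_self_le hreg hlam hlt R
      rw [Fintype.card_coe]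
      refine le_trans (le_of_eq ?_) h3
      rw [edgeCount]
      push_cast
      rw [← Finset.sum_coe_sort R]
      exact Finset.sum_congr rfl fun v _ => by rw [hcard])
  rw [Fintype.card_coe] at h2
  exact le_trans (by exact_mod_cast h1) h2

variable (G) in
/-- The vertex lists of the walks with `k` edges starting at `v`. -/
def walkLists : ℕ → V → Finset (List V)
  | 0, v => {[v]}
  | k + 1, v => (G.neighborFinset v).biUnion fun u => (walkLists k u).image (v :: ·)

theorem card_walkLists_le (hreg : G.IsRegularOfDegree d) (k : ℕ) (v : V) :
    (G.walkLists k v).card ≤ d ^ k := by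
  induction k generalizing v with
  | zero => simp [walkLists]
  | succ k ih =>
    rw [walkLists]
    refine Finset.card_biUnion_le.trans ((Finset.sum_le_card_nsmul _ _ (d ^ k) fun u _ =>
      Finset.card_image_le.trans (ih u)).trans ?_)
    rw [card_neighborFinset_eq_degree, hreg v, smul_eq_mul, pow_succ, mul_comm]

theorem iterate_mem_walkLists {R : Finset V} {σ : Equiv.Perm V} (hσ : σ ∈ G.factorPerms R) {v : V}
    (hv : v ∈ R) (k : ℕ) : List.iterate σ v (k + 1) ∈ G.walkLists k v := by
  induction k generalizing v with
  | zero => simp [walkLists]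
  | succ k ih =>
    rw [walkLists, Finset.mem_biUnion]
    refine ⟨σ v, by simpa using adj_of_mem_factorPerms hσ hv, Finset.mem_image.mpr
      ⟨_, ih ((apply_mem_of_mem_factorPerms hσ v).mpr hv), ?_⟩⟩
    simp [List.iterate]

end SimpleGraph

/-! ### Orbits of a permutation as lists. -/

section Orbits

variable {V : Type*} [Fintype V] [DecidableEq V]

/-- The orbit of `v` under `σ`, listed from `v`. -/
noncomputable def orbitList (σ : Equiv.Perm V) (v : V) : List V :=
  List.iterate σ v (Function.minimalPeriod σ v)

theorem minimalPeriod_perm_pos (σ : Equiv.Perm V) (v : V) : 0 < Function.minimalPeriod σ v :=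
  Function.minimalPeriod_pos_of_mem_periodicPts
    (Function.Injective.mem_periodicPts σ.injective v)

theorem mem_orbitList {σ : Equiv.Perm V} {v x : V} :
    x ∈ orbitList σ v ↔ ∃ i : ℕ, σ^[i] v = x := by
  rw [orbitList, List.mem_iterate]
  constructor
  · rintro ⟨i, -, rfl⟩
    exact ⟨i, rfl⟩
  · rintro ⟨i, rfl⟩
    exact ⟨i % Function.minimalPeriod σ v, Nat.mod_lt _ (minimalPeriod_perm_pos σ v),
      (Function.iterate_mod_minimalPeriod_eq).symm⟩

theorem apply_mem_orbitList {σ : Equiv.Perm V} {v x : V} :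
    σ x ∈ orbitList σ v ↔ x ∈ orbitList σ v := by
  simp only [mem_orbitList]
  constructor
  · rintro ⟨i, hi⟩
    rcases i with _ | i
    · refine ⟨Function.minimalPeriod σ v - 1, σ.injective ?_⟩
      rw [← hi, ← Function.iterate_succ_apply' σ,
        Nat.succ_eq_add_one, Nat.sub_add_cancel (minimalPeriod_perm_pos σ v)]
      exact Function.iterate_minimalPeriod
    · refine ⟨i, σ.injective ?_⟩
      rw [← hi, Function.iterate_succ_apply']
  · rintro ⟨i, rfl⟩
    exact ⟨i + 1, Function.iterate_succ_apply' σ i v⟩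

theorem nodup_orbitList (σ : Equiv.Perm V) (v : V) : (orbitList σ v).Nodup := by
  rw [List.nodup_iff_injective_getElem]
  intro i j hij
  have hi := i.2
  have hj := j.2
  simp only [orbitList, List.length_iterate] at hi hj
  simp only [orbitList, List.getElem_iterate] at hij
  exact Fin.ext ((Function.iterate_injOn_Iio_minimalPeriod (f := σ) (x := v)) hi hj hij)

theorem length_orbitList (σ : Equiv.Perm V) (v : V) :
    (orbitList σ v).length = Function.minimalPeriod σ v := by
  simp [orbitList]

theorem mem_orbitList_self (σ : Equiv.Perm V) (v : V) : v ∈ orbitList σ v :=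
  mem_orbitList.mpr ⟨0, rfl⟩

/-- Two permutations with the same orbit list at `v` agree on it. -/
theorem apply_eq_of_orbitList_eq {σ τ : Equiv.Perm V} {v x : V}
    (h : orbitList σ v = orbitList τ v) (hx : x ∈ orbitList σ v) : σ x = τ x := by
  have hlen : Function.minimalPeriod σ v = Function.minimalPeriod τ v := by
    rw [← length_orbitList, h, length_orbitList]
  have hit : ∀ i, σ^[i] v = τ^[i] v := fun i => by
    rw [← Function.iterate_mod_minimalPeriod_eq (f := σ),
      ← Function.iterate_mod_minimalPeriod_eq (f := τ), ← hlen]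
    have hi := Nat.mod_lt i (minimalPeriod_perm_pos σ v)
    have h1 : (orbitList σ v)[i % Function.minimalPeriod σ v]'(by rwa [length_orbitList]) =
        (orbitList τ v)[i % Function.minimalPeriod σ v]'(by
          rw [length_orbitList, ← hlen]; exact hi) := by
      simp only [h]
    simpa [orbitList] using h1
  obtain ⟨i, rfl⟩ := mem_orbitList.mp hx
  calc σ (σ^[i] v) = σ^[i + 1] v := (Function.iterate_succ_apply' σ i v).symm
    _ = τ^[i + 1] v := hit _
    _ = τ (τ^[i] v) := Function.iterate_succ_apply' τ i v
    _ = τ (σ^[i] v) := by rw [hit]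

/-- The permutation that agrees with `σ` off the orbit of `v` and fixes that orbit. -/
noncomputable def offOrbit (σ : Equiv.Perm V) (v : V) : Equiv.Perm V :=
  (σ.subtypePerm (p := fun x => x ∉ orbitList σ v)
    (fun _ => not_congr apply_mem_orbitList)).ofSubtype

theorem offOrbit_apply_of_mem {σ : Equiv.Perm V} {v x : V} (hx : x ∈ orbitList σ v) :
    offOrbit σ v x = x :=
  Equiv.Perm.ofSubtype_apply_of_not_mem _ (by simpa using hx)

theorem offOrbit_apply_of_notMem {σ : Equiv.Perm V} {v x : V} (hx : x ∉ orbitList σ v) :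
    offOrbit σ v x = σ x :=
  (Equiv.Perm.ofSubtype_apply_of_mem (p := fun x => x ∉ orbitList σ v) _ hx).trans (by simp)

theorem iterate_offOrbit {σ : Equiv.Perm V} {v x : V} (hx : x ∉ orbitList σ v) (i : ℕ) :
    (offOrbit σ v)^[i] x = σ^[i] x ∧ σ^[i] x ∉ orbitList σ v := by
  induction i with
  | zero => exact ⟨rfl, hx⟩
  | succ i ih =>
    rw [Function.iterate_succ_apply', Function.iterate_succ_apply', ih.1,
      offOrbit_apply_of_notMem ih.2]
    exact ⟨rfl, fun h => ih.2 (apply_mem_orbitList.mp h)⟩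

/-- The vertices of `S` lie in distinct orbits of `σ`, each of length at most `L`. -/
def InDistinctShortOrbits (σ : Equiv.Perm V) (L : ℕ) (S : Finset V) : Prop :=
  (∀ v ∈ S, Function.minimalPeriod σ v ≤ L) ∧ ∀ u ∈ S, ∀ v ∈ S, u ≠ v → v ∉ orbitList σ u

/-- Orbits other than that of `v` are untouched, so short orbits can be peeled off one at a time. -/
theorem InDistinctShortOrbits.offOrbit {σ : Equiv.Perm V} {L : ℕ} {S : Finset V} {v : V}
    (h : InDistinctShortOrbits σ L (insert v S)) (hv : v ∉ S) :
    InDistinctShortOrbits (offOrbit σ v) L S := by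
  have hS : ∀ u ∈ S, u ∉ orbitList σ v := fun u hu =>
    h.2 v (by simp) u (by simp [hu]) (by rintro rfl; exact hv hu)
  refine ⟨fun u hu => ?_, fun u hu w hw huw hmem => ?_⟩
  · refine le_trans ?_ (h.1 u (by simp [hu]))
    refine Function.IsPeriodicPt.minimalPeriod_le (minimalPeriod_perm_pos σ u) ?_
    rw [Function.IsPeriodicPt, Function.IsFixedPt, (iterate_offOrbit (hS u hu) _).1]
    exact Function.iterate_minimalPeriod
  · obtain ⟨i, hi⟩ := mem_orbitList.mp hmem
    rw [(iterate_offOrbit (hS u hu) _).1] at hi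
    exact h.2 u (by simp [hu]) w (by simp [hw]) huw (mem_orbitList.mpr ⟨i, hi⟩)

/-- Every invariant set is a disjoint union of listed orbits. -/
theorem exists_orbitLists (σ : Equiv.Perm V) (R : Finset V) (hR : ∀ x ∈ R, σ x ∈ R) :
    ∃ Cs : List (List V), Cs.flatten.Nodup ∧ (∀ x, x ∈ Cs.flatten ↔ x ∈ R) ∧
      ∀ C ∈ Cs, ∃ v, C = orbitList σ v := by
  induction hk : R.card using Nat.strong_induction_on generalizing R with
  | _ k ih =>
    rcases R.eq_empty_or_nonempty with rfl | ⟨v, hv⟩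
    · exact ⟨[], by simp⟩
    have horb : ∀ x ∈ orbitList σ v, x ∈ R := fun x hx => by
      obtain ⟨i, rfl⟩ := mem_orbitList.mp hx
      clear hx
      induction i with
      | zero => exact hv
      | succ i ih => rw [Function.iterate_succ_apply']; exact hR _ ih
    obtain ⟨Cs, h1, h2, h3⟩ := ih (R \ (orbitList σ v).toFinset).card (by
        rw [← hk]
        refine Finset.card_lt_card (Finset.ssubset_iff_subset_ne.mpr ⟨Finset.sdiff_subset, ?_⟩)
        intro h
        rw [← h] at hv
        simp [mem_orbitList_self] at hv)
      (R \ (orbitList σ v).toFinset) (fun x hx => by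
        simp only [Finset.mem_sdiff, List.mem_toFinset] at hx ⊢
        exact ⟨hR x hx.1, fun h => hx.2 (apply_mem_orbitList.mp h)⟩) rfl
    refine ⟨orbitList σ v :: Cs, ?_, fun x => ?_, ?_⟩
    · rw [List.flatten_cons, List.nodup_append']
      refine ⟨nodup_orbitList σ v, h1, fun x hx hx' => ?_⟩
      have := (h2 x).mp hx'
      simp [hx] at this
    · rw [List.flatten_cons, List.mem_append, h2]
      simp only [Finset.mem_sdiff, List.mem_toFinset]
      have := horb x
      tauto
    · intro C hC
      rcases List.mem_cons.mp hC with rfl | hC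
      · exact ⟨v, rfl⟩
      · exact h3 C hC

/-- A permutation without `t` vertices in distinct short orbits has few orbits. -/
theorem length_orbitLists_le {σ : Equiv.Perm V} {L t : ℕ}
    (hbad : ¬ ∃ S : Finset V, S.card = t ∧ InDistinctShortOrbits σ L S)
    (Cs : List (List V)) (hnd : Cs.flatten.Nodup) (horb : ∀ C ∈ Cs, ∃ v, C = orbitList σ v) :
    L * Cs.length ≤ L * t + Fintype.card V := by
  -- One representative is taken from each short orbit; every other orbit uses up more than `L`
  -- entries of the flattened list.
  have hkey : ∀ Cs : List (List V), Cs.flatten.Nodup → (∀ C ∈ Cs, ∃ v, C = orbitList σ v) →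
      ∃ S : Finset V, InDistinctShortOrbits σ L S ∧ (∀ v ∈ S, v ∈ Cs.flatten) ∧
        L * Cs.length ≤ L * S.card + Cs.flatten.length := by
    intro Cs
    induction Cs with
    | nil => exact fun _ _ => ⟨∅, ⟨by simp, by simp⟩, by simp, by simp⟩
    | cons C Cs ih =>
      intro hnd horb
      rw [List.flatten_cons, List.nodup_append'] at hnd
      obtain ⟨S, h1, h2, h3⟩ := ih hnd.2.1 fun C hC => horb C (by simp [hC])
      obtain ⟨v, rfl⟩ := horb C (by simp)
      have hvS : v ∉ S := fun h => hnd.2.2 (mem_orbitList_self σ v) (h2 v h)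
      by_cases hL : Function.minimalPeriod σ v ≤ L
      · refine ⟨insert v S, ⟨?_, ?_⟩, ?_, ?_⟩
        · intro u hu
          rcases Finset.mem_insert.mp hu with rfl | hu
          · exact hL
          · exact h1.1 u hu
        · intro u hu w hw huw hmem
          rcases Finset.mem_insert.mp hu with rfl | huS
          · rcases Finset.mem_insert.mp hw with rfl | hw
            · exact huw rfl
            · exact hnd.2.2 hmem (h2 w hw)
          · rcases Finset.mem_insert.mp hw with rfl | hw
            · have h5 : u ∈ orbitList σ w := by
                obtain ⟨i, hi⟩ := mem_orbitList.mp hmem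
                have h6 : ∀ j, σ^[j] u ∈ orbitList σ w → u ∈ orbitList σ w := by
                  intro j
                  induction j with
                  | zero => exact id
                  | succ j ih =>
                    rw [Function.iterate_succ_apply']
                    exact fun h => ih (apply_mem_orbitList.mp h)
                exact h6 i (hi ▸ mem_orbitList_self σ w)
              exact hnd.2.2 h5 (h2 u huS)
            · exact h1.2 u huS w hw huw hmem
        · intro u hu
          rw [List.flatten_cons, List.mem_append]
          rcases Finset.mem_insert.mp hu with rfl | hu
          · exact Or.inl (mem_orbitList_self σ u)
          · exact Or.inr (h2 u hu)
        · rw [Finset.card_insert_of_notMem hvS, List.flatten_cons, List.length_append,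
            List.length_cons]
          nlinarith
      · refine ⟨S, h1, fun u hu => by rw [List.flatten_cons, List.mem_append]
                                      exact Or.inr (h2 u hu), ?_⟩
        rw [List.flatten_cons, List.length_append, List.length_cons, length_orbitList]
        have : L * (Cs.length + 1) = L * Cs.length + L := by ring
        omega
  obtain ⟨S, h1, -, h3⟩ := hkey Cs hnd horb
  have hS : S.card < t := by
    by_contra! h
    obtain ⟨S', hS', hc⟩ := Finset.exists_subset_card_eq h
    exact hbad ⟨S', hc, fun v hv => h1.1 v (hS' hv), fun u hu v hv => h1.2 u (hS' hu) v (hS' hv)⟩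
  have h4 := hnd.length_le_card
  have : L * S.card ≤ L * t := Nat.mul_le_mul_left _ hS.le
  omega

end Orbits

/-! ### Counting the permutations with many short orbits. -/

namespace SimpleGraph

variable {V : Type*} [Fintype V] [DecidableEq V] {G : SimpleGraph V} [DecidableRel G.Adj]
  {d : ℕ}

-- The orbit of one vertex of `S` is peeled off: it is a walk from that vertex, with at most d^k
-- choices for k + 1 vertices, and what is left is a permutation of the same kind on a smaller set.
-- Each deleted vertex contributes a factor η, of order 1/d in the application. The budget `M` keeps
-- every set that arises within the range of `hbound`.
open Classical in
theorem card_inDistinctShortOrbits_le (hreg : G.IsRegularOfDegree d) (L M : ℕ) (Γ η : ℝ)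
    (hΓ : 0 ≤ Γ) (hη : 0 ≤ η)
    (hbound : ∀ R : Finset V, Rᶜ.card ≤ M → ((G.factorPerms R).card : ℝ) ≤ Γ * η ^ Rᶜ.card)
    (S R : Finset V) (hSR : S ⊆ R) (hM : Rᶜ.card + S.card * L ≤ M) :
    (((G.factorPerms R).filter fun σ => InDistinctShortOrbits σ L S).card : ℝ) ≤
      Γ * η ^ Rᶜ.card * (∑ k ∈ Finset.range L, (d : ℝ) ^ k * η ^ (k + 1)) ^ S.card := by
  induction S using Finset.induction_on generalizing R with
  | empty =>
    simp only [Finset.card_empty, pow_zero, mul_one]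
    refine le_trans ?_ (hbound R (by simpa using hM))
    exact_mod_cast Finset.card_filter_le _ _
  | insert v S hv ih =>
    rw [Finset.card_insert_of_notMem hv] at hM ⊢
    have hvR : v ∈ R := hSR (by simp)
    -- The codes are pairs of a possible orbit of `v` and a permutation of what remains; the orbit
    -- must avoid `S` for the induction hypothesis to apply.
    let D : Finset (List V × Equiv.Perm V) :=
      (Finset.range L).biUnion fun k => ((G.walkLists k v).filter fun C =>
        C.Nodup ∧ C.length = k + 1 ∧ (∀ x ∈ C, x ∈ R) ∧ Disjoint S C.toFinset).biUnion fun C =>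
        ((G.factorPerms (R \ C.toFinset)).filter fun σ => InDistinctShortOrbits σ L S).image (C, ·)
    have h1 : ((G.factorPerms R).filter fun σ => InDistinctShortOrbits σ L (insert v S)).card ≤
        D.card := by
      refine Finset.card_le_card_of_injOn (fun σ => (orbitList σ v, offOrbit σ v)) ?_ ?_
      · intro σ hσ
        obtain ⟨hσ, hdis⟩ := Finset.mem_filter.mp (Finset.mem_coe.mp hσ)
        have hpos := minimalPeriod_perm_pos σ v
        obtain ⟨k, hk⟩ : ∃ k, Function.minimalPeriod σ v = k + 1 :=
          ⟨_, (Nat.sub_add_cancel hpos).symm⟩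
        have hkL := hdis.1 v (by simp)
        have hinR : ∀ x ∈ orbitList σ v, x ∈ R := fun x hx => by
          obtain ⟨i, rfl⟩ := mem_orbitList.mp hx
          clear hx
          induction i with
          | zero => exact hvR
          | succ i ih =>
            rw [Function.iterate_succ_apply']
            exact (apply_mem_of_mem_factorPerms hσ _).mpr ih
        simp only [D, Finset.coe_biUnion, Set.mem_iUnion, Finset.mem_coe]
        refine ⟨k, Finset.mem_range.mpr (by omega), orbitList σ v, ?_, ?_⟩
        · refine Finset.mem_filter.mpr ⟨?_, nodup_orbitList σ v, by rw [length_orbitList, hk], hinR,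
            ?_⟩
          · rw [orbitList, hk]
            exact iterate_mem_walkLists hσ hvR k
          · rw [Finset.disjoint_left]
            intro u hu hu'
            exact hdis.2 v (by simp) u (by simp [hu]) (by rintro rfl; exact hv hu)
              (List.mem_toFinset.mp hu')
        · refine Finset.mem_image.mpr ⟨offOrbit σ v, Finset.mem_filter.mpr ⟨?_, hdis.offOrbit hv⟩,
            rfl⟩
          refine Finset.mem_filter.mpr ⟨Finset.mem_univ _, fun x => ?_⟩
          by_cases hx : x ∈ orbitList σ v
          · rw [if_neg (by simp [hx])]
            exact offOrbit_apply_of_mem hx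
          · rw [offOrbit_apply_of_notMem hx]
            by_cases hxR : x ∈ R
            · rw [if_pos (by simp [hx, hxR])]
              exact adj_of_mem_factorPerms hσ hxR
            · rw [if_neg (by simp [hxR])]
              exact apply_eq_of_mem_factorPerms hσ hxR
      · intro σ _ τ _ h
        simp only [Prod.mk.injEq] at h
        ext x
        by_cases hx : x ∈ orbitList σ v
        · exact apply_eq_of_orbitList_eq h.1 hx
        · rw [← offOrbit_apply_of_notMem hx, h.2, offOrbit_apply_of_notMem (h.1 ▸ hx)]
    set W : ℝ := ∑ k ∈ Finset.range L, (d : ℝ) ^ k * η ^ (k + 1) with hW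
    have hW0 : 0 ≤ W := Finset.sum_nonneg fun k _ => by positivity
    have h2 : (D.card : ℝ) ≤ ∑ k ∈ Finset.range L, (d : ℝ) ^ k *
        (Γ * η ^ (Rᶜ.card + (k + 1)) * W ^ S.card) := by
      have h3 : D.card ≤ ∑ k ∈ Finset.range L, ∑ C ∈ (G.walkLists k v).filter fun C =>
          C.Nodup ∧ C.length = k + 1 ∧ (∀ x ∈ C, x ∈ R) ∧ Disjoint S C.toFinset,
          ((G.factorPerms (R \ C.toFinset)).filter fun σ => InDistinctShortOrbits σ L S).card :=
        Finset.card_biUnion_le.trans (Finset.sum_le_sum fun k _ =>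
          Finset.card_biUnion_le.trans (Finset.sum_le_sum fun C _ => Finset.card_image_le))
      have h4 : (D.card : ℝ) ≤ ∑ k ∈ Finset.range L, ∑ C ∈ (G.walkLists k v).filter fun C =>
          C.Nodup ∧ C.length = k + 1 ∧ (∀ x ∈ C, x ∈ R) ∧ Disjoint S C.toFinset,
          (((G.factorPerms (R \ C.toFinset)).filter fun σ =>
            InDistinctShortOrbits σ L S).card : ℝ) := by
        exact_mod_cast h3
      refine h4.trans (Finset.sum_le_sum fun k hk => ?_)
      have h5 : ∀ C ∈ (G.walkLists k v).filter fun C =>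
          C.Nodup ∧ C.length = k + 1 ∧ (∀ x ∈ C, x ∈ R) ∧ Disjoint S C.toFinset,
          (((G.factorPerms (R \ C.toFinset)).filter fun σ =>
            InDistinctShortOrbits σ L S).card : ℝ) ≤ Γ * η ^ (Rᶜ.card + (k + 1)) * W ^ S.card := by
        intro C hC
        obtain ⟨-, hnd, hlen, hCR, hdisj⟩ := Finset.mem_filter.mp hC
        have hc : (R \ C.toFinset)ᶜ.card = Rᶜ.card + (k + 1) := by
          rw [show (R \ C.toFinset)ᶜ = C.toFinset ∪ Rᶜ by ext x; simp; tauto,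
            Finset.card_union_of_disjoint, List.toFinset_card_of_nodup hnd,
            hlen, add_comm]
          rw [Finset.disjoint_left]
          intro x hx hx'
          exact Finset.mem_compl.mp hx' (hCR x (List.mem_toFinset.mp hx))
        rw [← hc]
        refine ih _ (fun u hu => Finset.mem_sdiff.mpr ⟨hSR (by simp [hu]),
          Finset.disjoint_left.mp hdisj hu⟩) ?_
        rw [hc]
        have := Finset.mem_range.mp hk
        nlinarith
      refine (Finset.sum_le_card_nsmul _ _ _ h5).trans ?_
      rw [nsmul_eq_mul]
      refine mul_le_mul_of_nonneg_right ?_ (by positivity)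
      exact_mod_cast (Finset.card_filter_le _ _).trans (card_walkLists_le hreg k v)
    refine le_trans (by exact_mod_cast h1) (h2.trans (le_of_eq ?_))
    have h6 : ∀ k ∈ Finset.range L, (d : ℝ) ^ k * (Γ * η ^ (Rᶜ.card + (k + 1)) * W ^ S.card) =
        (d : ℝ) ^ k * η ^ (k + 1) * (Γ * η ^ Rᶜ.card * W ^ S.card) := fun k _ => by
      rw [pow_add]; ring
    rw [Finset.sum_congr rfl h6, ← Finset.sum_mul, ← hW, pow_succ]
    ring

open Classical in
/-- Few permutations have many short orbits. -/
theorem card_manyShortOrbits_le (hreg : G.IsRegularOfDegree d) (L t : ℕ) (Γ η : ℝ)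
    (hΓ : 0 ≤ Γ) (hη : 0 ≤ η)
    (hbound : ∀ R : Finset V, Rᶜ.card ≤ t * L → ((G.factorPerms R).card : ℝ) ≤ Γ * η ^ Rᶜ.card) :
    (((G.factorPerms Finset.univ).filter fun σ =>
      ∃ S : Finset V, S.card = t ∧ InDistinctShortOrbits σ L S).card : ℝ) ≤
      (Fintype.card V).choose t *
        (Γ * (∑ k ∈ Finset.range L, (d : ℝ) ^ k * η ^ (k + 1)) ^ t) := by
  have h1 : ((G.factorPerms Finset.univ).filter fun σ =>
      ∃ S : Finset V, S.card = t ∧ InDistinctShortOrbits σ L S) ⊆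
      (Finset.powersetCard t Finset.univ).biUnion fun S =>
        (G.factorPerms Finset.univ).filter fun σ => InDistinctShortOrbits σ L S := by
    intro σ hσ
    obtain ⟨hσ, S, hS, h⟩ := Finset.mem_filter.mp hσ
    exact Finset.mem_biUnion.mpr ⟨S, by simp [hS], Finset.mem_filter.mpr ⟨hσ, h⟩⟩
  have h2 := (Finset.card_le_card h1).trans Finset.card_biUnion_le
  have h3 : (((G.factorPerms Finset.univ).filter fun σ =>
      ∃ S : Finset V, S.card = t ∧ InDistinctShortOrbits σ L S).card : ℝ) ≤
      ∑ S ∈ Finset.powersetCard t (Finset.univ : Finset V),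
        (((G.factorPerms Finset.univ).filter fun σ => InDistinctShortOrbits σ L S).card : ℝ) := by
    exact_mod_cast h2
  refine h3.trans ((Finset.sum_le_card_nsmul _ _
    (Γ * (∑ k ∈ Finset.range L, (d : ℝ) ^ k * η ^ (k + 1)) ^ t) fun S hS => ?_).trans ?_)
  · have hc := (Finset.mem_powersetCard.mp hS).2
    have := card_inDistinctShortOrbits_le hreg L (t * L) Γ η hΓ hη hbound S Finset.univ
      (Finset.subset_univ S) (by simp [hc])
    simpa [hc] using this
  · rw [Finset.card_powersetCard, Finset.card_univ, nsmul_eq_mul]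

end SimpleGraph

/-! ### Edges of a path given as a list. -/

section PathEdges

variable {V : Type*} [DecidableEq V]

/-- The set of unordered pairs of consecutive entries of a list. -/
def pathEdges : List V → Finset (Sym2 V)
  | [] => ∅
  | [_] => ∅
  | a :: b :: l => insert s(a, b) (pathEdges (b :: l))

theorem mem_of_mem_pathEdges {l : List V} {x y : V} (h : s(x, y) ∈ pathEdges l) : x ∈ l ∧ y ∈ l := by
  induction l with
  | nil => simp [pathEdges] at h
  | cons a l ih =>
    cases l with
    | nil => simp [pathEdges] at h
    | cons b l =>
      rw [pathEdges, Finset.mem_insert, Sym2.eq_iff] at h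
      rcases h with (⟨rfl, rfl⟩ | ⟨rfl, rfl⟩) | h
      · simp
      · simp
      · have := ih h
        exact ⟨List.mem_cons_of_mem _ this.1, List.mem_cons_of_mem _ this.2⟩

theorem pathEdges_append_cons_cons (l : List V) (p w : V) (l' : List V) :
    pathEdges (l ++ p :: w :: l') = pathEdges (l ++ [p]) ∪ insert s(p, w) (pathEdges (w :: l')) := by
  induction l with
  | nil => simp [pathEdges]
  | cons a l ih =>
    cases l with
    | nil => simp [pathEdges, Finset.insert_comm]
    | cons b l =>
      simp only [List.cons_append, pathEdges] at ih ⊢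
      rw [ih, Finset.insert_union]

theorem pathEdges_concat_concat (l : List V) (p w : V) :
    pathEdges (l ++ [p, w]) = insert s(p, w) (pathEdges (l ++ [p])) := by
  rw [pathEdges_append_cons_cons]
  ext; simp [pathEdges, or_comm]

theorem pathEdges_reverse (l : List V) : pathEdges l.reverse = pathEdges l := by
  induction l with
  | nil => rfl
  | cons a l ih =>
    cases l with
    | nil => rfl
    | cons b l =>
      rw [pathEdges, ← ih]
      simp only [List.reverse_cons, List.append_assoc, List.cons_append, List.nil_append]
      rw [pathEdges_concat_concat, Sym2.eq_swap]

theorem pathEdges_subset_of_infix {l l' : List V} (h : l <:+: l') : pathEdges l ⊆ pathEdges l' := by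
  obtain ⟨s, t, rfl⟩ := h
  have hpre : pathEdges l ⊆ pathEdges (l ++ t) := by
    rcases List.eq_nil_or_concat l with rfl | ⟨l, p, rfl⟩
    · simp [pathEdges]
    cases t with
    | nil => simp
    | cons w t =>
      simp only [List.append_assoc, List.cons_append, List.nil_append, List.concat_eq_append]
      rw [pathEdges_append_cons_cons]
      exact Finset.subset_union_left
  refine hpre.trans ?_
  rw [List.append_assoc]
  rcases List.eq_nil_or_concat s with rfl | ⟨s, p, rfl⟩
  · simp
  cases h : l ++ t with
  | nil => simp [pathEdges]
  | cons w t =>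
    simp only [List.append_assoc, List.cons_append, List.nil_append, List.concat_eq_append]
    rw [pathEdges_append_cons_cons]
    exact (Finset.subset_insert _ _).trans Finset.subset_union_right

theorem neighbor_cases {l l' : List V} {p w : V} (hnd : (l ++ p :: l').Nodup)
    (h : s(p, w) ∈ pathEdges (l ++ p :: l')) : l.getLast? = some w ∨ l'.head? = some w := by
  have hp1 : p ∉ l := fun h1 => (List.nodup_append'.mp hnd).2.2 h1 (by simp)
  have hp2 : p ∉ l' := (List.nodup_cons.mp (List.nodup_append'.mp hnd).2.1).1
  have hright : s(p, w) ∈ pathEdges (p :: l') → l'.head? = some w := fun h => by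
    cases l' with
    | nil => simp [pathEdges] at h
    | cons c l' =>
      rw [pathEdges, Finset.mem_insert, Sym2.eq_iff] at h
      rcases h with (⟨-, rfl⟩ | ⟨rfl, -⟩) | h
      · rfl
      · simp at hp2
      · exact absurd (mem_of_mem_pathEdges h).1 hp2
  rcases List.eq_nil_or_concat l with rfl | ⟨l, q, rfl⟩
  · exact Or.inr (hright h)
  · simp only [List.append_assoc, List.cons_append, List.nil_append, List.concat_eq_append] at h hp1
    rw [pathEdges_append_cons_cons, Finset.mem_union, Finset.mem_insert, Sym2.eq_iff] at h
    rcases h with h | (⟨rfl, -⟩ | ⟨-, rfl⟩) | h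
    · exact absurd (mem_of_mem_pathEdges h).1 hp1
    · simp at hp1
    · left; simp
    · exact Or.inr (hright h)

/-- The neighbors of `p` along the path `l`. -/
def pathNeighbors [Fintype V] (l : List V) (p : V) : Finset V :=
  Finset.univ.filter fun w => s(p, w) ∈ pathEdges l

theorem card_pathNeighbors_le [Fintype V] {l : List V} (hnd : l.Nodup) (p : V) :
    (pathNeighbors l p).card ≤ 2 := by
  by_cases hp : p ∈ l
  · obtain ⟨l₁, l₂, rfl⟩ := List.append_of_mem hp
    have h : pathNeighbors (l₁ ++ p :: l₂) p ⊆ l₁.getLast?.toFinset ∪ l₂.head?.toFinset := by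
      intro w hw
      have := neighbor_cases hnd (Finset.mem_filter.mp hw).2
      simpa [Option.mem_toFinset] using this
    refine (Finset.card_le_card h).trans ((Finset.card_union_le _ _).trans ?_)
    have h1 : ∀ o : Option V, o.toFinset.card ≤ 1 := fun o => by cases o <;> simp
    have := h1 l₁.getLast?
    have := h1 l₂.head?
    omega
  · have : pathNeighbors l p = ∅ := by
      ext w
      simp only [pathNeighbors, Finset.mem_filter, Finset.mem_univ, true_and, Finset.notMem_empty,
        iff_false]
      exact fun h => hp (mem_of_mem_pathEdges h).1
    simp [this]

/-- If both `a` and `b` are neighbors of `w` along a path, then the predecessor of `w` is one of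
them. -/
theorem eq_or_eq_of_mem_pathEdges {l l' : List V} {p w a b : V} (hnd : (l ++ p :: w :: l').Nodup)
    (hab : a ≠ b) (ha : s(w, a) ∈ pathEdges (l ++ p :: w :: l'))
    (hb : s(w, b) ∈ pathEdges (l ++ p :: w :: l')) : p = a ∨ p = b := by
  have h1 : l ++ p :: w :: l' = (l ++ [p]) ++ w :: l' := by simp
  rw [h1] at hnd ha hb
  rcases neighbor_cases hnd ha with h | h
  · left; simpa using h
  · rcases neighbor_cases hnd hb with h' | h'
    · right; simpa using h'
    · rw [h] at h'
      exact absurd (Option.some.inj h') hab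

/-- A path whose edges lie in two vertex-disjoint paths lies in one of them. -/
theorem subset_or_subset_of_pathEdges {z l₁ l₂ : List V} (hd : List.Disjoint l₁ l₂)
    (hz : 2 ≤ z.length) (h : ∀ e ∈ pathEdges z, e ∈ pathEdges l₁ ∨ e ∈ pathEdges l₂) :
    (∀ x ∈ z, x ∈ l₁) ∧ pathEdges z ⊆ pathEdges l₁ ∨
      (∀ x ∈ z, x ∈ l₂) ∧ pathEdges z ⊆ pathEdges l₂ := by
  induction z with
  | nil => simp at hz
  | cons a z ih =>
    cases z with
    | nil => simp at hz
    | cons b z =>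
      have hab := h s(a, b) (by simp [pathEdges])
      cases z with
      | nil =>
        rcases hab with h' | h'
        · left
          have := mem_of_mem_pathEdges h'
          simp [pathEdges, h', this]
        · right
          have := mem_of_mem_pathEdges h'
          simp [pathEdges, h', this]
      | cons c z =>
        have := ih (by simp) fun e he => h e (by rw [pathEdges]; exact Finset.mem_insert_of_mem he)
        rcases this with ⟨h1, h2⟩ | ⟨h1, h2⟩
        · left
          have hb : b ∈ l₁ := h1 b (by simp)
          rcases hab with h' | h'
          · refine ⟨fun x hx => ?_, ?_⟩
            · rcases List.mem_cons.mp hx with rfl | hx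
              · exact (mem_of_mem_pathEdges h').1
              · exact h1 x hx
            · rw [pathEdges]
              exact Finset.insert_subset h' h2
          · exact absurd (mem_of_mem_pathEdges h').2 (hd hb)
        · right
          have hb : b ∈ l₂ := h1 b (by simp)
          rcases hab with h' | h'
          · exact absurd hb (hd (mem_of_mem_pathEdges h').2)
          · refine ⟨fun x hx => ?_, ?_⟩
            · rcases List.mem_cons.mp hx with rfl | hx
              · exact (mem_of_mem_pathEdges h').1
              · exact h1 x hx
            · rw [pathEdges]
              exact Finset.insert_subset h' h2

end PathEdges

/-! ### Pósa rotations and the growth of the set of reachable heads. -/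

namespace SimpleGraph

variable {V : Type*} [Fintype V] [DecidableEq V] {G : SimpleGraph V} [DecidableRel G.Adj]

variable (G) in
/-- `Rotates G k L L'`: the path `L'` arises from the path `L` by `k` Pósa rotations at the head. -/
inductive Rotates : ℕ → List V → List V → Prop
  | refl (L : List V) : Rotates 0 L L
  | step {k : ℕ} {L l l' : List V} {e p w : V} (h : Rotates k L (l ++ p :: w :: l'))
      (he : (l ++ [p]).head? = some e) (hadj : G.Adj e w) :
      Rotates (k + 1) L (p :: (l.reverse ++ w :: l'))

theorem Rotates.perm {k : ℕ} {L L' : List V} (h : Rotates G k L L') : L'.Perm L := by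
  induction h with
  | refl => exact List.Perm.refl _
  | @step k L l l' e p w _ _ _ ih =>
    refine List.Perm.trans ?_ ih
    have h1 : p :: (l.reverse ++ w :: l') = (l ++ [p]).reverse ++ w :: l' := by simp
    have h2 : l ++ p :: w :: l' = (l ++ [p]) ++ w :: l' := by simp
    rw [h1, h2]
    exact List.Perm.append_right _ (List.reverse_perm _)

theorem Rotates.getLast? {k : ℕ} {L L' : List V} (h : Rotates G k L L') :
    L'.getLast? = L.getLast? := by
  induction h with
  | refl => rfl
  | @step k L l l' e p w _ _ _ ih =>
    rw [← ih]
    simp [List.getLast?_cons, List.getLast?_append]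

theorem Rotates.isChain {k : ℕ} {L L' : List V} (h : Rotates G k L L') (hL : L.IsChain G.Adj) :
    L'.IsChain G.Adj := by
  induction h with
  | refl => exact hL
  | @step k L l l' e p w _ he hadj ih =>
    have ih := ih hL
    have h1 : p :: (l.reverse ++ w :: l') = (l ++ [p]).reverse ++ w :: l' := by simp
    have h2 : l ++ p :: w :: l' = (l ++ [p]) ++ w :: l' := by simp
    rw [h2, List.isChain_append] at ih
    rw [h1, List.isChain_append]
    refine ⟨?_, ih.2.1, ?_⟩
    · rw [List.isChain_reverse]
      exact ih.1.imp fun a b hab => hab.symm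
    · intro x hx y hy
      rw [List.getLast?_reverse, he] at hx
      simp only [Option.mem_def, Option.some.injEq, List.head?_cons] at hx hy
      rw [← hx, ← hy]
      exact hadj

theorem pathEdges_rotate {l l' : List V} {e p w : V} (he : (l ++ [p]).head? = some e) :
    pathEdges (p :: (l.reverse ++ w :: l')) =
      pathEdges (l ++ [p]) ∪ insert s(e, w) (pathEdges (w :: l')) := by
  have h1 : p :: (l.reverse ++ w :: l') = (l ++ [p]).reverse ++ w :: l' := by simp
  obtain ⟨t, ht⟩ : ∃ t, l ++ [p] = e :: t := by
    cases hl : l ++ [p] with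
    | nil => simp at hl
    | cons a t =>
      rw [hl] at he
      exact ⟨t, by simpa using he⟩
  rw [h1, ht, List.reverse_cons, List.append_assoc, List.cons_append, List.nil_append,
    pathEdges_append_cons_cons, ← List.reverse_cons, pathEdges_reverse]

theorem Rotates.card_sdiff_le {k : ℕ} {L L' : List V} (h : Rotates G k L L') :
    (pathEdges L \ pathEdges L').card ≤ k ∧ (pathEdges L' \ pathEdges L).card ≤ k := by
  induction h with
  | refl => simp
  | @step k L l l' e p w _ he hadj ih =>
    rw [pathEdges_append_cons_cons] at ih
    rw [pathEdges_rotate he]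
    constructor
    · refine (Finset.card_le_card (t := insert s(p, w) (pathEdges L \ (pathEdges (l ++ [p]) ∪
        insert s(p, w) (pathEdges (w :: l'))))) ?_).trans ((Finset.card_insert_le _ _).trans ?_)
      · intro x
        simp only [Finset.mem_sdiff, Finset.mem_union, Finset.mem_insert]
        tauto
      · omega
    · refine (Finset.card_le_card (t := insert s(e, w) ((pathEdges (l ++ [p]) ∪
        insert s(p, w) (pathEdges (w :: l'))) \ pathEdges L)) ?_).trans
        ((Finset.card_insert_le _ _).trans ?_)
      · intro x
        simp only [Finset.mem_sdiff, Finset.mem_union, Finset.mem_insert]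
        tauto
      · omega

/-- Pósa's lemma with pivots restricted to `W` and new endpoints avoiding `X`: under a local
expansion condition the set of reachable heads doubles with every rotation. -/
theorem posa_growth {L : List V} (hnd : L.Nodup) (hch : L.IsChain G.Adj) {v : V}
    (hv : L.head? = some v) {A : Finset V} (hA : IsSide G A) (hvA : v ∈ A) (W X : Finset V)
    (τ T : ℕ) (P : V → Prop)
    (hW : ∀ w ∈ W, w ∈ L ∧ ∃ a b, a ≠ b ∧ s(w, a) ∈ pathEdges L ∧ s(w, b) ∈ pathEdges L ∧
      a ∉ X ∧ b ∉ X)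
    (hvX : v ∉ X)
    (hP : ∀ k ≤ T, ∀ L' e, Rotates G k L L' → L'.head? = some e → P e)
    (hexp : ∀ S ⊆ A, S.Nonempty → Disjoint S X → (∀ s ∈ S, P s) → S.card ≤ τ →
      6 * S.card ≤ (W.filter fun w => ∃ s ∈ S, G.Adj s w).card) (t : ℕ) (ht : t ≤ T) :
    ∃ E ⊆ A, Disjoint E X ∧ min (2 ^ t) (τ + 1) ≤ E.card ∧ ∀ e ∈ E, ∃ k ≤ t, ∃ L',
      Rotates G k L L' ∧ L'.head? = some e ∧
        ∀ x y, s(x, y) ∈ pathEdges L → s(x, y) ∉ pathEdges L' → x ∈ E ∨ y ∈ E := by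
  induction t with
  | zero =>
    refine ⟨{v}, by simpa using hvA, by simpa using hvX, by simp, fun e he => ?_⟩
    rw [Finset.mem_singleton] at he
    subst he
    exact ⟨0, le_rfl, L, .refl L, hv, fun x y h h' => absurd h h'⟩
  | succ t ih =>
    obtain ⟨E, hEA, hEX, hcard, hE⟩ := ih (by omega)
    by_cases hτ : τ < E.card
    · refine ⟨E, hEA, hEX, (min_le_right _ _).trans hτ, fun e he => ?_⟩
      obtain ⟨k, hk, h⟩ := hE e he
      exact ⟨k, by omega, h⟩
    have hne : E.Nonempty := Finset.card_pos.mp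
      (lt_of_lt_of_le (by positivity) hcard)
    set N := W.filter fun w => ∃ s ∈ E, G.Adj s w with hN
    have hNcard : 6 * E.card ≤ N.card := hexp E hEA hne hEX (fun e he => by
      obtain ⟨k, hk, L', hrot, hhd, -⟩ := hE e he
      exact hP k (by omega) L' e hrot hhd) (not_lt.mp hτ)
    -- Pivots next to a known head along the original path are discarded. Each head spoils at most
    -- two, which leaves 4|E| of the 6|E| pivots.
    set B := E.biUnion fun a => pathNeighbors L a with hB
    have hBcard : B.card ≤ E.card * 2 :=
      Finset.card_biUnion_le_card_mul _ _ _ fun a _ => card_pathNeighbors_le hnd a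
    set N' := N \ B with hN'
    have hN'card : 4 * E.card ≤ N'.card := by
      have : N.card - B.card ≤ N'.card := Finset.le_card_sdiff B N
      omega
    have hstep : ∀ w ∈ N', ∃ p, p ∈ A ∧ p ∉ X ∧ s(p, w) ∈ pathEdges L ∧ ∃ k ≤ t + 1, ∃ L',
        Rotates G k L L' ∧ L'.head? = some p ∧ ∀ x y, s(x, y) ∈ pathEdges L →
          s(x, y) ∉ pathEdges L' → (x ∈ E ∨ y ∈ E) ∨ (x = p ∨ y = p) := by
      intro w hw
      obtain ⟨hwN, hwB⟩ := Finset.mem_sdiff.mp hw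
      obtain ⟨hwW, e, he, hadj⟩ := Finset.mem_filter.mp hwN
      obtain ⟨hwL, a, b, hab, ha, hb, haX, hbX⟩ := hW w hwW
      have hnotE : ∀ c, s(w, c) ∈ pathEdges L → c ∉ E := fun c hc hcE => hwB
        (Finset.mem_biUnion.mpr ⟨c, hcE, Finset.mem_filter.mpr ⟨Finset.mem_univ _, by
          rwa [Sym2.eq_swap]⟩⟩)
      have hwA : w ∉ A := (hA e w hadj).mp (hEA he)
      have hwE : w ∉ E := fun h => hwA (hEA h)
      obtain ⟨k, hk, L', hrot, hhd, hdel⟩ := hE e he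
      have hnd' : L'.Nodup := hrot.perm.nodup_iff.mpr hnd
      have hwL' : w ∈ L' := hrot.perm.mem_iff.mpr hwL
      obtain ⟨l, l', hl⟩ := List.append_of_mem hwL'
      -- Every deleted edge has an end in `E`, while neither `w` nor its neighbors along `L` are in
      -- `E`. Both path edges at the pivot have therefore survived.
      have hin : ∀ c, s(w, c) ∈ pathEdges L → s(w, c) ∈ pathEdges L' := fun c hc => by
        by_contra hc'
        rcases hdel w c hc hc' with h | h
        · exact hwE h
        · exact hnotE c hc h
      rcases List.eq_nil_or_concat l with rfl | ⟨l, p, rfl⟩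
      · rw [hl] at hhd
        have : w = e := by simpa using hhd
        rw [this] at hadj
        exact absurd hadj (G.loopless.irrefl e)
      have hl2 : L' = l ++ p :: w :: l' := by simpa using hl
      subst hl2
      have he' : (l ++ [p]).head? = some e := by
        rw [← hhd]
        cases l <;> simp
      -- The new head is the current predecessor of the pivot, hence one of its two original
      -- neighbors `a`, `b`, which avoid `X`.
      have hp := eq_or_eq_of_mem_pathEdges hnd' hab (hin a ha) (hin b hb)
      have hpe : s(p, w) ∈ pathEdges L := by
        rcases hp with rfl | rfl
        · rwa [Sym2.eq_swap]
        · rwa [Sym2.eq_swap]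
      have hpadj : G.Adj p w := by
        have := hrot.isChain hch
        rw [List.isChain_append] at this
        have h3 := this.2.1
        rw [List.isChain_cons_cons] at h3
        exact h3.1
      refine ⟨p, (hA p w hpadj).mpr hwA, by rcases hp with rfl | rfl <;> assumption, hpe, k + 1,
        by omega, _, hrot.step he' hadj, by simp, fun x y hxy hxy' => ?_⟩
      by_cases h4 : s(x, y) ∈ pathEdges (l ++ p :: w :: l')
      · rw [pathEdges_append_cons_cons, Finset.mem_union, Finset.mem_insert] at h4
        rw [pathEdges_rotate he', Finset.mem_union, Finset.mem_insert] at hxy'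
        rcases h4 with h4 | h4 | h4
        · exact absurd (Or.inl h4) hxy'
        · rcases Sym2.eq_iff.mp h4 with ⟨h5, -⟩ | ⟨-, h5⟩
          · exact Or.inr (Or.inl h5)
          · exact Or.inr (Or.inr h5)
        · exact absurd (Or.inr (Or.inr h4)) hxy'
      · exact Or.inl (hdel x y hxy h4)
    choose! p hpA hpX hpe hp using hstep
    refine ⟨E ∪ N'.image p, ?_, ?_, ?_, ?_⟩
    · refine Finset.union_subset hEA fun x hx => ?_
      obtain ⟨w, hw, rfl⟩ := Finset.mem_image.mp hx
      exact hpA w hw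
    · rw [Finset.disjoint_union_left]
      refine ⟨hEX, Finset.disjoint_left.mpr fun x hx => ?_⟩
      obtain ⟨w, hw, rfl⟩ := Finset.mem_image.mp hx
      exact hpX w hw
    · have h1 : N'.card ≤ 2 * (N'.image p).card := by
        refine Finset.card_le_mul_card_image N' 2 fun x _ => ?_
        refine (Finset.card_le_card fun w hw => ?_).trans (card_pathNeighbors_le hnd x)
        obtain ⟨hw', rfl⟩ := Finset.mem_filter.mp hw
        exact Finset.mem_filter.mpr ⟨Finset.mem_univ _, hpe w hw'⟩
      have h2 : (N'.image p).card ≤ (E ∪ N'.image p).card :=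
        Finset.card_le_card Finset.subset_union_right
      have h3 : 2 ^ (t + 1) = 2 * 2 ^ t := by ring
      rw [h3]
      omega
    · intro e he
      rcases Finset.mem_union.mp he with he | he
      · obtain ⟨k, hk, L', hrot, hhd, hdel⟩ := hE e he
        refine ⟨k, by omega, L', hrot, hhd, fun x y h h' => ?_⟩
        simp only [Finset.mem_union]
        rcases hdel x y h h' with h | h <;> simp [h]
      · obtain ⟨w, hw, rfl⟩ := Finset.mem_image.mp he
        obtain ⟨k, hk, L', hrot, hhd, hdel⟩ := hp w hw
        refine ⟨k, hk, L', hrot, hhd, fun x y h h' => ?_⟩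
        simp only [Finset.mem_union]
        rcases hdel x y h h' with (h | h) | (h | h)
        · simp [h]
        · simp [h]
        · left; right; rw [h]; exact he
        · right; right; rw [h]; exact he

end SimpleGraph

/-! ### Inner vertices, blocks of a path, and cutting a path between two blocks. -/

section Zones

variable {V : Type*} [Fintype V] [DecidableEq V]

/-- `w` is an entry of `l` that is neither the first nor the last one, with neighbors `a`, `b`. -/
def IsInner (l : List V) (w : V) : Prop := ∃ l₁ a b l₂, l = l₁ ++ a :: w :: b :: l₂

theorem IsInner.exists_neighbors {l : List V} {w : V} (h : IsInner l w) (hnd : l.Nodup) :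
    w ∈ l ∧ ∃ a b, a ≠ b ∧ s(w, a) ∈ pathEdges l ∧ s(w, b) ∈ pathEdges l := by
  obtain ⟨l₁, a, b, l₂, rfl⟩ := h
  refine ⟨by simp, a, b, ?_, ?_, ?_⟩
  · rintro rfl
    have := (List.nodup_append'.mp hnd).2.1
    simp at this
  · rw [pathEdges_append_cons_cons, Sym2.eq_swap]
    simp
  · rw [pathEdges_append_cons_cons]
    simp [pathEdges]

theorem isInner_of_mem {l : List V} {w x y : V} (hw : w ∈ l) (hx : l.head? = some x)
    (hy : l.getLast? = some y) (hwx : w ≠ x) (hwy : w ≠ y) : IsInner l w := by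
  obtain ⟨l₁, l₂, rfl⟩ := List.append_of_mem hw
  rcases List.eq_nil_or_concat l₁ with rfl | ⟨l₁, a, rfl⟩
  · exact absurd (by simpa using hx) hwx
  cases l₂ with
  | nil => exact absurd (by simpa using hy) hwy
  | cons b l₂ => exact ⟨l₁, a, b, l₂, by simp⟩

theorem isInner_of_mem_tail_dropLast {l : List V} {w : V} (h : w ∈ l.tail.dropLast) :
    IsInner l w := by
  cases l with
  | nil => simp at h
  | cons x l =>
    rw [List.tail_cons] at h
    rcases List.eq_nil_or_concat l with rfl | ⟨l, y, rfl⟩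
    · simp at h
    rw [List.concat_eq_append, List.dropLast_concat] at h
    obtain ⟨l₁, l₂, rfl⟩ := List.append_of_mem h
    rcases List.eq_nil_or_concat l₁ with rfl | ⟨l₁, a, rfl⟩
    · cases l₂ with
      | nil => exact ⟨[], x, y, [], by simp⟩
      | cons b l₂ => exact ⟨[], x, b, l₂ ++ [y], by simp⟩
    · cases l₂ with
      | nil => exact ⟨x :: l₁, a, y, [], by simp⟩
      | cons b l₂ => exact ⟨x :: l₁, a, b, l₂ ++ [y], by simp⟩

/-- The `i`-th block of length `z` of a list. -/
def block (l : List V) (z i : ℕ) : List V := (l.drop (i * z)).take z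

theorem block_infix (l : List V) (z i : ℕ) : block l z i <:+: l :=
  (List.take_prefix _ _).isInfix.trans (List.drop_suffix _ _).isInfix

theorem length_block {l : List V} {z i K : ℕ} (hK : K * z ≤ l.length) (hi : i < K) :
    (block l z i).length = z := by
  rw [block, List.length_take, List.length_drop]
  have : (i + 1) * z ≤ K * z := Nat.mul_le_mul_right z hi
  rw [add_mul, one_mul] at this
  omega

theorem exists_getElem_of_mem_block {l : List V} {z i : ℕ} {x : V} (h : x ∈ block l z i) :
    ∃ j, ∃ hj : i * z + j < l.length, j < z ∧ l[i * z + j] = x := by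
  rw [block, List.mem_take_iff_getElem] at h
  obtain ⟨j, hj, rfl⟩ := h
  rw [List.length_drop] at hj
  refine ⟨j, by omega, by omega, ?_⟩
  rw [List.getElem_drop]

theorem disjoint_block {l : List V} (hnd : l.Nodup) {z i j : ℕ} (hij : i ≠ j) :
    List.Disjoint (block l z i) (block l z j) := by
  intro x hi hj
  obtain ⟨a, ha, haz, rfl⟩ := exists_getElem_of_mem_block hi
  obtain ⟨b, hb, hbz, h⟩ := exists_getElem_of_mem_block hj
  have h1 := (List.Nodup.getElem_inj_iff hnd).mp h
  have h2 : (j * z + b) / z = (i * z + a) / z := by rw [h1]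
  have hz : 0 < z := by omega
  rw [mul_comm j, mul_comm i, Nat.mul_add_div hz, Nat.mul_add_div hz, Nat.div_eq_of_lt haz,
    Nat.div_eq_of_lt hbz] at h2
  omega

/-- A path containing all edges of several disjoint paths can be cut so that one of them lies on
either side of the cut. -/
theorem exists_split {Q : List V} (hnd : Q.Nodup) (Z : ℕ → List V) (I : Finset ℕ)
    (hI : 2 ≤ I.card) (hdisj : ∀ i ∈ I, ∀ j ∈ I, i ≠ j → List.Disjoint (Z i) (Z j))
    (hlen : ∀ i ∈ I, 2 ≤ (Z i).length) (hZ : ∀ i ∈ I, pathEdges (Z i) ⊆ pathEdges Q) :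
    ∃ L₁ L₂ i j, i ∈ I ∧ j ∈ I ∧ Q = L₁ ++ L₂ ∧ pathEdges (Z i) ⊆ pathEdges L₁ ∧
      pathEdges (Z j) ⊆ pathEdges L₂ := by
  classical
  have hsub : ∀ i ∈ I, ∀ x ∈ Z i, x ∈ Q := fun i hi => by
    have := subset_or_subset_of_pathEdges (z := Z i) (l₁ := Q) (l₂ := []) (by simp) (hlen i hi)
      fun e he => Or.inl (hZ i hi he)
    rcases this with h | h
    · exact h.1
    · intro x hx
      simpa using h.1 x hx
  -- The cut is made after the shortest prefix that contains a whole subpath `Z i`. Its last vertex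
  -- `q` belongs to `Z i`, so every other subpath avoids `q` and is not severed; by minimality it
  -- cannot lie in the prefix.
  have hex : ∃ k, ∃ i ∈ I, ∀ x ∈ Z i, x ∈ Q.take k := by
    obtain ⟨i, hi⟩ := Finset.card_pos.mp (by omega : 0 < I.card)
    exact ⟨Q.length, i, hi, by simpa using hsub i hi⟩
  set k := Nat.find hex with hk
  obtain ⟨i, hi, hik⟩ := Nat.find_spec hex
  rw [← hk] at hik
  have hmin : ∀ j ∈ I, ∃ x ∈ Z j, x ∉ Q.take (k - 1) := fun j hj => by
    rcases Nat.eq_zero_or_pos k with h0 | hpos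
    · rw [h0] at hik
      obtain ⟨x, hx⟩ := List.exists_mem_of_length_pos (by have := hlen i hi; omega : 0 < (Z i).length)
      simpa using hik x hx
    · have := Nat.find_min hex (m := k - 1) (by omega)
      push Not at this
      exact this j hj
  have hklen : k ≤ Q.length := Nat.find_min' hex ⟨i, hi, by simpa using hsub i hi⟩
  have hkpos : 0 < k := by
    rcases Nat.eq_zero_or_pos k with h0 | hpos
    · rw [h0] at hik
      obtain ⟨x, hx⟩ := List.exists_mem_of_length_pos (by have := hlen i hi; omega : 0 < (Z i).length)
      simpa using hik x hx
    · exact hpos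
  obtain ⟨k', hk'⟩ : ∃ k', k = k' + 1 := ⟨k - 1, by omega⟩
  rw [hk'] at hik hmin hklen
  rw [Nat.add_sub_cancel] at hmin
  have htake : Q.take (k' + 1) = Q.take k' ++ [Q[k']] := (List.take_concat_get' Q k' (by omega)).symm
  set q := Q[k'] with hq
  set L₂ := Q.drop (k' + 1) with hL₂
  have hQ : Q = (Q.take k' ++ [q]) ++ L₂ := by rw [← htake, hL₂, List.take_append_drop]
  set L := Q.take k' with hL
  rw [htake] at hik
  have hnd2 : ((L ++ [q]) ++ L₂).Nodup := by rw [← hQ]; exact hnd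
  have hd : List.Disjoint (L ++ [q]) L₂ := (List.nodup_append'.mp hnd2).2.2
  have hqi : q ∈ Z i := by
    obtain ⟨x, hx, hxL⟩ := hmin i hi
    have := hik x hx
    rw [List.mem_append, List.mem_singleton] at this
    rcases this with h | h
    · exact absurd h hxL
    · rwa [← h]
  obtain ⟨j, hj, hji⟩ := Finset.exists_mem_ne (by omega : 1 < I.card) i
  have hqj : q ∉ Z j := fun h => hdisj i hi j hj hji.symm hqi h
  have hcut : ∀ e ∈ pathEdges Q, e ∈ pathEdges (L ++ [q]) ∨ e ∈ pathEdges L₂ ∨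
      ∃ w ∈ L₂, e = s(q, w) := fun e he => by
    rw [hQ] at he
    cases h2 : L₂ with
    | nil => rw [h2] at he; left; simpa using he
    | cons w l =>
      rw [h2, List.append_assoc, List.cons_append, List.nil_append,
        pathEdges_append_cons_cons, Finset.mem_union, Finset.mem_insert] at he
      rcases he with h | h | h
      · exact Or.inl h
      · exact Or.inr (Or.inr ⟨w, by simp, h⟩)
      · exact Or.inr (Or.inl h)
  have hZi : ∀ e ∈ pathEdges (Z i), e ∈ pathEdges (L ++ [q]) ∨ e ∈ pathEdges L₂ := fun e he => by
    rcases hcut e (hZ i hi he) with h | h | ⟨w, hw, rfl⟩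
    · exact Or.inl h
    · exact Or.inr h
    · exact absurd hw (hd (hik w (mem_of_mem_pathEdges he).2))
  have hZj : ∀ e ∈ pathEdges (Z j), e ∈ pathEdges (L ++ [q]) ∨ e ∈ pathEdges L₂ := fun e he => by
    rcases hcut e (hZ j hj he) with h | h | ⟨w, hw, rfl⟩
    · exact Or.inl h
    · exact Or.inr h
    · exact absurd (mem_of_mem_pathEdges he).1 hqj
  refine ⟨L ++ [q], L₂, i, j, hi, hj, hQ, ?_, ?_⟩
  · rcases subset_or_subset_of_pathEdges hd (hlen i hi) hZi with h | h
    · exact h.2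
    · exact absurd (h.1 q hqi) (hd (by simp))
  · rcases subset_or_subset_of_pathEdges hd (hlen j hj) hZj with h | h
    · obtain ⟨x, hx, hxL⟩ := hmin j hj
      have := h.1 x hx
      rw [List.mem_append, List.mem_singleton] at this
      rcases this with h' | h'
      · exact absurd h' hxL
      · exact absurd (h' ▸ hx) hqj
    · exact h.2

/-- Some element of a large set lies in few of a family of small sets. -/
theorem exists_mem_few {E : Finset V} {β K : ℕ} (X : ℕ → Finset V)
    (hX : ∀ i < K, (X i).card ≤ β) (hE : 8 * β < E.card) :
    ∃ v ∈ E, 8 * ((Finset.range K).filter fun i => v ∈ X i).card ≤ K := by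
  by_contra! h
  have h1 : ∑ v ∈ E, (K + 1) ≤ ∑ v ∈ E, 8 * ((Finset.range K).filter fun i => v ∈ X i).card :=
    Finset.sum_le_sum fun v hv => h v hv
  rw [← Finset.mul_sum] at h1
  -- Double counting of the incidences between `E` and the sets `X i`.
  have h2 : ∑ v ∈ E, ((Finset.range K).filter fun i => v ∈ X i).card =
      ∑ i ∈ Finset.range K, (E.filter fun v => v ∈ X i).card :=
    Finset.sum_card_bipartiteAbove_eq_sum_card_bipartiteBelow _
  have h3 : ∑ i ∈ Finset.range K, (E.filter fun v => v ∈ X i).card ≤ K * β := by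
    refine (Finset.sum_le_card_nsmul _ _ β fun i hi => ?_).trans (by simp)
    refine (Finset.card_le_card fun v hv => (Finset.mem_filter.mp hv).2).trans
      (hX i (Finset.mem_range.mp hi))
  rw [h2, Finset.sum_const, smul_eq_mul] at h1
  nlinarith

end Zones

/-! ### Exceptional sets for rotations restricted to one block. -/

namespace SimpleGraph

variable {V : Type*} [Fintype V] [DecidableEq V] {G : SimpleGraph V} [DecidableRel G.Adj]

theorem le_length_filter_side {A : Finset V} (hA : IsSide G A) (h : ℕ) (l : List V)
    (hl : l.IsChain G.Adj) (hlen : 2 * h ≤ l.length) :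
    h ≤ (l.filter fun w => w ∉ A).length := by
  induction h generalizing l with
  | zero => omega
  | succ h ih =>
    match l, hl, hlen with
    | [], _, hlen => simp at hlen
    | [a], _, hlen => simp at hlen; omega
    | a :: b :: l, hl, hlen =>
      rw [List.isChain_cons_cons] at hl
      have h1 := ih l hl.2.tail (by simp at hlen; omega)
      have h2 := hA a b hl.1
      by_cases ha : a ∈ A
      · simp [ha, h2.mp ha]; simpa using h1
      · have hb : b ∈ A := by tauto
        simp [ha, hb]; simpa using h1

open Classical in
/-- A path on `2 h + 2` vertices has at least `h` inner vertices outside the side `A`. -/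
theorem le_card_inner_side {A : Finset V} (hA : IsSide G A) {h : ℕ} {l : List V}
    (hnd : l.Nodup) (hl : l.IsChain G.Adj) (hlen : l.length = 2 * h + 2) :
    h ≤ (Finset.univ.filter fun w => IsInner l w ∧ w ∉ A).card := by
  have h1 := le_length_filter_side hA h l.tail.dropLast (hl.tail.prefix (List.dropLast_prefix _))
    (by simp; omega)
  have hnd' : (l.tail.dropLast.filter fun w => w ∉ A).Nodup :=
    (hnd.tail.sublist (List.dropLast_sublist _)).filter _
  rw [← List.toFinset_card_of_nodup hnd'] at h1
  refine h1.trans (Finset.card_le_card fun w hw => ?_)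
  simp only [List.mem_toFinset, List.mem_filter, decide_eq_true_eq] at hw
  exact Finset.mem_filter.mpr ⟨Finset.mem_univ _, isInner_of_mem_tail_dropLast hw.1, hw.2⟩

/-- After removing a small exceptional set from `A`, small subsets of `A` expand into `I`. -/
theorem exists_exceptional_set {Z : List V} (hnd : Z.Nodup) {A I : Finset V} {β h τ : ℕ}
    (hI : h ≤ I.card) (hIA : I ⊆ Aᶜ) (hβ : 32 * β < h) (hτ : 16 * τ ≤ h)
    (hlink : ∀ S ⊆ A, ∀ T ⊆ Aᶜ, (∀ u ∈ S, ∀ v ∈ T, ¬ G.Adj u v) → β < S.card → 4 * T.card ≤ h) :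
    ∃ X ⊆ A, X.card ≤ β ∧ ∃ W ⊆ I, (∀ w ∈ W, ∀ a, s(w, a) ∈ pathEdges Z → a ∉ X) ∧
      ∀ S ⊆ A, S.Nonempty → Disjoint S X → S.card ≤ τ →
        6 * S.card ≤ (W.filter fun w => ∃ s ∈ S, G.Adj s w).card := by
  let N : Finset V → Finset V := fun S => I.filter fun w => ∃ s ∈ S, G.Adj s w
  let Γ : Finset V → Finset V := fun S => N S ∪ S.biUnion (pathNeighbors Z)
  have hlarge : ∀ S ⊆ A, β < S.card → 3 * h ≤ 4 * (N S).card := fun S hS hc => by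
    have h1 := hlink S hS (I \ N S) (Finset.sdiff_subset.trans hIA) (fun u hu v hv hadj => by
      simp only [N, Finset.mem_sdiff, Finset.mem_filter, not_and, not_exists] at hv
      exact hv.2 hv.1 u hu hadj) hc
    have h2 : (I \ N S).card + (N S).card = I.card :=
      Finset.card_sdiff_add_card_eq_card (Finset.filter_subset _ _)
    omega
  -- `X` is a largest badly expanding set. The neighbors of its vertices along `Z` are counted in Γ
  -- X as well, so that deleting Γ X from the pivots also keeps the resulting heads out of `X`.
  obtain ⟨X, hX, hmax⟩ := Finset.exists_max_image
    (A.powerset.filter fun X => X.card ≤ β ∧ (Γ X).card ≤ 12 * X.card) Finset.card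
    ⟨∅, by simp [Γ, N]⟩
  simp only [Finset.mem_filter, Finset.mem_powerset] at hX hmax
  obtain ⟨hXA, hXβ, hXΓ⟩ := hX
  refine ⟨X, hXA, hXβ, I \ Γ X, Finset.sdiff_subset, fun w hw a ha haX => ?_, ?_⟩
  · refine (Finset.mem_sdiff.mp hw).2 (Finset.mem_union_right _ (Finset.mem_biUnion.mpr
      ⟨a, haX, Finset.mem_filter.mpr ⟨Finset.mem_univ _, by rwa [Sym2.eq_swap]⟩⟩))
  · intro S hSA hSne hdisj hSτ
    have hWN : (I \ Γ X).filter (fun w => ∃ s ∈ S, G.Adj s w) = N S \ Γ X := by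
      ext w
      simp only [N, Finset.mem_filter, Finset.mem_sdiff]
      tauto
    rw [hWN]
    by_cases hS : S.card ≤ β
    · by_contra! hlt
      have hun : (X ∪ S).card = X.card + S.card :=
        Finset.card_union_of_disjoint hdisj.symm
      have hΓ : Γ (X ∪ S) ⊆ Γ X ∪ (N S \ Γ X) ∪ S.biUnion (pathNeighbors Z) := by
        intro w hw
        simp only [Γ, N, Finset.mem_union, Finset.mem_filter, Finset.mem_biUnion,
          Finset.mem_sdiff] at hw ⊢
        rcases hw with ⟨hwI, s, hs | hs, hadj⟩ | ⟨s, hs | hs, hw⟩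
        · exact Or.inl (Or.inl (Or.inl ⟨hwI, s, hs, hadj⟩))
        · by_cases hc : (w ∈ I ∧ ∃ s ∈ X, G.Adj s w) ∨ ∃ a ∈ X, w ∈ pathNeighbors Z a
          · exact Or.inl (Or.inl hc)
          · exact Or.inl (Or.inr ⟨⟨hwI, s, hs, hadj⟩, hc⟩)
        · exact Or.inl (Or.inl (Or.inr ⟨s, hs, hw⟩))
        · exact Or.inr ⟨s, hs, hw⟩
      have hbi : (S.biUnion (pathNeighbors Z)).card ≤ S.card * 2 :=
        Finset.card_biUnion_le_card_mul _ _ _ fun a _ => card_pathNeighbors_le hnd a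
      have h1 := Finset.card_le_card hΓ
      have h2 := Finset.card_union_le (Γ X ∪ (N S \ Γ X)) (S.biUnion (pathNeighbors Z))
      have h3 := Finset.card_union_le (Γ X) (N S \ Γ X)
      have hSpos := hSne.card_pos
      -- If `S` expanded badly, then |Γ(X ∪ S)| ≤ 12|X| + 8|S|. Either X ∪ S contradicts the
      -- maximality of `X`, or it has more than β elements and 3h ≤ 80β contradicts 32β < h.
      by_cases hle : (X ∪ S).card ≤ β
      · have := hmax (X ∪ S) ⟨Finset.union_subset hXA hSA, hle, by omega⟩
        omega
      · have h4 := hlarge (X ∪ S) (Finset.union_subset hXA hSA) (by omega)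
        have h5 : (N (X ∪ S)).card ≤ (Γ (X ∪ S)).card := Finset.card_le_card Finset.subset_union_left
        omega
    -- For |S| > β what is left is at least 3h/4 - 12β ≥ 3h/8 ≥ 6τ.
    · have h1 := hlarge S hSA (by omega)
      have h2 := Finset.le_card_sdiff (Γ X) (N S)
      omega

end SimpleGraph

/-! ### Closing or extending a path in few edits. -/

namespace SimpleGraph

variable {V : Type*} [Fintype V] [DecidableEq V] {G : SimpleGraph V} [DecidableRel G.Adj]

/-- In a bipartite graph the ends of a path lie on different sides iff it has an even number of
vertices. -/
theorem IsSide.mem_iff_even {A : Finset V} (hA : IsSide G A) {l : List V} {v u : V}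
    (hl : l.IsChain G.Adj) (hv : l.head? = some v) (hu : l.getLast? = some u) :
    (v ∈ A ↔ u ∉ A) ↔ Even l.length := by
  induction l generalizing v with
  | nil => simp at hv
  | cons a l ih =>
    obtain rfl : a = v := by simpa using hv
    cases l with
    | nil =>
      obtain rfl : a = u := by simpa using hu
      simp
    | cons b l =>
      rw [List.isChain_cons_cons] at hl
      have h1 := ih hl.2 rfl (by simpa [List.getLast?_cons] using hu)
      have h2 := hA a b hl.1
      rw [List.length_cons, Nat.even_add_one, ← h1]
      tauto

variable (G) in
/-- `Reach G k P P'`: the path `P'` has the same vertices as `P`, and at most `k` edges of either of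
them are not in the other. -/
def Reach (k : ℕ) (P P' : List V) : Prop :=
  P'.Perm P ∧ P'.IsChain G.Adj ∧ (pathEdges P \ pathEdges P').card ≤ k ∧
    (pathEdges P' \ pathEdges P).card ≤ k

theorem Reach.trans {k k' : ℕ} {P P' P'' : List V} (h : Reach G k P P') (h' : Reach G k' P' P'') :
    Reach G (k + k') P P'' := by
  refine ⟨h'.1.trans h.1, h'.2.1, ?_, ?_⟩
  · refine (Finset.card_le_card (sdiff_triangle _ (pathEdges P') _)).trans
      ((Finset.card_union_le _ _).trans (add_le_add h.2.2.1 h'.2.2.1))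
  · refine (Finset.card_le_card (sdiff_triangle _ (pathEdges P') _)).trans
      ((Finset.card_union_le _ _).trans ?_)
    rw [add_comm]
    exact add_le_add h.2.2.2 h'.2.2.2

theorem Reach.mono {k k' : ℕ} {P P' : List V} (h : Reach G k P P') (hk : k ≤ k') :
    Reach G k' P P' := ⟨h.1, h.2.1, h.2.2.1.trans hk, h.2.2.2.trans hk⟩

theorem isChain_adj_reverse {P : List V} (hP : P.IsChain G.Adj) : P.reverse.IsChain G.Adj := by
  rw [List.isChain_reverse]
  exact hP.imp fun a b hab => hab.symm

theorem Reach.reverse {k : ℕ} {P P' : List V} (h : Reach G k P P') : Reach G k P P'.reverse := by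
  refine ⟨(List.reverse_perm _).trans h.1, isChain_adj_reverse h.2.1, ?_⟩
  rw [pathEdges_reverse]
  exact h.2.2

theorem Rotates.reach {k : ℕ} {P P' : List V} (h : Rotates G k P P') (hP : P.IsChain G.Adj) :
    Reach G k P P' :=
  ⟨h.perm, h.isChain hP, h.card_sdiff_le⟩

theorem Rotates.append_right {k : ℕ} {P P' : List V} (h : Rotates G k P P') (Q : List V) :
    Rotates G k (P ++ Q) (P' ++ Q) := by
  induction h with
  | refl => exact .refl _
  | @step k L l l' e p w _ he hadj ih =>
    simp only [List.append_assoc, List.cons_append] at ih ⊢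
    exact .step ih he hadj

variable (G) in
/-- Expansion and edge distribution out of one side `A` of a bipartite graph. -/
structure SideLinked (A : Finset V) (β h τ τ₁ : ℕ) : Prop where
  side : IsSide G A
  link : ∀ S ⊆ A, ∀ T ⊆ Aᶜ, (∀ u ∈ S, ∀ v ∈ T, ¬ G.Adj u v) → β < S.card → 4 * T.card ≤ h
  edge : ∀ S ⊆ A, ∀ T ⊆ Aᶜ, τ < S.card → τ < T.card → ∃ u ∈ S, ∃ v ∈ T, G.Adj u v
  expand : ∀ S ⊆ A, S.card ≤ τ₁ →
    8 * S.card ≤ (Finset.univ.filter fun w => ∃ s ∈ S, G.Adj s w).card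

section

variable {A : Finset V} {β h τ τ₁ ρ : ℕ}

open Classical in
/-- If no path obtained by at most `ρ` rotations can be extended, then there are many reachable
heads and the path is long. -/
theorem SideLinked.exists_heads (hA : SideLinked G A β h τ τ₁) (hρ : τ₁ < 2 ^ ρ) {P : List V}
    (hnd : P.Nodup) (hch : P.IsChain G.Adj) {v : V} (hv : P.head? = some v) (hvA : v ∈ A)
    (hfree : ∀ k ≤ ρ, ∀ P' e, Rotates G k P P' → P'.head? = some e → ∀ w, G.Adj e w → w ∈ P) :
    8 * τ₁ ≤ P.length ∧ ∃ E ⊆ A, τ₁ < E.card ∧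
      ∀ e ∈ E, ∃ k ≤ ρ, ∃ P', Rotates G k P P' ∧ P'.head? = some e := by
  obtain ⟨y, hy⟩ : ∃ y, P.getLast? = some y := by
    cases hP : P.getLast? with
    | none => rw [List.getLast?_eq_none_iff] at hP; simp [hP] at hv
    | some y => exact ⟨y, rfl⟩
  obtain ⟨E, hEA, -, hcard, hE⟩ := posa_growth hnd hch hv hA.side hvA
    (Finset.univ.filter fun w => IsInner P w) ∅ τ₁ ρ (fun e => ∀ w, G.Adj e w → w ∈ P)
    (fun w hw => by
      obtain ⟨h1, a, b, h2, h3, h4⟩ := (Finset.mem_filter.mp hw).2.exists_neighbors hnd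
      exact ⟨h1, a, b, h2, h3, h4, by simp, by simp⟩) (by simp) hfree
    (fun S hS hne _ hP hcard => by
      have h1 := hA.expand S hS hcard
      -- By assumption all neighbors of reachable heads lie on the path; only its two ends cannot
      -- serve as pivots, and 8|S| - 2 ≥ 6|S|.
      have hsub : (Finset.univ.filter fun w => ∃ s ∈ S, G.Adj s w) \ {v, y} ⊆
          ((Finset.univ.filter fun w => IsInner P w).filter fun w => ∃ s ∈ S, G.Adj s w) := by
        intro w hw
        simp only [Finset.mem_sdiff, Finset.mem_filter, Finset.mem_univ, true_and,
          Finset.mem_insert, Finset.mem_singleton, not_or] at hw ⊢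
        obtain ⟨⟨s, hs, hadj⟩, hwv, hwy⟩ := hw
        exact ⟨isInner_of_mem (hP s hs w hadj) hv hy hwv hwy, s, hs, hadj⟩
      have h2 := Finset.card_le_card hsub
      have h3 := Finset.le_card_sdiff {v, y} (Finset.univ.filter fun w => ∃ s ∈ S, G.Adj s w)
      have h4 : ({v, y} : Finset V).card ≤ 2 := Finset.card_le_two
      have := hne.card_pos
      omega) ρ le_rfl
  have hEcard : τ₁ < E.card := by omega
  have hE' : ∀ e ∈ E, ∃ k ≤ ρ, ∃ P', Rotates G k P P' ∧ P'.head? = some e := fun e he => by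
    obtain ⟨k, hk, P', h1, h2, -⟩ := hE e he
    exact ⟨k, hk, P', h1, h2⟩
  refine ⟨?_, E, hEA, hEcard, hE'⟩
  -- The neighborhood of τ₁ reachable heads lies on the path, so the path has at least 8τ₁ vertices.
  obtain ⟨S, hSE, hScard⟩ := Finset.exists_subset_card_eq hEcard.le
  have h1 := hA.expand S (hSE.trans hEA) hScard.le
  rw [hScard] at h1
  refine h1.trans ((Finset.card_le_card (t := P.toFinset) fun w hw => ?_).trans
    (List.toFinset_card_le P))
  obtain ⟨s, hs, hadj⟩ := (Finset.mem_filter.mp hw).2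
  obtain ⟨k, hk, P', h1, h2⟩ := hE' s (hSE hs)
  exact List.mem_toFinset.mpr (hfree k hk P' s h1 h2 w hadj)

variable (G) in
/-- Small subsets of `A` avoiding `X` expand into the interior of the path `Z`, even after the
neighbors of `X` along `Z` are deleted. -/
def IsExceptional (A : Finset V) (τ : ℕ) (Z : List V) (X : Finset V) : Prop :=
  ∃ W : Finset V, (∀ w ∈ W, IsInner Z w) ∧
    (∀ w ∈ W, ∀ a, s(w, a) ∈ pathEdges Z → a ∉ X) ∧
      ∀ S ⊆ A, S.Nonempty → Disjoint S X → S.card ≤ τ →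
        6 * S.card ≤ (W.filter fun w => ∃ s ∈ S, G.Adj s w).card

open Classical in
theorem SideLinked.exists_isExceptional (hA : SideLinked G A β h τ τ₁) (hβ : 32 * β < h)
    (hτ : 16 * τ ≤ h) {Z : List V} (hnd : Z.Nodup) (hch : Z.IsChain G.Adj)
    (hlen : Z.length = 2 * h + 2) :
    ∃ X : Finset V, X.card ≤ β ∧ IsExceptional G A τ Z X := by
  obtain ⟨X, -, hX, W, hW, h1, h2⟩ := exists_exceptional_set (G := G) hnd
    (le_card_inner_side hA.side hnd hch hlen)
    (fun w hw => Finset.mem_compl.mpr (Finset.mem_filter.mp hw).2.2) hβ hτ hA.link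
  exact ⟨X, hX, W, fun w hw => (Finset.mem_filter.mp (hW hw)).2.1, h1, h2⟩

/-- Rotations of a path `L` containing `Z` with pivots in `Z` reach many heads. -/
theorem IsExceptional.exists_heads (hA : IsSide G A) (hρ : τ < 2 ^ ρ) {Z L : List V} {X : Finset V}
    (hX : IsExceptional G A τ Z X) (hZ : Z.Nodup) (hnd : L.Nodup) (hch : L.IsChain G.Adj)
    (hZL : pathEdges Z ⊆ pathEdges L) {v : V} (hv : L.head? = some v) (hvA : v ∈ A) (hvX : v ∉ X) :
    ∃ E ⊆ A, τ < E.card ∧ ∀ e ∈ E, ∃ k ≤ ρ, ∃ L', Rotates G k L L' ∧ L'.head? = some e := by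
  obtain ⟨W, hW, hWX, hexp⟩ := hX
  obtain ⟨E, hEA, -, hcard, hE⟩ := posa_growth hnd hch hv hA hvA W X τ ρ (fun _ => True)
    (fun w hw => by
      obtain ⟨-, a, b, h2, h3, h4⟩ := (hW w hw).exists_neighbors hZ
      exact ⟨(mem_of_mem_pathEdges (hZL h3)).1, a, b, h2, hZL h3, hZL h4, hWX w hw a h3,
        hWX w hw b h4⟩) hvX (fun _ _ _ _ _ _ => trivial)
    (fun S hS hne hd _ hc => hexp S hS hne hd hc) ρ le_rfl
  refine ⟨E, hEA, by omega, fun e he => ?_⟩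
  obtain ⟨k, hk, P', h1, h2, -⟩ := hE e he
  exact ⟨k, hk, P', h1, h2⟩

/-- Few pairwise disjoint subpaths of `P` are destroyed by changing few edges. -/
theorem card_broken_le {P Q : List V} {k K : ℕ} (hPQ : (pathEdges P \ pathEdges Q).card ≤ k)
    (Z : ℕ → List V) (hdisj : ∀ i j, i ≠ j → List.Disjoint (Z i) (Z j))
    (hZ : ∀ i, pathEdges (Z i) ⊆ pathEdges P) :
    ((Finset.range K).filter fun i => ¬ pathEdges (Z i) ⊆ pathEdges Q).card ≤ k := by
  have hex : ∀ i ∈ (Finset.range K).filter fun i => ¬ pathEdges (Z i) ⊆ pathEdges Q,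
      ∃ e, e ∈ pathEdges (Z i) ∧ e ∉ pathEdges Q := fun i hi =>
    Finset.not_subset.mp (Finset.mem_filter.mp hi).2
  rcases Finset.eq_empty_or_nonempty
    ((Finset.range K).filter fun i => ¬ pathEdges (Z i) ⊆ pathEdges Q) with h0 | ⟨i₀, hi₀⟩
  · simp [h0]
  have : Nonempty (Sym2 V) := ⟨(hex i₀ hi₀).choose⟩
  choose! f hf hf' using hex
  refine (Finset.card_le_card_of_injOn f (fun i hi => Finset.mem_sdiff.mpr
    ⟨hZ i (hf i hi), hf' i hi⟩) fun i hi j hj hij => ?_).trans hPQ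
  by_contra hne
  have h1 := hf i hi
  have h2 := hf j hj
  rw [hij] at h1
  revert h1 h2
  generalize f j = e
  induction e with
  | _ x y => exact fun h1 h2 => hdisj i j hne (mem_of_mem_pathEdges h1).1 (mem_of_mem_pathEdges h2).1

/-- A path can be changed in few edges so that it closes up to a cycle or can be extended. -/
theorem SideLinked.exists_closing_of_mem (hA : SideLinked G A β h τ τ₁)
    (hA' : SideLinked G Aᶜ β h τ τ₁) (hβ : 32 * β < h) (hτ : 16 * τ ≤ h) (hτ₁ : 8 * β ≤ τ₁)
    (hρ : τ₁ < 2 ^ ρ) (hρ' : τ < 2 ^ ρ) {K : ℕ} (hK : 8 * ρ + 8 ≤ 3 * K)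
    (hKτ : K * (2 * h + 2) ≤ 8 * τ₁) {P : List V} (hnd : P.Nodup) (hch : P.IsChain G.Adj)
    {v₀ u₀ : V} (hv₀ : P.head? = some v₀) (hu₀ : P.getLast? = some u₀) (hv₀A : v₀ ∈ A)
    (hu₀A : u₀ ∉ A) :
    ∃ P', Reach G (4 * ρ) P P' ∧ ∃ v, P'.head? = some v ∧
      ((∃ u, P'.getLast? = some u ∧ G.Adj u v) ∨ ∃ w, G.Adj v w ∧ w ∉ P) := by
  by_cases hfree : ∀ k ≤ ρ, ∀ P' e, Rotates G k P P' → P'.head? = some e → ∀ w, G.Adj e w → w ∈ P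
  swap
  · push Not at hfree
    obtain ⟨k, hk, P', e, hrot, he, w, hw, hwP⟩ := hfree
    exact ⟨P', (hrot.reach hch).mono (by omega), e, he, Or.inr ⟨w, hw, hwP⟩⟩
  obtain ⟨hlen, E, hEA, hEcard, hE⟩ := hA.exists_heads hρ hnd hch hv₀ hv₀A hfree
  set Z : ℕ → List V := block P (2 * h + 2) with hZ
  have hZinf : ∀ i, Z i <:+: P := fun i => block_infix P _ i
  have hZnd : ∀ i, (Z i).Nodup := fun i => hnd.sublist (hZinf i).sublist
  have hZch : ∀ i, (Z i).IsChain G.Adj := fun i => hch.infix (hZinf i)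
  have hZlen : ∀ i < K, (Z i).length = 2 * h + 2 := fun i hi => length_block (hKτ.trans hlen) hi
  have hZdisj : ∀ i j, i ≠ j → List.Disjoint (Z i) (Z j) := fun i j hij => disjoint_block hnd hij
  have hX : ∀ i < K, ∃ X : Finset V, X.card ≤ β ∧ IsExceptional G A τ (Z i) X := fun i hi =>
    hA.exists_isExceptional hβ hτ (hZnd i) (hZch i) (hZlen i hi)
  have hY : ∀ i < K, ∃ X : Finset V, X.card ≤ β ∧ IsExceptional G Aᶜ τ (Z i) X := fun i hi =>
    hA'.exists_isExceptional hβ hτ (hZnd i) (hZch i) (hZlen i hi)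
  choose! X hXβ hX using hX
  choose! Y hYβ hY using hY
  -- There are more than 8β heads to choose from, so some head is exceptional for at most K/8
  -- blocks.
  obtain ⟨v, hvE, hvfew⟩ := exists_mem_few X hXβ (hτ₁.trans_lt hEcard)
  obtain ⟨k, hk, P₁, hrot₁, hP₁v⟩ := hE v hvE
  have hreach₁ : Reach G ρ P P₁.reverse := ((hrot₁.reach hch).mono hk).reverse
  have hnd₁ : P₁.reverse.Nodup := hreach₁.1.nodup_iff.mpr hnd
  have hhd₁ : P₁.reverse.head? = some u₀ := by rw [List.head?_reverse, hrot₁.getLast?, hu₀]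
  by_cases hfree' : ∀ k ≤ ρ, ∀ P' e, Rotates G k P₁.reverse P' → P'.head? = some e →
      ∀ w, G.Adj e w → w ∈ P₁.reverse
  swap
  · push Not at hfree'
    obtain ⟨k, hk, P', e, hrot, he, w, hw, hwP⟩ := hfree'
    exact ⟨P', (hreach₁.trans (hrot.reach hreach₁.2.1)).mono (by omega), e, he,
      Or.inr ⟨w, hw, fun h => hwP (hreach₁.1.mem_iff.mpr h)⟩⟩
  -- The same for the other end, on the reversed path; rotations fix the last vertex, so `v` remains
  -- an end.
  obtain ⟨-, E', hEA', hEcard', hE'⟩ := hA'.exists_heads hρ hnd₁ hreach₁.2.1 hhd₁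
    (Finset.mem_compl.mpr hu₀A) hfree'
  obtain ⟨u, huE, hufew⟩ := exists_mem_few Y hYβ (hτ₁.trans_lt hEcard')
  obtain ⟨k', hk', P₂, hrot₂, hP₂u⟩ := hE' u huE
  have hreach₂ : Reach G (ρ + ρ) P P₂.reverse :=
    (hreach₁.trans ((hrot₂.reach hreach₁.2.1).mono hk')).reverse
  have hhd₂ : P₂.reverse.head? = some v := by
    rw [List.head?_reverse, hrot₂.getLast?, List.getLast?_reverse, hP₁v]
  have hlast₂ : P₂.reverse.getLast? = some u := by rw [List.getLast?_reverse, hP₂u]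
  set Q := P₂.reverse with hQ
  have hQnd : Q.Nodup := hreach₂.1.nodup_iff.mpr hnd
  set I := (Finset.range K).filter fun i => v ∉ X i ∧ u ∉ Y i ∧ pathEdges (Z i) ⊆ pathEdges Q
    with hI
  -- At most K/8 blocks are lost to `v`, K/8 to `u` and 2ρ to the edits; 8ρ + 8 ≤ 3K leaves two
  -- blocks.
  have hIcard : 2 ≤ I.card := by
    have h1 := card_broken_le (K := K) hreach₂.2.2.1 Z hZdisj
      fun i => pathEdges_subset_of_infix (hZinf i)
    have h2 : Finset.range K ⊆ I ∪ ((Finset.range K).filter (fun i => v ∈ X i) ∪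
        ((Finset.range K).filter (fun i => u ∈ Y i) ∪
          (Finset.range K).filter fun i => ¬ pathEdges (Z i) ⊆ pathEdges Q)) := by
      intro i hi
      simp only [hI, Finset.mem_union, Finset.mem_filter, hi, true_and]
      tauto
    have h3 := (Finset.card_le_card h2).trans ((Finset.card_union_le _ _).trans
      (Nat.add_le_add_left ((Finset.card_union_le _ _).trans
        (Nat.add_le_add_left (Finset.card_union_le _ _) _)) _))
    rw [Finset.card_range] at h3
    omega
  have hIK : ∀ i ∈ I, i < K := fun i hi => Finset.mem_range.mp (Finset.mem_filter.mp hi).1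
  obtain ⟨L₁, L₂, i, j, hi, hj, hsplit, hZi, hZj⟩ := exists_split hQnd Z I hIcard
    (fun i _ j _ => hZdisj i j) (fun i hi => by rw [hZlen i (hIK i hi)]; omega)
    fun i hi => (Finset.mem_filter.mp hi).2.2.2
  have hQch := hreach₂.2.1
  rw [hsplit] at hQnd hQch hhd₂ hlast₂ hreach₂
  have hne : ∀ i ∈ I, ∀ L : List V, pathEdges (Z i) ⊆ pathEdges L → L ≠ [] := fun i hi L hL hnil => by
    have h1 := hZlen i (hIK i hi)
    match hz : Z i, h1 with
    | a :: b :: l, _ =>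
      rw [hnil, hz] at hL
      simpa [pathEdges] using hL (Finset.mem_insert_self s(a, b) _)
    | [], h1 => simp at h1
    | [a], h1 => simp at h1
  have hL₁hd : L₁.head? = some v := by
    rwa [List.head?_append_of_ne_nil _ (hne i hi L₁ hZi)] at hhd₂
  have hL₂last : L₂.reverse.head? = some u := by
    rw [List.head?_reverse]
    rwa [List.getLast?_append_of_ne_nil _ (hne j hj L₂ hZj)] at hlast₂
  have hL₁ch : L₁.IsChain G.Adj := hQch.prefix (List.prefix_append _ _)
  have hL₂ch : L₂.IsChain G.Adj := hQch.suffix (List.suffix_append _ _)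
  have hL₁nd : L₁.Nodup := hQnd.sublist (List.sublist_append_left _ _)
  have hL₂nd : L₂.Nodup := hQnd.sublist (List.sublist_append_right _ _)
  -- Rotations of `L₁` fix its last vertex and those of the reversed `L₂` fix the vertex next to the
  -- cut, so the halves stay joined and are rotated independently. Every pair of heads can thus be
  -- realised, and the two head sets are large enough to span an edge. The edits add up to at most
  -- 4ρ.
  obtain ⟨E₁, hE₁A, hE₁card, hE₁⟩ := (hX i (hIK i hi)).exists_heads hA.side hρ' (hZnd i) hL₁nd hL₁ch
    hZi hL₁hd (hEA hvE) (Finset.mem_filter.mp hi).2.1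
  obtain ⟨E₂, hE₂A, hE₂card, hE₂⟩ := (hY j (hIK j hj)).exists_heads hA'.side hρ' (hZnd j)
    (List.nodup_reverse.mpr hL₂nd) (isChain_adj_reverse hL₂ch)
    (by rwa [pathEdges_reverse]) hL₂last (hEA' huE) (Finset.mem_filter.mp hj).2.2.1
  obtain ⟨e₁, he₁, e₂, he₂, hadj⟩ := hA.edge E₁ hE₁A E₂ hE₂A hE₁card hE₂card
  obtain ⟨k₁, hk₁, L₁', hrotL₁, hL₁'⟩ := hE₁ e₁ he₁
  obtain ⟨k₂, hk₂, L₂', hrotL₂, hL₂'⟩ := hE₂ e₂ he₂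
  have hr₁ : Reach G k₁ (L₁ ++ L₂) (L₁' ++ L₂) := (hrotL₁.append_right L₂).reach hQch
  have hr₂ : Reach G k₂ (L₁' ++ L₂).reverse (L₂' ++ L₁'.reverse) := by
    have h1 := hrotL₂.append_right L₁'.reverse
    rw [← List.reverse_append] at h1
    exact h1.reach (isChain_adj_reverse hr₁.2.1)
  refine ⟨(L₂' ++ L₁'.reverse), ((hreach₂.trans hr₁.reverse).trans hr₂).mono (by omega), e₂, ?_,
    Or.inl ⟨e₁, ?_, hadj⟩⟩
  · rw [List.head?_append_of_ne_nil _ (by rintro rfl; simp at hL₂'), hL₂']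
  · rw [List.getLast?_append_of_ne_nil _ (by simpa using (by rintro rfl; simp at hL₁' : L₁' ≠ [])),
      List.getLast?_reverse, hL₁']

/-- A path on an even number of vertices can be changed in few edges so that it closes up to a cycle
or can be extended. -/
theorem SideLinked.exists_closing (hA : SideLinked G A β h τ τ₁)
    (hA' : SideLinked G Aᶜ β h τ τ₁) (hβ : 32 * β < h) (hτ : 16 * τ ≤ h) (hτ₁ : 8 * β ≤ τ₁)
    (hρ : τ₁ < 2 ^ ρ) (hρ' : τ < 2 ^ ρ) {K : ℕ} (hK : 8 * ρ + 8 ≤ 3 * K)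
    (hKτ : K * (2 * h + 2) ≤ 8 * τ₁) {P : List V} (hnd : P.Nodup) (hch : P.IsChain G.Adj)
    (hne : P ≠ []) (heven : Even P.length) :
    ∃ P', Reach G (4 * ρ) P P' ∧ ∃ v, P'.head? = some v ∧
      ((∃ u, P'.getLast? = some u ∧ G.Adj u v) ∨ ∃ w, G.Adj v w ∧ w ∉ P) := by
  have hhd := List.head?_eq_some_head hne
  have hlast := List.getLast?_eq_some_getLast hne
  have hiff := (hA.side.mem_iff_even hch hhd hlast).mpr heven
  by_cases hv : P.head hne ∈ A
  · exact hA.exists_closing_of_mem hA' hβ hτ hτ₁ hρ hρ' hK hKτ hnd hch hhd hlast hv (hiff.mp hv)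
  · refine hA'.exists_closing_of_mem (by rwa [compl_compl]) hβ hτ hτ₁ hρ hρ' hK hKτ hnd hch hhd hlast
      (Finset.mem_compl.mpr hv) ?_
    rw [Finset.mem_compl, not_not]
    tauto

end

end SimpleGraph

/-! ### Edit distance between edge sets. -/

section Within

variable {α : Type*} [DecidableEq α]

/-- At most `k` elements of either set are not in the other. -/
def Within (k : ℕ) (F F' : Finset α) : Prop := (F \ F').card ≤ k ∧ (F' \ F).card ≤ k

theorem Within.trans {k k' : ℕ} {F F' F'' : Finset α} (h : Within k F F') (h' : Within k' F' F'') :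
    Within (k + k') F F'' := by
  constructor
  · exact (Finset.card_le_card (sdiff_triangle _ F' _)).trans
      ((Finset.card_union_le _ _).trans (add_le_add h.1 h'.1))
  · rw [add_comm]
    exact (Finset.card_le_card (sdiff_triangle _ F' _)).trans
      ((Finset.card_union_le _ _).trans (add_le_add h'.2 h.2))

theorem Within.mono {k k' : ℕ} {F F' : Finset α} (h : Within k F F') (hk : k ≤ k') :
    Within k' F F' := ⟨h.1.trans hk, h.2.trans hk⟩

theorem Within.refl (F : Finset α) : Within 0 F F := by simp [Within]

theorem within_insert (a : α) (F : Finset α) : Within 1 F (insert a F) := by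
  constructor
  · simp [Finset.sdiff_eq_empty_iff_subset.mpr (Finset.subset_insert a F)]
  · refine (Finset.card_le_card (t := {a}) fun x hx => ?_).trans (by simp)
    simp only [Finset.mem_sdiff, Finset.mem_insert, Finset.mem_singleton] at hx ⊢
    tauto

theorem within_insert_insert (a b : α) (F : Finset α) : Within 1 (insert a F) (insert b F) := by
  constructor
  · refine (Finset.card_le_card (t := {a}) fun x hx => ?_).trans (by simp)
    simp only [Finset.mem_sdiff, Finset.mem_insert, Finset.mem_singleton] at hx ⊢
    tauto
  · refine (Finset.card_le_card (t := {b}) fun x hx => ?_).trans (by simp)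
    simp only [Finset.mem_sdiff, Finset.mem_insert, Finset.mem_singleton] at hx ⊢
    tauto

theorem Within.union {k k' : ℕ} {F F' H H' : Finset α} (h : Within k F F') (h' : Within k' H H') :
    Within (k + k') (F ∪ H) (F' ∪ H') := by
  constructor
  · refine (Finset.card_le_card (t := (F \ F') ∪ (H \ H')) fun x hx => ?_).trans
      ((Finset.card_union_le _ _).trans (add_le_add h.1 h'.1))
    simp only [Finset.mem_sdiff, Finset.mem_union] at hx ⊢
    tauto
  · refine (Finset.card_le_card (t := (F' \ F) ∪ (H' \ H)) fun x hx => ?_).trans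
      ((Finset.card_union_le _ _).trans (add_le_add h.2 h'.2))
    simp only [Finset.mem_sdiff, Finset.mem_union] at hx ⊢
    tauto

end Within

section FamilyEdges

variable {V : Type*} [DecidableEq V]

/-- All edges of a family of paths. -/
def familyEdges (Cs : List (List V)) : Finset (Sym2 V) := Cs.toFinset.biUnion pathEdges

theorem mem_familyEdges {Cs : List (List V)} {e : Sym2 V} :
    e ∈ familyEdges Cs ↔ ∃ C ∈ Cs, e ∈ pathEdges C := by
  simp [familyEdges]

theorem familyEdges_cons (C : List V) (Cs : List (List V)) :
    familyEdges (C :: Cs) = pathEdges C ∪ familyEdges Cs := by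
  ext e
  simp [mem_familyEdges]

theorem familyEdges_perm {Cs Cs' : List (List V)} (h : Cs.Perm Cs') :
    familyEdges Cs = familyEdges Cs' := by
  ext e
  simp [mem_familyEdges, h.mem_iff]

theorem pathEdges_append {l l' : List V} {p w : V} (hl : l.getLast? = some p)
    (hl' : l'.head? = some w) :
    pathEdges (l ++ l') = insert s(p, w) (pathEdges l ∪ pathEdges l') := by
  obtain ⟨l, rfl⟩ := List.getLast?_eq_some_iff.mp hl
  obtain ⟨l', rfl⟩ := List.head?_eq_some_iff.mp hl'
  rw [List.append_assoc, List.cons_append, List.nil_append, pathEdges_append_cons_cons,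
    Finset.union_insert]

end FamilyEdges

/-! ### Absorbing cycles into a path until a Hamilton cycle is left. -/

namespace SimpleGraph

variable {V : Type*} [Fintype V] [DecidableEq V] {G : SimpleGraph V} [DecidableRel G.Adj]

variable (G) in
/-- A list that traces a closed walk of `G` (an edge if it has two entries). -/
def IsCyclicList (C : List V) : Prop :=
  C.IsChain G.Adj ∧ ∀ u ∈ C.getLast?, ∀ v ∈ C.head?, G.Adj u v

/-- Opening a closed list elsewhere only trades the edge that is cut for the wrap-around edge. -/
theorem IsCyclicList.rotate {c₁ c₂ : List V} {w : V} (h : IsCyclicList G (c₁ ++ w :: c₂)) :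
    (w :: (c₂ ++ c₁)).IsChain G.Adj ∧
      Within 1 (pathEdges (c₁ ++ w :: c₂)) (pathEdges (w :: (c₂ ++ c₁))) := by
  rcases List.eq_nil_or_concat c₁ with rfl | ⟨c, p, hc⟩
  · simpa using ⟨h.1, (Within.refl _).mono (by omega)⟩
  have hlast : c₁.getLast? = some p := by simp [hc]
  obtain ⟨x, hx⟩ : ∃ x, c₁.head? = some x := by
    cases c₁ with
    | nil => simp at hlast
    | cons x _ => exact ⟨x, rfl⟩
  obtain ⟨y, hy⟩ : ∃ y, (w :: c₂).getLast? = some y := ⟨_, List.getLast?_cons⟩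
  have hadj : G.Adj y x := by
    refine h.2 y ?_ x ?_
    · rw [List.getLast?_append_of_ne_nil _ (by simp), hy]; rfl
    · rw [List.head?_append_of_ne_nil _ (by rintro rfl; simp at hx), hx]; rfl
  have hch := h.1
  rw [List.isChain_append] at hch
  rw [← List.cons_append, pathEdges_append hy hx, pathEdges_append hlast (w := w) rfl,
    Finset.union_comm (pathEdges (w :: c₂)), List.isChain_append]
  refine ⟨⟨hch.2.1, hch.1, fun a ha b hb => ?_⟩, within_insert_insert _ _ _⟩
  rw [hy] at ha
  rw [hx] at hb
  simp only [Option.mem_def, Option.some.injEq] at ha hb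
  rwa [← ha, ← hb]

theorem IsSide.even_length {A : Finset V} (hA : IsSide G A) {C : List V} (hC : IsCyclicList G C) :
    Even C.length := by
  by_cases hne : C = []
  · simp [hne]
  have h1 := List.head?_eq_some_head hne
  have h2 := List.getLast?_eq_some_getLast hne
  rw [← hA.mem_iff_even hC.1 h1 h2]
  have := hA _ _ (hC.2 _ h2 _ h1)
  tauto

/-- A path can absorb a cycle adjacent to its head. -/
theorem IsCyclicList.absorb {P C : List V} {v w : V} (hP : P.IsChain G.Adj)
    (hC : IsCyclicList G C) (hv : P.head? = some v) (hadj : G.Adj v w) (hw : w ∈ C) :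
    ∃ Q, Q.Perm (P ++ C) ∧ Q.IsChain G.Adj ∧ Within 2 (pathEdges P ∪ pathEdges C) (pathEdges Q) := by
  obtain ⟨c₁, c₂, rfl⟩ := List.append_of_mem hw
  obtain ⟨hch, hwithin⟩ := hC.rotate
  have hlast : (w :: (c₂ ++ c₁)).reverse.getLast? = some w := by
    rw [List.getLast?_reverse]; rfl
  refine ⟨(w :: (c₂ ++ c₁)).reverse ++ P, ?_, ?_, ?_⟩
  · refine List.perm_append_comm.trans (List.Perm.append_left _ ((List.reverse_perm _).trans ?_))
    rw [← List.cons_append]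
    exact List.perm_append_comm
  · rw [List.isChain_append]
    refine ⟨isChain_adj_reverse hch, hP, fun a ha b hb => ?_⟩
    rw [hlast] at ha
    rw [hv] at hb
    simp only [Option.mem_def, Option.some.injEq] at ha hb
    rw [← ha, ← hb]
    exact hadj.symm
  · rw [pathEdges_append hlast hv, pathEdges_reverse, Finset.union_comm]
    exact (hwithin.union (Within.refl _)).trans (within_insert _ _)

variable {A : Finset V} {β h τ τ₁ ρ : ℕ}

/-- A cover of the vertices by a path and cycles can be turned into a Hamilton cycle by changing few
edges per cycle. -/
theorem SideLinked.exists_hamiltonian_of_path (hA : SideLinked G A β h τ τ₁)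
    (hA' : SideLinked G Aᶜ β h τ τ₁) (hβ : 32 * β < h) (hτ : 16 * τ ≤ h) (hτ₁ : 8 * β ≤ τ₁)
    (hρ : τ₁ < 2 ^ ρ) (hρ' : τ < 2 ^ ρ) {K : ℕ} (hK : 8 * ρ + 8 ≤ 3 * K)
    (hKτ : K * (2 * h + 2) ≤ 8 * τ₁)
    (hconn : ∀ U : Finset V, U.Nonempty → (∀ u ∈ U, ∀ w, G.Adj u w → w ∈ U) → U = Finset.univ)
    (Cs : List (List V)) (hcyc : ∀ C ∈ Cs, IsCyclicList G C ∧ C ≠ []) (P : List V) (hne : P ≠ [])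
    (hch : P.IsChain G.Adj) (heven : Even P.length) (hnd : (P ++ Cs.flatten).Nodup)
    (hcov : ∀ x, x ∈ P ++ Cs.flatten) :
    ∃ H : List V, H.Nodup ∧ (∀ x, x ∈ H) ∧ IsCyclicList G H ∧
      Within ((4 * ρ + 3) * (Cs.length + 1)) (familyEdges (P :: Cs)) (pathEdges H) := by
  induction hj : Cs.length generalizing Cs P with
  | zero =>
    obtain rfl := List.length_eq_zero_iff.mp hj
    simp only [List.flatten_nil, List.append_nil] at hnd hcov
    obtain ⟨P', hreach, v, hv, hcase⟩ := hA.exists_closing hA' hβ hτ hτ₁ hρ hρ' hK hKτ hnd hch hne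
      heven
    rcases hcase with ⟨u, hu, hadj⟩ | ⟨w, -, hw⟩
    · refine ⟨P', hreach.1.nodup_iff.mpr hnd, fun x => hreach.1.mem_iff.mpr (hcov x),
        ⟨hreach.2.1, fun a ha b hb => ?_⟩, ?_⟩
      · rw [hu] at ha
        rw [hv] at hb
        simp only [Option.mem_def, Option.some.injEq] at ha hb
        rwa [← ha, ← hb]
      · have h1 : Within (4 * ρ) (pathEdges P) (pathEdges P') := hreach.2.2
        rw [familyEdges_cons]
        refine Within.mono (k := 4 * ρ) ?_ (by omega)
        simpa [familyEdges] using h1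
    · exact absurd (hcov w) hw
  | succ j ih =>
    have hndP : P.Nodup := (List.nodup_append'.mp hnd).1
    obtain ⟨P₁, hreach, v, hv, hcase⟩ := hA.exists_closing hA' hβ hτ hτ₁ hρ hρ' hK hKτ hndP hch hne
      heven
    obtain ⟨P₂, v₂, w, hperm₂, hch₂, hv₂, hadj₂, hw, hwithin₂⟩ : ∃ P₂ v₂ w, P₂.Perm P ∧
        P₂.IsChain G.Adj ∧ P₂.head? = some v₂ ∧ G.Adj v₂ w ∧ w ∉ P ∧
          Within (4 * ρ + 1) (pathEdges P) (pathEdges P₂) := by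
      rcases hcase with ⟨u, hu, hadj⟩ | ⟨w, hw, hwP⟩
      swap
      · exact ⟨P₁, v, w, hreach.1, hreach.2.1, hv, hw, hwP, Within.mono hreach.2.2 (by omega)⟩
      -- If the path closes up while vertices remain outside, connectedness provides an edge leaving
      -- it, and the cycle is reopened at the end of that edge.
      have hcl : ∃ x ∈ P, ∃ y, G.Adj x y ∧ y ∉ P := by
        by_contra! hcon
        have h1 := hconn P.toFinset (by simpa using hne) (by simpa using hcon)
        obtain ⟨C, hC⟩ := List.exists_mem_of_length_pos (by omega : 0 < Cs.length)
        obtain ⟨y, hy⟩ := List.exists_mem_of_ne_nil _ (hcyc C hC).2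
        have h2 : y ∈ P.toFinset := by rw [h1]; simp
        exact (List.nodup_append'.mp hnd).2.2 (List.mem_toFinset.mp h2)
          (List.mem_flatten.mpr ⟨C, hC, hy⟩)
      obtain ⟨x, hx, y, hxy, hy⟩ := hcl
      obtain ⟨p₁, p₂, rfl⟩ := List.append_of_mem (hreach.1.mem_iff.mpr hx)
      have hcycP : IsCyclicList G (p₁ ++ x :: p₂) := ⟨hreach.2.1, fun a ha b hb => by
        rw [hu] at ha
        rw [hv] at hb
        simp only [Option.mem_def, Option.some.injEq] at ha hb
        rwa [← ha, ← hb]⟩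
      refine ⟨x :: (p₂ ++ p₁), x, y, ?_, hcycP.rotate.1, rfl, hxy, hy,
        Within.trans hreach.2.2 hcycP.rotate.2⟩
      refine List.Perm.trans ?_ hreach.1
      rw [← List.cons_append]
      exact List.perm_append_comm
    obtain ⟨C, hC, hwC⟩ := List.mem_flatten.mp ((List.mem_append.mp (hcov w)).resolve_left hw)
    obtain ⟨Q, hQperm, hQch, hQwithin⟩ := (hcyc C hC).1.absorb hch₂ hv₂ hadj₂ hwC
    have hCs := List.perm_cons_erase hC
    have hflat : (P ++ Cs.flatten).Perm (Q ++ (Cs.erase C).flatten) := by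
      refine (List.Perm.append_left P hCs.flatten).trans ?_
      rw [List.flatten_cons, ← List.append_assoc]
      exact List.Perm.append_right _ ((hperm₂.symm.append_right C).trans hQperm.symm)
    obtain ⟨H, hH1, hH2, hH3, hH4⟩ := ih (Cs.erase C)
      (fun D hD => hcyc D (List.mem_of_mem_erase hD)) Q
      (by
        rintro rfl
        have := hQperm.length_eq
        have := List.length_pos_of_mem hwC
        simp at *
        omega) hQch
      (by
        rw [hQperm.length_eq, List.length_append, hperm₂.length_eq]
        exact heven.add (hA.side.even_length (hcyc C hC).1))
      (hflat.nodup_iff.mp hnd) (fun x => hflat.mem_iff.mp (hcov x))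
      (by rw [List.length_erase_of_mem hC]; omega)
    refine ⟨H, hH1, hH2, hH3, ?_⟩
    rw [familyEdges_cons, familyEdges_perm hCs, familyEdges_cons, ← Finset.union_assoc]
    -- Per merged cycle: 4ρ edits for closing, one for reopening and two for absorbing. All cycles
    -- have even length, so the new path still has an even number of vertices.
    have h1 : Within (4 * ρ + 3) (pathEdges P ∪ pathEdges C) (pathEdges Q) :=
      ((hwithin₂.union (Within.refl (pathEdges C))).trans hQwithin)
    have h2 := (h1.union (Within.refl (familyEdges (Cs.erase C))))
    rw [familyEdges_cons] at hH4
    refine (h2.trans hH4).mono ?_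
    apply le_of_eq
    ring

theorem SideLinked.exists_hamiltonian (hA : SideLinked G A β h τ τ₁)
    (hA' : SideLinked G Aᶜ β h τ τ₁) (hβ : 32 * β < h) (hτ : 16 * τ ≤ h) (hτ₁ : 8 * β ≤ τ₁)
    (hρ : τ₁ < 2 ^ ρ) (hρ' : τ < 2 ^ ρ) {K : ℕ} (hK : 8 * ρ + 8 ≤ 3 * K)
    (hKτ : K * (2 * h + 2) ≤ 8 * τ₁)
    (hconn : ∀ U : Finset V, U.Nonempty → (∀ u ∈ U, ∀ w, G.Adj u w → w ∈ U) → U = Finset.univ)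
    [Nonempty V] (Cs : List (List V)) (hcyc : ∀ C ∈ Cs, IsCyclicList G C ∧ C ≠ [])
    (hnd : Cs.flatten.Nodup) (hcov : ∀ x, x ∈ Cs.flatten) :
    ∃ H : List V, H.Nodup ∧ (∀ x, x ∈ H) ∧ IsCyclicList G H ∧
      Within ((4 * ρ + 3) * Cs.length) (familyEdges Cs) (pathEdges H) := by
  cases Cs with
  | nil => simpa using hcov (Classical.arbitrary V)
  | cons P Cs =>
    have hP := hcyc P (by simp)
    simpa using hA.exists_hamiltonian_of_path hA' hβ hτ hτ₁ hρ hρ' hK hKτ hconn Cs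
      (fun C hC => hcyc C (by simp [hC])) P hP.2 hP.1.1 (hA.side.even_length hP.1)
      (by simpa using hnd) (by simpa using hcov)

end SimpleGraph

/-! ### Recovering a permutation from a Hamilton cycle and few edits. -/

/-- The number of subsets with at most `k` elements. -/
theorem card_filter_card_le {α : Type*} [Fintype α] [DecidableEq α] (k : ℕ) :
    (Finset.univ.filter fun S : Finset α => S.card ≤ k).card ≤ (Fintype.card α + 1) ^ k := by
  classical
  have h : (Finset.univ : Finset (Fin k → Option α)).card = (Fintype.card α + 1) ^ k := by simp
  rw [← h]
  -- A small set is listed in `k` slots, the unused ones holding `none`.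
  refine Finset.card_le_card_of_surjOn
    (fun f => Finset.univ.filter fun x => ∃ i, f i = some x) fun S hS => ?_
  have hS' : S.card ≤ k := by simpa using hS
  refine ⟨fun i => S.toList[(i : ℕ)]?, by simp, ?_⟩
  ext x
  simp only [Finset.mem_filter, Finset.mem_univ, true_and]
  rw [← Finset.mem_toList, List.mem_iff_getElem?]
  constructor
  · rintro ⟨i, hi⟩
    exact ⟨i, hi⟩
  · rintro ⟨i, hi⟩
    obtain ⟨hlt, -⟩ := List.getElem?_eq_some_iff.mp hi
    rw [Finset.length_toList] at hlt
    exact ⟨⟨i, by omega⟩, hi⟩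

section Traces

variable {V : Type*} [Fintype V] [DecidableEq V]

/-- Two paths with the same head, both saturated in the edge set `F`, agree. -/
theorem eq_of_saturated {F : Finset (Sym2 V)} (p : List V) (x : V) (t t' : List V)
    (hnd : (p ++ x :: t).Nodup) (hnd' : (p ++ x :: t').Nodup)
    (hF : pathEdges (p ++ x :: t) ⊆ F) (hF' : pathEdges (p ++ x :: t') ⊆ F)
    (hsat : ∀ y z, s(y, z) ∈ F → y ∈ p ++ x :: t → s(y, z) ∈ pathEdges (p ++ x :: t))
    (hsat' : ∀ y z, s(y, z) ∈ F → y ∈ p ++ x :: t' → s(y, z) ∈ pathEdges (p ++ x :: t')) :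
    t = t' := by
  have hmem : ∀ (y : V) (s : List V), s(x, y) ∈ pathEdges (p ++ x :: y :: s) := fun y s => by
    rw [pathEdges_append_cons_cons]
    simp
  have hnotlast : ∀ (y : V) (s : List V), (p ++ x :: y :: s).Nodup → p.getLast? ≠ some y :=
    fun y s hnd hl => (List.nodup_append'.mp hnd).2.2 (List.mem_of_getLast? hl) (by simp)
  induction t generalizing p x t' with
  | nil =>
    cases t' with
    | nil => rfl
    | cons y s =>
      have h1 := hsat x y (hF' (hmem y s)) (by simp)
      rcases neighbor_cases hnd h1 with h | h
      · exact absurd h (hnotlast y s hnd')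
      · simp at h
  | cons y s ih =>
    have h1 := hsat' x y (hF (hmem y s)) (by simp)
    rcases neighbor_cases hnd' h1 with h | h
    · exact absurd h (hnotlast y s hnd)
    · obtain ⟨s', rfl⟩ := List.head?_eq_some_iff.mp h
      have e : ∀ s, p ++ x :: y :: s = (p ++ [x]) ++ y :: s := by simp
      rw [e] at hnd hnd' hF hF'
      simp only [e] at hsat hsat'
      rw [ih (p ++ [x]) y s' hnd hnd' hF hF' hsat hsat' (fun z s => by
        rw [pathEdges_append_cons_cons]; simp) fun z s hnd hl =>
          (List.nodup_append'.mp hnd).2.2 (List.mem_of_getLast? hl) (by simp)]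

/-- The orbits of `σ` are the orbits of the vertices in `S`, and `F` is the set of edges of the
orbit lists of these vertices. -/
def Traces (σ : Equiv.Perm V) (F : Finset (Sym2 V)) (S : Finset V) : Prop :=
  (∀ x, ∃ v ∈ S, x ∈ orbitList σ v) ∧ ∀ v ∈ S, pathEdges (orbitList σ v) ⊆ F ∧
    ∀ x y, s(x, y) ∈ F → x ∈ orbitList σ v → s(x, y) ∈ pathEdges (orbitList σ v)

theorem exists_orbitList_eq_cons (σ : Equiv.Perm V) (v : V) : ∃ t, orbitList σ v = v :: t := by
  obtain ⟨n, hn⟩ := Nat.exists_eq_succ_of_ne_zero (minimalPeriod_perm_pos σ v).ne'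
  rw [orbitList, hn]
  exact ⟨_, rfl⟩

/-- The wrap-around edge is not among the edges of an orbit list, so `v` is an end of its path in
`F`. The list starting at `v`, and with it the orientation of the orbit, is therefore forced; this
is why one vertex per orbit has to be recorded. -/
theorem Traces.injective {σ σ' : Equiv.Perm V} {F : Finset (Sym2 V)} {S : Finset V}
    (h : Traces σ F S) (h' : Traces σ' F S) : σ = σ' := by
  ext x
  obtain ⟨v, hv, hx⟩ := h.1 x
  refine apply_eq_of_orbitList_eq ?_ hx
  obtain ⟨t, ht⟩ := exists_orbitList_eq_cons σ v
  obtain ⟨t', ht'⟩ := exists_orbitList_eq_cons σ' v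
  have h1 := h.2 v hv
  have h2 := h'.2 v hv
  have hnd := nodup_orbitList σ v
  have hnd' := nodup_orbitList σ' v
  rw [ht] at h1 hnd
  rw [ht'] at h2 hnd'
  rw [ht, ht', eq_of_saturated [] v t t' hnd hnd' h1.1 h2.1 h1.2 h2.2]

theorem traces_of_orbitLists {σ : Equiv.Perm V} {Cs : List (List V)} (hnd : Cs.flatten.Nodup)
    (hcov : ∀ x, x ∈ Cs.flatten) (horb : ∀ C ∈ Cs, ∃ v, C = orbitList σ v) :
    ∃ S : Finset V, S.card ≤ Cs.length ∧ Traces σ (familyEdges Cs) S := by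
  have hmem : ∀ v, v ∈ (Cs.filterMap List.head?).toFinset ↔ orbitList σ v ∈ Cs := fun v => by
    rw [List.mem_toFinset, List.mem_filterMap]
    constructor
    · rintro ⟨C, hC, hv⟩
      obtain ⟨w, rfl⟩ := horb C hC
      obtain ⟨t, ht⟩ := exists_orbitList_eq_cons σ w
      rw [ht] at hv
      obtain rfl : w = v := by simpa using hv
      exact hC
    · intro h
      obtain ⟨t, ht⟩ := exists_orbitList_eq_cons σ v
      exact ⟨_, h, by rw [ht]; rfl⟩
  refine ⟨(Cs.filterMap List.head?).toFinset,
    (List.toFinset_card_le _).trans (List.length_filterMap_le _ _), fun x => ?_, fun v hv => ⟨?_, ?_⟩⟩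
  · obtain ⟨C, hC, hx⟩ := List.mem_flatten.mp (hcov x)
    obtain ⟨v, rfl⟩ := horb C hC
    exact ⟨v, (hmem v).mpr hC, hx⟩
  · exact fun e he => mem_familyEdges.mpr ⟨_, (hmem v).mp hv, he⟩
  · intro x y hxy hx
    obtain ⟨C, hC, he⟩ := mem_familyEdges.mp hxy
    have : Std.Symm (List.Disjoint : List V → List V → Prop) := ⟨fun _ _ h => h.symm⟩
    by_cases hCv : C = orbitList σ v
    · rwa [← hCv]
    · exact absurd hx ((List.nodup_flatten.mp hnd).2.forall hC ((hmem v).mp hv) hCv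
        (mem_of_mem_pathEdges he).1)

end Traces

namespace SimpleGraph

variable {V : Type*} [Fintype V] [DecidableEq V] {G : SimpleGraph V} [DecidableRel G.Adj]

theorem isCyclicList_orbitList {σ : Equiv.Perm V} (hσ : σ ∈ G.factorPerms Finset.univ) (v : V) :
    IsCyclicList G (orbitList σ v) := by
  have hadj : ∀ x, G.Adj x (σ x) := fun x => adj_of_mem_factorPerms hσ (Finset.mem_univ x)
  constructor
  · rw [List.isChain_iff_getElem]
    intro i hi
    simp only [orbitList, List.getElem_iterate, Function.iterate_succ_apply']
    exact hadj _
  · intro u hu w hw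
    obtain ⟨t, ht⟩ := exists_orbitList_eq_cons σ v
    obtain rfl : v = w := by rw [ht] at hw; simpa using hw
    rw [List.getLast?_eq_getElem?, Option.mem_def, List.getElem?_eq_some_iff] at hu
    obtain ⟨hlt, hu⟩ := hu
    simp only [orbitList, List.getElem_iterate, List.length_iterate] at hu
    have h1 : σ u = v := by
      rw [← hu, ← Function.iterate_succ_apply' σ, Nat.succ_eq_add_one,
        Nat.sub_add_cancel (minimalPeriod_perm_pos σ v)]
      exact Function.iterate_minimalPeriod
    have h2 := hadj u
    rwa [h1] at h2

theorem Walk.mem_edges_iff_mem_pathEdges {a b : V} (p : G.Walk a b) (e : Sym2 V) :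
    e ∈ p.edges ↔ e ∈ pathEdges p.support := by
  induction p with
  | nil => simp [pathEdges]
  | @cons a b c hab p ih =>
    obtain ⟨t, ht⟩ : ∃ t, p.support = b :: t := ⟨_, (Walk.cons_tail_support p).symm⟩
    rw [Walk.edges_cons, Walk.support_cons, List.mem_cons, ih, ht, pathEdges, Finset.mem_insert]

/-- A cyclic list of all vertices traces a Hamilton cycle. -/
theorem IsCyclicList.exists_isHamiltonianCycle {H : List V} (hH : IsCyclicList G H) (hnd : H.Nodup)
    (hcov : ∀ x, x ∈ H) (hcard : 3 ≤ Fintype.card V) :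
    ∃ (a : V) (p : G.Walk a a), p.IsHamiltonianCycle ∧
      Within 1 (pathEdges H) p.edges.toFinset := by
  have hlen : H.length = Fintype.card V := by
    rw [← List.toFinset_card_of_nodup hnd, ← Finset.card_univ]
    congr 1
    ext x
    simp [hcov]
  have hne : H ≠ [] := by rintro rfl; simp at hlen; omega
  have hadj : G.Adj (H.getLast hne) (H.head hne) :=
    hH.2 _ (List.getLast?_eq_some_getLast hne) _ (List.head?_eq_some_head hne)
  have hch : H.IsChain G.Adj := hH.1
  have hsupp := Walk.support_ofSupport hne hch
  refine ⟨H.getLast hne, Walk.cons hadj (Walk.ofSupport H hne hch), ?_, ?_⟩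
  · rw [Walk.isHamiltonianCycle_isCycle_and_isHamiltonian_tail,
      Walk.isCycle_iff_isPath_tail_and_le_length]
    have hpath : (Walk.cons hadj (Walk.ofSupport H hne hch)).tail.support = H := by
      rw [Walk.support_tail_of_not_nil _ Walk.not_nil_cons, Walk.support_cons, List.tail_cons, hsupp]
    have hp : (Walk.cons hadj (Walk.ofSupport H hne hch)).tail.IsPath := by
      rw [Walk.isPath_def, hpath]
      exact hnd
    refine ⟨⟨hp, ?_⟩, hp.isHamiltonian_of_mem fun w => by rw [hpath]; exact hcov w⟩
    rw [Walk.length_cons, Walk.length_ofSupport]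
    omega
  · have : (Walk.cons hadj (Walk.ofSupport H hne hch)).edges.toFinset =
        insert s(H.getLast hne, H.head hne) (pathEdges H) := by
      ext e
      rw [List.mem_toFinset, Walk.edges_cons, List.mem_cons, Walk.mem_edges_iff_mem_pathEdges, hsupp,
        Finset.mem_insert]
    rw [this]
    exact within_insert _ _

/-- A Hamilton cycle defines a permutation from which it can be recovered. -/
theorem Walk.IsHamiltonianCycle.exists_perm {a : V} {p : G.Walk a a} (hp : p.IsHamiltonianCycle) :
    ∃ σ ∈ G.factorPerms Finset.univ, ∀ u v, p.toSubgraph.Adj u v ↔ σ u = v ∨ σ v = u := by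
  set xs := p.support.dropLast with hxs
  have hlen : xs.length = p.length := by simp [hxs]
  have hpos : 0 < p.length := by have := hp.isCycle.three_le_length; omega
  have hget : ∀ i, i < p.length → p.getVert i ∈ xs ∧ xs.formPerm (p.getVert i) =
      p.getVert (i + 1) := fun i hi => by
    have h1 : ∀ j (hj : j < xs.length), xs[j] = p.getVert j := fun j hj => by
      simp only [hxs, List.getElem_dropLast, Walk.support_getElem_eq_getVert]
    rw [← h1 i (by omega)]
    refine ⟨List.getElem_mem _, ?_⟩
    rw [List.formPerm_apply_getElem _ hp.isCycle.nodup_dropLast_support, h1, hlen]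
    rcases Nat.lt_or_ge (i + 1) p.length with h | h
    · rw [Nat.mod_eq_of_lt h]
    · have h2 : i + 1 = p.length := by omega
      simp [h2]
  have hall : ∀ x, ∃ i < p.length, p.getVert i = x := fun x => by
    obtain ⟨i, hi, hle⟩ := Walk.mem_support_iff_exists_getVert.mp (hp.mem_support x)
    rcases Nat.lt_or_ge i p.length with h | h
    · exact ⟨i, h, hi⟩
    · refine ⟨0, hpos, ?_⟩
      rw [← hi, show i = p.length by omega]
      simp
  refine ⟨xs.formPerm, ?_, fun u v => ?_⟩
  · simp only [factorPerms, Finset.mem_filter, Finset.mem_univ, true_and, if_true]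
    intro x
    obtain ⟨i, hi, rfl⟩ := hall x
    rw [(hget i hi).2]
    exact p.adj_getVert_succ hi
  · rw [Walk.toSubgraph_adj_iff]
    constructor
    · rintro ⟨i, he, hi⟩
      rw [Sym2.eq_iff] at he
      rcases he with ⟨rfl, rfl⟩ | ⟨rfl, rfl⟩
      · exact Or.inl (hget i hi).2
      · exact Or.inr (hget i hi).2
    · rintro (h | h)
      · obtain ⟨i, hi, rfl⟩ := hall u
        exact ⟨i, by rw [← h, (hget i hi).2], hi⟩
      · obtain ⟨i, hi, rfl⟩ := hall v
        exact ⟨i, by rw [← h, (hget i hi).2, Sym2.eq_swap], hi⟩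

-- Orienting a Hamilton cycle gives a permutation along edges, and the cycle can be read off from
-- it.
open Classical in
theorem numHamiltonCycles_le_card_factorPerms :
    G.numHamiltonCycles ≤ (G.factorPerms Finset.univ).card := by
  have hfin : Finite G.Subgraph := inferInstance
  have := Fintype.ofFinite G.Subgraph
  rw [numHamiltonCycles, Set.ncard_eq_toFinset_card']
  have hex : ∀ H : G.Subgraph, (∃ (a : V) (p : G.Walk a a), p.IsHamiltonianCycle ∧
      p.toSubgraph = H) → ∃ σ ∈ G.factorPerms Finset.univ,
        H.verts = Set.univ ∧ ∀ u v, H.Adj u v ↔ σ u = v ∨ σ v = u := by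
    rintro H ⟨a, p, hp, rfl⟩
    obtain ⟨σ, hσ, h⟩ := hp.exists_perm
    refine ⟨σ, hσ, ?_, h⟩
    ext x
    simpa using hp.mem_support x
  choose! f hf hverts hadj using hex
  refine Finset.card_le_card_of_injOn f (fun H hH => hf H (by simpa using hH)) ?_
  intro H hH H' hH' heq
  simp only [Set.coe_toFinset, Set.mem_ofPred_eq] at hH hH'
  refine Subgraph.ext ((hverts H hH).trans (hverts H' hH').symm) ?_
  ext u v
  rw [hadj H hH, hadj H' hH', heq]

open Classical in
/-- If all permutations in `T` can be turned into Hamilton cycles by changing few edges, then there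
are almost as many Hamilton cycles as elements of `T`. -/
theorem card_le_numHamiltonCycles_mul {k s : ℕ} (T : Finset (Equiv.Perm V))
    (hT : ∀ σ ∈ T, ∃ F S, Traces σ F S ∧ S.card ≤ s ∧ ∃ (a : V) (p : G.Walk a a),
      p.IsHamiltonianCycle ∧ Within k F p.edges.toFinset) :
    T.card ≤ G.numHamiltonCycles * (Fintype.card V ^ 2 + 1) ^ (2 * k + s) := by
  have hfin : Finite G.Subgraph := inferInstance
  have := Fintype.ofFinite G.Subgraph
  have hT' : ∀ σ ∈ T, ∃ F S, ∃ H : G.Subgraph, Traces σ F S ∧ S.card ≤ s ∧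
      (∃ (a : V) (p : G.Walk a a), p.IsHamiltonianCycle ∧ p.toSubgraph = H) ∧
        Within k F (Finset.univ.filter fun e => e ∈ H.edgeSet) := fun σ hσ => by
    obtain ⟨F, S, h1, h2, a, p, hp, h3⟩ := hT σ hσ
    refine ⟨F, S, p.toSubgraph, h1, h2, ⟨a, p, hp, rfl⟩, ?_⟩
    have : (Finset.univ.filter fun e => e ∈ p.toSubgraph.edgeSet) = p.edges.toFinset := by
      ext e
      simp
    rwa [this]
  choose! F S H h1 h2 h3 h4 using hT'
  let EH : Equiv.Perm V → Finset (Sym2 V) := fun σ => Finset.univ.filter fun e => e ∈ (H σ).edgeSet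
  let HC : Finset G.Subgraph :=
    Set.toFinset {H | ∃ (a : V) (p : G.Walk a a), p.IsHamiltonianCycle ∧ p.toSubgraph = H}
  let B : Finset (Finset (Sym2 V)) := Finset.univ.filter fun D => D.card ≤ k
  let B' : Finset (Finset V) := Finset.univ.filter fun D => D.card ≤ s
  -- The code consists of the Hamilton cycle, the two differences that recover `F` from it, and the
  -- set `S` of starting points.
  have hle : T.card ≤ (HC ×ˢ (B ×ˢ (B ×ˢ B'))).card := by
    refine Finset.card_le_card_of_injOn (fun σ => (H σ, F σ \ EH σ, EH σ \ F σ, S σ))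
      (fun σ hσ => ?_) fun σ hσ σ' hσ' heq => ?_
    · have h5 := h3 σ hσ
      simp only [Finset.coe_product, Set.mem_prod, Finset.mem_coe, HC, B, B', Set.mem_toFinset,
        Set.mem_ofPred_eq, Finset.mem_filter, Finset.mem_univ, true_and]
      exact ⟨h5, (h4 σ hσ).1, (h4 σ hσ).2, h2 σ hσ⟩
    · simp only [Prod.mk.injEq] at heq
      obtain ⟨hH, hD, hD', hS⟩ := heq
      have hEH : EH σ = EH σ' := by simp only [EH, hH]
      have hF : ∀ σ, F σ = (EH σ \ (EH σ \ F σ)) ∪ (F σ \ EH σ) := fun σ => by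
        ext e
        simp only [Finset.mem_union, Finset.mem_sdiff]
        tauto
      have hFF : F σ = F σ' := by rw [hF σ, hF σ', hD, hD', hEH]
      have h6 := h1 σ hσ
      rw [hFF, hS] at h6
      exact h6.injective (h1 σ' hσ')
  have hHC : HC.card = G.numHamiltonCycles := by
    rw [numHamiltonCycles, Set.ncard_eq_toFinset_card']
  have hSym : Fintype.card (Sym2 V) ≤ Fintype.card V ^ 2 := by
    rw [sq, ← Fintype.card_prod]
    exact Fintype.card_le_of_surjective (fun x : V × V => s(x.1, x.2)) fun e => by
      induction e with
      | _ x y => exact ⟨(x, y), rfl⟩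
  have hB : B.card ≤ (Fintype.card V ^ 2 + 1) ^ k := (card_filter_card_le k).trans (by gcongr)
  have hB' : B'.card ≤ (Fintype.card V ^ 2 + 1) ^ s := (card_filter_card_le s).trans (by
    gcongr
    exact Nat.le_self_pow (by norm_num) _)
  calc T.card ≤ HC.card * (B.card * (B.card * B'.card)) := by
        simpa only [Finset.card_product] using hle
    _ ≤ G.numHamiltonCycles * ((Fintype.card V ^ 2 + 1) ^ k * ((Fintype.card V ^ 2 + 1) ^ k *
        (Fintype.card V ^ 2 + 1) ^ s)) := by
        rw [hHC]
        gcongr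
    _ = _ := by rw [← pow_add, ← pow_add]; congr 2; ring

end SimpleGraph

/-! ### Upper and lower bounds for the number of Hamilton cycles. -/

namespace SimpleGraph

variable {V : Type*} [Fintype V] [DecidableEq V] {G : SimpleGraph V} [DecidableRel G.Adj]
  {d : ℕ} {lam : ℝ} {A : Finset V}

theorem IsBipartite.exists_isSide (hG : G.IsBipartite) : ∃ A : Finset V, IsSide G A := by
  obtain ⟨c⟩ := hG
  refine ⟨Finset.univ.filter fun v => c v = 0, fun u v huv => ?_⟩
  have h := c.valid huv
  simp only [Finset.mem_filter, Finset.mem_univ, true_and]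
  omega

/-- Two sets on opposite sides without edges between them satisfy d²|S||T| ≤ lam²|A|², which yields
`link` and `edge`; `expand` is the mixing lemma for small sets. -/
theorem IsSide.sideLinked (hA : IsSide G A) (hreg : G.IsRegularOfDegree d) (hd : 0 < d)
    (hlam0 : 0 < lam) (hlam : G.NontrivialEigenvaluesLE lam) (hgap : 6 * lam < d) {β h τ τ₁ : ℕ}
    (hlink : 4 * (lam ^ 2 * A.card ^ 2) ≤ (d : ℝ) ^ 2 * (h * β))
    (hedge : lam ^ 2 * A.card ^ 2 < (d : ℝ) ^ 2 * (τ + 1) ^ 2) (hτ₁ : 16 * τ₁ ≤ A.card) :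
    SideLinked G A β h τ τ₁ where
  side := hA
  link S hS T hT hno hβ := by
    have h1 := hA.card_mul_card_le hreg hd hlam0 hlam (by linarith) hS hT hno
    have hd' : (0 : ℝ) < d := by exact_mod_cast hd
    have h2 : (d : ℝ) ^ 2 * (4 * (S.card * T.card)) ≤ (d : ℝ) ^ 2 * (h * β) := by linarith
    have h3 := le_of_mul_le_mul_left h2 (by positivity)
    have h4 : 4 * (S.card * T.card) ≤ h * β := by exact_mod_cast h3
    by_contra! hlt
    nlinarith
  edge S hS T hT hSτ hTτ := by
    by_contra! hno
    have h1 := hA.card_mul_card_le hreg hd hlam0 hlam (by linarith) hS hT hno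
    have h2 : ((τ : ℝ) + 1) ^ 2 ≤ S.card * T.card := by
      have : (τ + 1) ^ 2 ≤ S.card * T.card := by
        rw [sq]
        exact Nat.mul_le_mul hSτ hTτ
      exact_mod_cast this
    have h3 := mul_le_mul_of_nonneg_left h2 (sq_nonneg (d : ℝ))
    linarith
  expand S hS hcard := hA.card_neighbors_ge hreg hd hlam0 hlam hgap hS (by omega)
    fun u hu v huv => by simpa using ⟨u, hu, huv⟩

/-- In a bipartite graph with a large spectral gap, a cover of the vertices by cycles can be turned
into a Hamilton cycle by changing `O(log n)` edges per cycle. -/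
theorem IsSide.exists_hamiltonian (hA : IsSide G A) (hreg : G.IsRegularOfDegree d) (hd : 0 < d)
    (hlam0 : 0 < lam) (hlam : G.NontrivialEigenvaluesLE lam) {ρ : ℕ}
    (hρ : Fintype.card V < 2 ^ ρ) (hgap : 128 * (3 * ρ + 3) * lam < d)
    (hcard : 20000 * (3 * ρ + 3) ≤ Fintype.card V) (Cs : List (List V))
    (hcyc : ∀ C ∈ Cs, IsCyclicList G C ∧ C ≠ []) (hnd : Cs.flatten.Nodup)
    (hcov : ∀ x, x ∈ Cs.flatten) :
    ∃ H : List V, H.Nodup ∧ (∀ x, x ∈ H) ∧ IsCyclicList G H ∧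
      Within ((4 * ρ + 3) * Cs.length) (familyEdges Cs) (pathEdges H) := by
  set K := 3 * ρ + 3 with hK
  have hK3 : 3 ≤ K := by omega
  set m := A.card with hm
  have hAc : A.card = Aᶜ.card := hA.card_eq hreg hd
  have hmn : 2 * m = Fintype.card V := by
    have := Finset.card_add_card_compl A
    omega
  have hmK : 10000 * K ≤ m := by omega
  -- τ₁ is the largest size covered by the expansion lemma, and `h` is chosen so that `K` blocks of
  -- 2h + 2 vertices fit into a path with 8τ₁ vertices. Then τ = h/16 and β = (h - 1)/32, the latter
  -- so that 32β < h is strict. Rounding still leaves m ≤ 8Kh and h ≤ 64β.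
  obtain ⟨τ₁, hτ₁⟩ : ∃ τ₁, τ₁ = m / 16 := ⟨_, rfl⟩
  obtain ⟨h, hh⟩ : ∃ h, h = 4 * τ₁ / K - 1 := ⟨_, rfl⟩
  have hKh : K * (h + 1) ≤ 4 * τ₁ := by
    have h1 : K * (4 * τ₁ / K) ≤ 4 * τ₁ := Nat.mul_div_le _ _
    have h2 : 1 ≤ 4 * τ₁ / K := by
      rw [Nat.one_le_div_iff (by omega)]
      omega
    rw [hh, Nat.sub_add_cancel h2]
    exact h1
  have hKh' : m ≤ 8 * (K * h) := by
    have h1 : 4 * τ₁ < K * (4 * τ₁ / K + 1) := Nat.lt_mul_div_succ _ (by omega)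
    have h2 : 4 * τ₁ / K + 1 ≤ h + 2 := by omega
    have h3 : K * (4 * τ₁ / K + 1) ≤ K * h + 2 * K := (Nat.mul_le_mul_left _ h2).trans_eq (by ring)
    omega
  have hh66 : 66 ≤ h := by
    by_contra! hlt
    have : K * h ≤ K * 66 := Nat.mul_le_mul_left _ (by omega)
    omega
  obtain ⟨τ, hτ⟩ : ∃ τ, τ = h / 16 := ⟨_, rfl⟩
  obtain ⟨β, hβ⟩ : ∃ β, β = (h - 1) / 32 := ⟨_, rfl⟩
  have hβh : h ≤ 64 * β := by omega
  have hKpos : (0 : ℝ) < K := by exact_mod_cast (by omega : 0 < K)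
  have hgap' : 128 * (K : ℝ) * lam < d := by rw [hK]; push_cast; linarith
  have hlamK : (128 * (K : ℝ) * lam) ^ 2 < (d : ℝ) ^ 2 := by gcongr
  have hKh'' : (m : ℝ) ≤ 8 * (K * h) := by exact_mod_cast hKh'
  have hpos : (0 : ℝ) < h := by exact_mod_cast (by omega : 0 < h)
  have hmsq : (m : ℝ) ^ 2 ≤ (8 * (K * h)) ^ 2 := by gcongr
  have hlm : lam ^ 2 * (m : ℝ) ^ 2 ≤ lam ^ 2 * (8 * (K * h)) ^ 2 := by gcongr
  -- The gap constant comes from here: 4 · 8² · 64 = 128².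
  have hlink : 4 * (lam ^ 2 * (m : ℝ) ^ 2) ≤ (d : ℝ) ^ 2 * (h * β) := by
    have h1 : (h : ℝ) ≤ 64 * β := by exact_mod_cast hβh
    have h2 : (128 * (K : ℝ) * lam) ^ 2 * (h * h) ≤ (d : ℝ) ^ 2 * (h * (64 * β)) := by gcongr
    nlinarith
  have hedge : lam ^ 2 * (m : ℝ) ^ 2 < (d : ℝ) ^ 2 * (τ + 1) ^ 2 := by
    have h1 : (h : ℝ) ≤ 16 * ((τ : ℝ) + 1) := by exact_mod_cast (by omega : h ≤ 16 * (τ + 1))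
    have h2 : (128 * (K : ℝ) * lam) ^ 2 * h ^ 2 < (d : ℝ) ^ 2 * (16 * ((τ : ℝ) + 1)) ^ 2 :=
      calc _ < (d : ℝ) ^ 2 * (h : ℝ) ^ 2 := by gcongr
        _ ≤ _ := by gcongr
    nlinarith
  have hK1 : (1 : ℝ) ≤ K := by exact_mod_cast (by omega : 1 ≤ K)
  have hgap6 : 6 * lam < d := by nlinarith
  have hL := hA.sideLinked hreg hd hlam0 hlam hgap6 hlink hedge (by omega : 16 * τ₁ ≤ m)
  have hL' := hA.compl.sideLinked hreg hd hlam0 hlam hgap6 (β := β) (h := h) (τ := τ) (τ₁ := τ₁)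
    (by rw [← hAc]; exact hlink) (by rw [← hAc]; exact hedge) (by omega)
  have : Nonempty V := Fintype.card_pos_iff.mp (by omega)
  have hKτ₁ : K * h ≤ 4 * τ₁ := by nlinarith
  have h3h : 3 * h ≤ K * h := Nat.mul_le_mul_right _ hK3
  exact hL.exists_hamiltonian hL' (by omega) (by omega) (by omega) (by omega) (by omega) (K := K)
    (by omega) (by nlinarith)
    (fun U hU hcl => eq_univ_of_closed hreg hlam (by linarith) hU hcl) Cs hcyc hnd hcov

theorem le_card_factorPerms (hreg : G.IsRegularOfDegree d) (hd : 0 < d) :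
    ((d : ℝ) / Real.exp 1) ^ Fintype.card V ≤ (G.factorPerms Finset.univ).card := by
  have h := le_card_perfectMatchings G.Adj (fun u v h => h.symm) d hd (fun v => by
    rw [← hreg v, ← G.card_neighborFinset_eq_degree]
    congr 1
    ext u
    simp)
  have heq : (perfectMatchings fun v => Finset.univ.filter fun u => G.Adj v u) =
      G.factorPerms Finset.univ := by
    ext σ
    simp [factorPerms, mem_perfectMatchings]
  rwa [heq] at h

/-- Deleting b vertices removes b factors d/e, but also lowers the mean degree by about d b/n. The
resulting (1 - b/n)^n ≈ e^(-b) cancels the factor e^b, so each deleted vertex costs 1/d. What is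
left is the loss in Bregman–Minc and the error terms `lam / d` and c/n in the exponent. -/
theorem card_factorPerms_le_mul_pow (hreg : G.IsRegularOfDegree d) (hd : 0 < d)
    (hlam0 : 0 < lam) (hlam : G.NontrivialEigenvaluesLE lam) (hlt : lam < d) [Nonempty V] (c : ℕ)
    (R : Finset V) (hR : Rᶜ.card ≤ c) :
    ((G.factorPerms R).card : ℝ) ≤ (((d : ℝ) / Real.exp 1) ^ Fintype.card V *
      Real.exp ((2 + 2 * Real.log d) * Fintype.card V / d)) *
        (Real.exp (lam / d + c / Fintype.card V) / d) ^ Rᶜ.card := by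
  refine (card_factorPerms_le hreg hlam hlt R).trans ?_
  have hd' : (0 : ℝ) < d := by exact_mod_cast hd
  set n : ℝ := (Fintype.card V : ℝ) with hn
  have hn0 : 0 < n := by
    rw [hn]
    exact_mod_cast Fintype.card_pos
  set q := 2 + 2 * Real.log d with hq
  have hq0 : 0 ≤ q := by
    have : 0 ≤ Real.log d := Real.log_nonneg (by exact_mod_cast hd)
    positivity
  have hRc : R.card + Rᶜ.card = Fintype.card V := Finset.card_add_card_compl R
  set r := R.card with hr
  set b := Rᶜ.card with hb
  have hrn : (r : ℝ) = n - b := by rw [hn, ← hRc]; push_cast; ring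
  have hb0 : (0 : ℝ) ≤ b := Nat.cast_nonneg b
  have hr0 : (0 : ℝ) ≤ r := Nat.cast_nonneg r
  have hbc : (b : ℝ) ≤ c := by exact_mod_cast hR
  have hbase : d * (r / n) + lam * (1 - r / n) + q =
      d * ((-(b / n) + lam / d * (b / n) + q / d) + 1) := by
    rw [hrn]
    field_simp
    ring
  have hexp : d * ((-(b / n) + lam / d * (b / n) + q / d) + 1) / Real.exp 1 ≤
      d / Real.exp 1 * Real.exp (-(b / n) + lam / d * (b / n) + q / d) := by
    rw [mul_div_right_comm]
    gcongr
    exact Real.add_one_le_exp _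
  have hnn : 0 ≤ d * ((-(b / n) + lam / d * (b / n) + q / d) + 1) / Real.exp 1 := by
    rw [← hbase]
    have : 0 ≤ 1 - r / n := by
      rw [sub_nonneg, div_le_one hn0]
      linarith
    positivity
  rw [hbase]
  refine (pow_le_pow_left₀ hnn hexp r).trans ?_
  rw [mul_pow, ← Real.exp_nat_mul, div_pow (Real.exp _), ← Real.exp_nat_mul, ← hRc, pow_add,
    div_pow _ _ b, ← Real.exp_nat_mul]
  have hkey : r * (-(b / n) + lam / d * (b / n) + q / d) ≤
      -b + q * n / d + b * (lam / d + c / n) := by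
    have h1 : (r : ℝ) * (-(b / n)) ≤ -b + b * (c / n) := by
      rw [hrn]
      have : (n - b) * -(b / n) = -b + b * (b / n) := by field_simp; ring
      rw [this]
      gcongr
    have h2 : (r : ℝ) * (lam / d * (b / n)) ≤ b * (lam / d) := by
      have : (r : ℝ) * (lam / d * (b / n)) = b * (lam / d) * (r / n) := by ring
      rw [this]
      refine mul_le_of_le_one_right (by positivity) ?_
      rw [div_le_one hn0]
      linarith
    have h3 : (r : ℝ) * (q / d) ≤ q * n / d := by
      rw [mul_comm q n, mul_div_assoc]
      gcongr
      linarith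
    nlinarith
  calc ((d : ℝ) / Real.exp 1) ^ r * Real.exp (r * (-(b / n) + lam / d * (b / n) + q / d))
      ≤ ((d : ℝ) / Real.exp 1) ^ r * Real.exp (-b + q * n / d + b * (lam / d + c / n)) := by
        gcongr
    _ = _ := by
        rw [Real.exp_add, Real.exp_add, Real.exp_neg, mul_one]
        field_simp

theorem choose_le_exp (n t : ℕ) (ht : 0 < t) (hn : 0 < n) :
    (n.choose t : ℝ) ≤ Real.exp (1 + Real.log (n / t)) ^ t := by
  have ht' : (0 : ℝ) < t := by exact_mod_cast ht
  have hn' : (0 : ℝ) < n := by exact_mod_cast hn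
  have h1 : (n.choose t : ℝ) ≤ (n : ℝ) ^ t / t.factorial := Nat.choose_le_pow_div t n
  have h2 := Real.pow_div_factorial_le_exp (t : ℝ) ht'.le t
  rw [Real.exp_add, Real.exp_log (by positivity), mul_pow, ← Real.exp_nat_mul, mul_one]
  calc (n.choose t : ℝ) ≤ (n : ℝ) ^ t / t.factorial := h1
    _ = ((t : ℝ) ^ t / t.factorial) * (n / t) ^ t := by rw [div_pow]; field_simp
    _ ≤ _ := by gcongr

open Classical in
/-- Few permutations moving all vertices along edges have many short orbits. -/
theorem card_manyShortOrbits_le_half (hreg : G.IsRegularOfDegree d) (hd : 0 < d)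
    (hlam0 : 0 < lam) (hlam : G.NontrivialEigenvaluesLE lam) (hlt : lam < d) [Nonempty V]
    {L t : ℕ} (hL : 0 < L) (ht : 0 < t)
    (hbad : (2 + 2 * Real.log d) * Fintype.card V / d + t * (1 + Real.log (Fintype.card V / t) +
      Real.log L + L * (lam / d + (t * L : ℕ) / Fintype.card V) - Real.log d) ≤ -Real.log 2) :
    2 * (((G.factorPerms Finset.univ).filter fun σ =>
      ∃ S : Finset V, S.card = t ∧ InDistinctShortOrbits σ L S).card : ℝ) ≤
      ((d : ℝ) / Real.exp 1) ^ Fintype.card V := by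
  have hd' : (0 : ℝ) < d := by exact_mod_cast hd
  have hL' : (0 : ℝ) < L := by exact_mod_cast hL
  have hκ0 : 0 ≤ lam / d + (t * L : ℕ) / (Fintype.card V : ℝ) := by positivity
  have hfact := card_factorPerms_le_mul_pow hreg hd hlam0 hlam hlt (t * L)
  generalize lam / d + (t * L : ℕ) / (Fintype.card V : ℝ) = κ at hbad hκ0 hfact
  have h1 := card_manyShortOrbits_le hreg L t (((d : ℝ) / Real.exp 1) ^ Fintype.card V *
      Real.exp ((2 + 2 * Real.log d) * Fintype.card V / d)) (Real.exp κ / d) (by positivity)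
    (by positivity) hfact
  -- Each orbit length contributes about 1/d, whatever the length, so a short orbit costs at most L
  -- exp(L κ)/d.
  have hsum : ∑ k ∈ Finset.range L, (d : ℝ) ^ k * (Real.exp κ / d) ^ (k + 1) ≤
      Real.exp (Real.log L + L * κ - Real.log d) := by
    rw [Real.exp_sub, Real.exp_add, Real.exp_log hL', Real.exp_log hd']
    calc ∑ k ∈ Finset.range L, (d : ℝ) ^ k * (Real.exp κ / d) ^ (k + 1)
        ≤ ∑ k ∈ Finset.range L, Real.exp (L * κ) / d := by
          refine Finset.sum_le_sum fun k hk => ?_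
          have hk' : ((k + 1 : ℕ) : ℝ) ≤ L := by exact_mod_cast Finset.mem_range.mp hk
          rw [div_pow, ← Real.exp_nat_mul, pow_succ (d : ℝ)]
          calc (d : ℝ) ^ k * (Real.exp ((k + 1 : ℕ) * κ) / (d ^ k * d))
              = Real.exp ((k + 1 : ℕ) * κ) / d := by field_simp
            _ ≤ _ := by gcongr
      _ = _ := by rw [Finset.sum_const, Finset.card_range, nsmul_eq_mul]; ring
  have hS0 : 0 ≤ ∑ k ∈ Finset.range L, (d : ℝ) ^ k * (Real.exp κ / d) ^ (k + 1) :=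
    Finset.sum_nonneg fun k _ => by positivity
  have h2 := choose_le_exp (Fintype.card V) t ht Fintype.card_pos
  calc 2 * (((G.factorPerms Finset.univ).filter fun σ =>
      ∃ S : Finset V, S.card = t ∧ InDistinctShortOrbits σ L S).card : ℝ)
      ≤ 2 * (Real.exp (1 + Real.log (Fintype.card V / t)) ^ t *
        (((d : ℝ) / Real.exp 1) ^ Fintype.card V *
          Real.exp ((2 + 2 * Real.log d) * Fintype.card V / d) *
            Real.exp (Real.log L + L * κ - Real.log d) ^ t)) := by
        refine mul_le_mul_of_nonneg_left (h1.trans ?_) (by norm_num)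
        gcongr
    _ = ((d : ℝ) / Real.exp 1) ^ Fintype.card V * Real.exp (Real.log 2 +
        ((2 + 2 * Real.log d) * Fintype.card V / d + t * (1 + Real.log (Fintype.card V / t) +
          Real.log L + L * κ - Real.log d))) := by
        have e : t * (1 + Real.log (Fintype.card V / t) + Real.log L + L * κ - Real.log d) =
          t * (1 + Real.log (Fintype.card V / t)) + t * (Real.log L + L * κ - Real.log d) := by ring
        rw [e, Real.exp_add (Real.log 2), Real.exp_add (_ / _), Real.exp_add (t * _), Real.exp_nat_mul,
          Real.exp_nat_mul,
          Real.exp_log two_pos]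
        ring
    _ ≤ ((d : ℝ) / Real.exp 1) ^ Fintype.card V * 1 := by
        gcongr
        rw [Real.exp_le_one_iff]
        linarith
    _ = _ := mul_one _

/-- A lower bound for the number of Hamilton cycles. -/
theorem IsSide.le_numHamiltonCycles_mul (hA : IsSide G A) (hreg : G.IsRegularOfDegree d)
    (hd : 0 < d) (hlam0 : 0 < lam) (hlam : G.NontrivialEigenvaluesLE lam) {ρ : ℕ}
    (hρ : Fintype.card V < 2 ^ ρ) (hgap : 128 * (3 * ρ + 3) * lam < d)
    (hcard : 20000 * (3 * ρ + 3) ≤ Fintype.card V) {L t s : ℕ} (hL : 0 < L) (ht : 0 < t)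
    (hs : L * t + Fintype.card V < L * (s + 1))
    (hbad : (2 + 2 * Real.log d) * Fintype.card V / d + t * (1 + Real.log (Fintype.card V / t) +
      Real.log L + L * (lam / d + (t * L : ℕ) / Fintype.card V) - Real.log d) ≤ -Real.log 2) :
    ((d : ℝ) / Real.exp 1) ^ Fintype.card V ≤ 2 * (G.numHamiltonCycles *
      ((Fintype.card V : ℝ) ^ 2 + 1) ^ (2 * ((4 * ρ + 3) * s + 1) + s)) := by
  classical
  have : Nonempty V := Fintype.card_pos_iff.mp (by omega)
  have hlt : lam < d := by
    have : (0 : ℝ) ≤ ρ := Nat.cast_nonneg ρ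
    nlinarith
  have h1 := le_card_factorPerms hreg hd
  have h2 := card_manyShortOrbits_le_half hreg hd hlam0 hlam hlt hL ht hbad
  have h3 := card_le_numHamiltonCycles_mul (G := G) (k := (4 * ρ + 3) * s + 1) (s := s)
    ((G.factorPerms Finset.univ).filter fun σ =>
      ¬ ∃ S : Finset V, S.card = t ∧ InDistinctShortOrbits σ L S) (fun σ hσ => by
        obtain ⟨hσ, hgood⟩ := Finset.mem_filter.mp hσ
        obtain ⟨Cs, hnd, hmem, horb⟩ := exists_orbitLists σ Finset.univ (by simp)
        have hcov : ∀ x, x ∈ Cs.flatten := fun x => (hmem x).mpr (Finset.mem_univ x)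
        have hlen : Cs.length ≤ s := by
          have h4 := length_orbitLists_le hgood Cs hnd horb
          have h5 := lt_of_mul_lt_mul_left (h4.trans_lt hs) (Nat.zero_le L)
          omega
        obtain ⟨S, hScard, hS⟩ := traces_of_orbitLists hnd hcov horb
        obtain ⟨H, hH1, hH2, hH3, hH4⟩ := hA.exists_hamiltonian hreg hd hlam0 hlam hρ hgap hcard Cs
          (fun C hC => by
            obtain ⟨v, rfl⟩ := horb C hC
            exact ⟨isCyclicList_orbitList hσ v, List.ne_nil_of_mem (mem_orbitList_self σ v)⟩) hnd hcov
        obtain ⟨a, p, hp, hpw⟩ := hH3.exists_isHamiltonianCycle hH1 hH2 (by omega)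
        exact ⟨_, S, hS, hScard.trans hlen, a, p, hp,
          (hH4.trans hpw).mono (Nat.add_le_add_right (Nat.mul_le_mul_left _ hlen) _)⟩)
  have h4 := Finset.card_filter_add_card_filter_not (s := G.factorPerms Finset.univ)
    (fun σ => ∃ S : Finset V, S.card = t ∧ InDistinctShortOrbits σ L S)
  have h3' : (((G.factorPerms Finset.univ).filter fun σ =>
      ¬ ∃ S : Finset V, S.card = t ∧ InDistinctShortOrbits σ L S).card : ℝ) ≤
      G.numHamiltonCycles * ((Fintype.card V : ℝ) ^ 2 + 1) ^ (2 * ((4 * ρ + 3) * s + 1) + s) := by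
    exact_mod_cast h3
  rw [← h4] at h1
  push_cast at h1
  have h5 : (((G.factorPerms Finset.univ).filter fun σ =>
      ∃ S : Finset V, S.card = t ∧ InDistinctShortOrbits σ L S).card : ℝ) * 2 ≤
      ((d : ℝ) / Real.exp 1) ^ Fintype.card V := by
    convert (mul_comm _ _).trans_le h2
  linarith

theorem numHamiltonCycles_le (hreg : G.IsRegularOfDegree d)
    (hlam : G.NontrivialEigenvaluesLE lam) (hlt : lam < d) [Nonempty V] :
    (G.numHamiltonCycles : ℝ) ≤
      ((d + (2 + 2 * Real.log d)) / Real.exp 1) ^ Fintype.card V := by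
  have h1 : (G.numHamiltonCycles : ℝ) ≤ (G.factorPerms Finset.univ).card := by
    exact_mod_cast numHamiltonCycles_le_card_factorPerms
  refine h1.trans ((card_factorPerms_le hreg hlam hlt Finset.univ).trans (le_of_eq ?_))
  have : (Fintype.card V : ℝ) ≠ 0 := by exact_mod_cast Fintype.card_ne_zero
  rw [Finset.card_univ, div_self this]
  simp

end SimpleGraph

/-! ### The choice of the orbit parameters and the size of the errors. -/

section RealEstimates

/-- Since (1 + ε)(1 - ε/4) ≥ 1 + ε/4 for ε ≤ 1, the power of `x` uses only r^(1 - ε/4), and the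
remaining r^(ε/4) absorbs the logarithm. -/
theorem rpow_mul_log_le {ε x r : ℝ} (hε : 0 < ε) (hε1 : ε ≤ 1) (hx : 1 ≤ x)
    (hr : x ^ (1 + ε) ≤ r) : x ^ (1 + ε / 4) * Real.log r ≤ 4 / ε * r := by
  have hx0 : 0 < x := by linarith
  have hr1 : 1 ≤ r := (Real.one_le_rpow hx (by linarith)).trans hr
  have hr0 : 0 < r := by linarith
  have h1 : x ^ (1 + ε / 4) ≤ r ^ (1 - ε / 4) :=
    calc x ^ (1 + ε / 4) ≤ x ^ ((1 + ε) * (1 - ε / 4)) :=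
          Real.rpow_le_rpow_of_exponent_le hx (by nlinarith)
      _ = (x ^ (1 + ε)) ^ (1 - ε / 4) := Real.rpow_mul hx0.le _ _
      _ ≤ r ^ (1 - ε / 4) := Real.rpow_le_rpow (by positivity) hr (by linarith)
  have h2 : Real.log r ≤ r ^ (ε / 4) / (ε / 4) := Real.log_le_rpow_div hr0.le (by linarith)
  calc x ^ (1 + ε / 4) * Real.log r ≤ r ^ (1 - ε / 4) * (r ^ (ε / 4) / (ε / 4)) :=
        mul_le_mul h1 h2 (Real.log_nonneg hr1) (by positivity)
    _ = r ^ (1 - ε / 4 + ε / 4) / (ε / 4) := by rw [Real.rpow_add hr0]; ring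
    _ = 4 / ε * r := by
        rw [sub_add_cancel, Real.rpow_one]
        field_simp

/-- The exponent governing the number of permutations with many short orbits is negative. -/
theorem short_orbit_exponent_le {ε x D N d lam y : ℝ} {L t : ℕ} (hε : 0 < ε) (hε1 : ε ≤ 1)
    (hx : 6 ≤ x) (hN : 2 * x ^ 5 ≤ N) (hd : 0 < d) (hD : D = Real.log d)
    (hDx : 100 * Real.log x + 100 ≤ D) (hy : y = x ^ (2 + ε / 4)) (hlam : y * (lam / d) ≤ D / 4)
    (hlam0 : 0 < lam) (hL : L = ⌊y⌋₊) (ht : t = ⌊N / x ^ 5⌋₊) :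
    0 < L ∧ 0 < t ∧ (2 + 2 * D) * N / d + t * (1 + Real.log (N / t) +
      Real.log L + L * (lam / d + (t * L : ℕ) / N) - D) ≤ -Real.log 2 := by
  have hx0 : 0 < x := by linarith
  have hx5 : 0 < x ^ 5 := by positivity
  have hN0 : 0 < N := by linarith
  have hlx : 0 ≤ Real.log x := Real.log_nonneg (by linarith)
  have hD0 : 100 ≤ D := by linarith
  have hy1 : 1 ≤ y := by rw [hy]; exact Real.one_le_rpow (by linarith) (by linarith)
  have hL1 : 1 ≤ L := by rw [hL]; exact Nat.one_le_floor_iff _ |>.mpr hy1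
  have hLy : (L : ℝ) ≤ y := by rw [hL]; exact Nat.floor_le (by linarith)
  have hL0 : (0 : ℝ) < L := by exact_mod_cast hL1
  have hz2 : 2 ≤ N / x ^ 5 := by rwa [le_div_iff₀ hx5]
  have htle : (t : ℝ) ≤ N / x ^ 5 := by rw [ht]; exact Nat.floor_le (by linarith)
  have htge : N / x ^ 5 ≤ 2 * t := by
    have := Nat.lt_floor_add_one (N / x ^ 5)
    rw [← ht] at this
    linarith
  have ht1 : (1 : ℝ) ≤ t := by linarith
  have ht0 : (0 : ℝ) < t := by linarith
  refine ⟨hL1, by exact_mod_cast ht0, ?_⟩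
  have h1 : Real.log (N / t) ≤ 1 + 5 * Real.log x := by
    have h2 : N / t ≤ 2 * x ^ 5 := by
      rw [div_le_iff₀ ht0]
      rw [div_le_iff₀ hx5] at htge
      linarith
    calc Real.log (N / t) ≤ Real.log (2 * x ^ 5) := Real.log_le_log (by positivity) h2
      _ = Real.log 2 + 5 * Real.log x := by
        rw [Real.log_mul two_ne_zero hx5.ne', Real.log_pow]; norm_num
      _ ≤ _ := by linarith [Real.log_two_lt_d9]
  have h2 : Real.log L ≤ 3 * Real.log x := by
    calc Real.log L ≤ Real.log y := Real.log_le_log hL0 hLy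
      _ = (2 + ε / 4) * Real.log x := by rw [hy, Real.log_rpow hx0]
      _ ≤ _ := by nlinarith
  have h3 : L * (lam / d) ≤ D / 4 := le_trans (by gcongr) hlam
  have h4 : L * (((t * L : ℕ) : ℝ) / N) ≤ 1 := by
    -- The exponent 5 exceeds 4 + ε/2, so t L² ≤ n and the deletion of up to t L vertices is
    -- harmless.
    have hyy : y * y ≤ x ^ 5 := by
      rw [hy, ← Real.rpow_add hx0, ← Real.rpow_natCast]
      exact Real.rpow_le_rpow_of_exponent_le (by linarith) (by push_cast; linarith)
    have hLL : (L : ℝ) * L ≤ x ^ 5 := le_trans (by gcongr) hyy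
    push_cast
    rw [← mul_div_assoc, div_le_one hN0]
    rw [le_div_iff₀ hx5] at htle
    calc (L : ℝ) * (t * L) = t * (L * L) := by ring
      _ ≤ t * x ^ 5 := by gcongr
      _ ≤ N := htle
  have h5 : (2 + 2 * D) * N / d ≤ t * (D / 8) := by
    -- The Bregman–Minc loss is about n D/d and has to be small against t D ≈ n D/x^5.
    have hd64 : 64 * x ^ 5 ≤ d := by
      rw [← Real.log_le_log_iff (by positivity) hd, Real.log_mul (by norm_num) hx5.ne',
        Real.log_pow, ← hD]
      have : Real.log 64 ≤ 5 := by
        rw [show (64 : ℝ) = 2 ^ 6 by norm_num, Real.log_pow]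
        push_cast
        linarith [Real.log_two_lt_d9]
      push_cast
      linarith
    rw [div_le_iff₀ hd]
    rw [div_le_iff₀ hx5] at htge
    calc (2 + 2 * D) * N ≤ (4 * D) * (2 * t * x ^ 5) := by
          apply mul_le_mul _ htge hN0.le (by positivity)
          linarith
      _ = t * (D / 8) * (64 * x ^ 5) := by ring
      _ ≤ _ := by gcongr
  -- The positive terms total at most 3 + 8 log x + D/4, and 3 + 8 log x ≤ D/8.
  have h6 : t * (1 + Real.log (N / t) + Real.log L + L * (lam / d + (t * L : ℕ) / N) - D) ≤
      t * (-(5 * D / 8)) := by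
    gcongr
    rw [mul_add]
    linarith
  have h7 : 1 * 100 ≤ t * D := mul_le_mul ht1 hD0 (by norm_num) ht0.le
  linarith [Real.log_two_lt_d9]

theorem sq_add_one_le_cube {a : ℝ} (ha : 2 ≤ a) : a ^ 2 + 1 ≤ a ^ 3 := by
  have h1 : 4 ≤ a ^ 2 := by nlinarith
  nlinarith

theorem natLog_le_two_mul_log {n : ℕ} (hn : 0 < n) : (Nat.log 2 n : ℝ) ≤ 2 * Real.log n := by
  have h1 : ((2 : ℝ) ^ Nat.log 2 n) ≤ n := by exact_mod_cast Nat.pow_log_le_self 2 hn.ne'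
  have h2 := Real.log_le_log (by positivity) h1
  rw [Real.log_pow] at h2
  have : (0 : ℝ) ≤ Nat.log 2 n := Nat.cast_nonneg _
  nlinarith [Real.log_two_gt_d9]

/-- There are about n/x^(2 + ε/4) orbits, each costs O(x) edits, and recording one edit costs O(x)
in the exponent. The total is of order n x^(-ε/4), apart from a term linear in x. -/
theorem edit_exponent_le {ε x N y s ρ : ℝ} (hε1 : ε ≤ 1) (hx : 8 ≤ x) (hN : 0 < N)
    (hy : y = x ^ (2 + ε / 4)) (hs0 : 0 ≤ s) (hs : s ≤ N / x ^ 5 + 2 * N / y)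
    (hρ : ρ ≤ 2 * x + 1) :
    (2 * ((4 * ρ + 3) * s + 1) + s) * (3 * x) ≤ N * (180 * x ^ (-(ε / 4))) + 6 * x := by
  have hx0 : 0 < x := by linarith
  have hy0 : 0 < y := by rw [hy]; positivity
  have hyx : y ≤ x ^ 5 := by
    rw [hy, ← Real.rpow_natCast]
    exact Real.rpow_le_rpow_of_exponent_le (by linarith) (by push_cast; linarith)
  have hs' : s ≤ 3 * (N / y) := by
    have : N / x ^ 5 ≤ N / y := by gcongr
    have e : 2 * N / y = 2 * (N / y) := by ring
    linarith
  have hxy : x * x * (1 / y) = x ^ (-(ε / 4)) := by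
    rw [hy, ← sq, ← Real.rpow_natCast, one_div, ← Real.rpow_neg hx0.le, ← Real.rpow_add hx0]
    congr 1
    push_cast
    ring
  calc (2 * ((4 * ρ + 3) * s + 1) + s) * (3 * x) ≤ (20 * x * s + 2) * (3 * x) := by
        refine mul_le_mul_of_nonneg_right ?_ (by positivity)
        have h1 : (4 * ρ + 3) * s ≤ (9 * x) * s := by gcongr; linarith
        have h2 : 1 * s ≤ x * s := by gcongr; linarith
        linarith
    _ ≤ (20 * x * (3 * (N / y)) + 2) * (3 * x) := by gcongr
    _ = N * (180 * (x * x * (1 / y))) + 6 * x := by ring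
    _ = _ := by rw [hxy]

end RealEstimates

theorem Nat.le_log_factorial {n : ℕ} (hn : 0 < n) :
    n * (Real.log n - 1) ≤ Real.log (n.factorial : ℝ) := by
  have hn' : (0 : ℝ) < n := by exact_mod_cast hn
  have hf : (0 : ℝ) < n.factorial := by exact_mod_cast n.factorial_pos
  have h := Real.pow_div_factorial_le_exp (n : ℝ) hn'.le n
  have h2 := Real.log_le_log (by positivity) h
  rw [Real.log_exp, Real.log_div (by positivity) hf.ne', Real.log_pow] at h2
  linarith

/-! ### Two-sided bounds for the logarithm of the number of Hamilton cycles. -/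

namespace SimpleGraph

/-- The degree is large, since otherwise the spectral gap would be small. -/
theorem sqrt_log_card_sub_one_le_log_degree {V : Type*} [Fintype V] [DecidableEq V] [Nonempty V]
    {G : SimpleGraph V} [DecidableRel G.Adj] {d : ℕ} {lam x D : ℝ} (hreg : G.IsRegularOfDegree d)
    (hd : 0 < d) (hlam0 : 0 < lam) (hlam : G.NontrivialEigenvaluesLE lam) (hlt : lam < d)
    (hxn : x = Real.log (Fintype.card V)) (hDd : D = Real.log d) (hx : 3 ≤ x) (hD0 : 0 ≤ D)
    (hlog : x ≤ D * Real.log (d / lam)) : Real.sqrt x - 1 ≤ D := by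
  have hd' : (0 : ℝ) < d := by exact_mod_cast hd
  have hN0 : (0 : ℝ) < Fintype.card V := by exact_mod_cast Fintype.card_pos
  have hsq : x ≤ (D + 1) ^ 2 := by
    -- If 4d ≤ n, a single edge shows lam ≥ 1/2, so log(d/lam) ≤ D + 1 and x ≤ D(D + 1). Otherwise
    -- `d` is a constant fraction of n.
    rcases le_or_gt (4 * (d : ℝ)) (Fintype.card V) with h4 | h4
    · obtain ⟨a⟩ := ‹Nonempty V›
      obtain ⟨b, hab⟩ : ∃ b, G.Adj a b := by
        have : 0 < G.degree a := by rw [hreg a]; exact hd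
        exact (G.degree_pos_iff_exists_adj a).mp this
      have h1 := one_sub_le_of_adj hreg hlam0 hlam hlt hab
      have h2 : 2 * (d : ℝ) / Fintype.card V ≤ 1 / 2 := by
        rw [div_le_iff₀ hN0]
        linarith
      have hlam2 : 1 / 2 ≤ lam := by linarith
      have h3 : (d : ℝ) / lam ≤ 2 * d := by
        rw [div_le_iff₀ hlam0]
        nlinarith
      have h5 : Real.log (d / lam) ≤ D + 1 := by
        calc Real.log (d / lam) ≤ Real.log (2 * d) := Real.log_le_log (by positivity) h3
          _ = Real.log 2 + D := by rw [Real.log_mul two_ne_zero hd'.ne', hDd]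
          _ ≤ _ := by linarith [Real.log_two_lt_d9]
      have h6 : D * Real.log (d / lam) ≤ D * (D + 1) := by gcongr
      nlinarith
    · have h1 : x ≤ D + 2 := by
        calc x ≤ Real.log (4 * d) := by rw [hxn]; exact Real.log_le_log hN0 h4.le
          _ = 2 * Real.log 2 + D := by
            rw [Real.log_mul (by norm_num) hd'.ne', hDd, show (4 : ℝ) = 2 ^ 2 by norm_num,
              Real.log_pow]
            norm_num
          _ ≤ _ := by linarith [Real.log_two_lt_d9]
      nlinarith
  have := Real.sqrt_le_sqrt hsq
  rw [Real.sqrt_sq (by linarith)] at this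
  linarith

/-- The error (2 + 2D)/d is exponentially small in D, and D dominates log x; the bound 8/log x is
crude but tends to 0. -/
theorem log_numHamiltonCycles_le {V : Type*} [Fintype V] [DecidableEq V] [Nonempty V]
    {G : SimpleGraph V} [DecidableRel G.Adj] {d : ℕ} {lam x D : ℝ} (hreg : G.IsRegularOfDegree d)
    (hd : 0 < d) (hlam : G.NontrivialEigenvaluesLE lam) (hlt : lam < d) (hDd : D = Real.log d)
    (hlx : 0 < Real.log x) (hD100 : 100 * Real.log x + 100 ≤ D) (hpos : 0 < G.numHamiltonCycles) :
    Real.log G.numHamiltonCycles ≤ Fintype.card V * (D - 1 + 8 / Real.log x) := by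
  have hd' : (0 : ℝ) < d := by exact_mod_cast hd
  have hpos' : (0 : ℝ) < G.numHamiltonCycles := by exact_mod_cast hpos
  have hD0 : 0 ≤ D := by linarith
  have h1 := Real.log_le_log hpos' (numHamiltonCycles_le hreg hlam hlt)
  have hq : 0 < (d : ℝ) + (2 + 2 * Real.log d) := by rw [← hDd]; linarith
  rw [Real.log_pow, Real.log_div hq.ne' (Real.exp_pos 1).ne', Real.log_exp, ← hDd] at h1
  refine h1.trans ?_
  gcongr
  have hexpD : Real.exp D = d := by rw [hDd, Real.exp_log hd']
  have h2 : Real.log (d + (2 + 2 * D)) ≤ D + 8 / Real.log x := by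
    have h3 : (d : ℝ) + (2 + 2 * D) = d * (1 + (2 + 2 * D) / d) := by field_simp
    rw [h3, Real.log_mul hd'.ne' (by positivity), ← hDd]
    gcongr
    have h4 : Real.log (1 + (2 + 2 * D) / d) ≤ (2 + 2 * D) / d := by
      have := Real.log_le_sub_one_of_pos (by positivity : 0 < 1 + (2 + 2 * D) / d)
      linarith
    refine h4.trans ?_
    have h5 := Real.quadratic_le_exp_of_nonneg hD0
    rw [hexpD] at h5
    rw [div_le_div_iff₀ hd' hlx]
    have h6 : (2 + 2 * D) * Real.log x ≤ (4 * D) * D := by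
      apply mul_le_mul _ _ hlx.le (by linarith)
      · linarith
      · linarith
    nlinarith
  linarith

set_option maxHeartbeats 400000 in
/-- The logarithm of the number of Hamilton cycles up to an error of smaller order. -/
theorem log_numHamiltonCycles_bounds {V : Type*} [Fintype V] [DecidableEq V] {G : SimpleGraph V}
    [DecidableRel G.Adj] {d : ℕ} {lam ε x D : ℝ} (hG : G.IsBipartite) (hreg : G.IsRegularOfDegree d)
    (hlam0 : 0 < lam) (hlam : G.NontrivialEigenvaluesLE lam) (hε : 0 < ε) (hε1 : ε ≤ 1)
    (hcard : 0 < Fintype.card V) (hxn : x = Real.log (Fintype.card V)) (hDd : D = Real.log d)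
    (hx : 8 ≤ x) (hxε : 1000 < x ^ ε) (hxexp : 140000 * x ≤ Real.exp x)
    (hxexp' : 2 * x ^ 5 ≤ Real.exp x) (hxsqrt : 100 * Real.log x + 100 ≤ Real.sqrt x - 1)
    (hr : x ^ (1 + ε) ≤ d / lam) (hlog : x ≤ ε / 16 * (D * Real.log (d / lam))) :
    0 < G.numHamiltonCycles ∧ 0 < d ∧
      Fintype.card V * (D - 1 - 180 * x ^ (-(ε / 4))) - (6 * x + 1) ≤
        Real.log G.numHamiltonCycles ∧
      Real.log G.numHamiltonCycles ≤ Fintype.card V * (D - 1 + 8 / Real.log x) := by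
  set n := Fintype.card V with hn
  have hnonempty : Nonempty V := Fintype.card_pos_iff.mp hcard
  have hx0 : 0 < x := by linarith
  have hN0 : (0 : ℝ) < n := by exact_mod_cast hcard
  have hNx : Real.exp x = n := by rw [hxn, Real.exp_log hN0]
  have hr' : 1000 * x < d / lam := by
    refine lt_of_lt_of_le ?_ hr
    rw [Real.rpow_add hx0, Real.rpow_one, mul_comm]
    gcongr
  have hr1 : 1 ≤ d / lam := by linarith
  have hdlam : 1000 * x * lam < d := (lt_div_iff₀ hlam0).mp hr'
  have hd' : (0 : ℝ) < d := lt_trans (by positivity) hdlam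
  have hd : 0 < d := by exact_mod_cast hd'
  have hlt : lam < d := by nlinarith
  have hD0 : 0 ≤ D := by rw [hDd]; exact Real.log_nonneg (by exact_mod_cast hd)
  have hlr0 : 0 ≤ Real.log (d / lam) := Real.log_nonneg hr1
  have hDx : Real.sqrt x - 1 ≤ D := by
    have h1 : 0 ≤ D * Real.log (d / lam) := mul_nonneg hD0 hlr0
    exact sqrt_log_card_sub_one_le_log_degree hreg hd hlam0 hlam hlt hxn hDd (by linarith) hD0
      (by nlinarith)
  have hD100 : 100 * Real.log x + 100 ≤ D := hxsqrt.trans hDx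
  have hlx : 0 < Real.log x := Real.log_pos (by linarith)
  obtain ⟨y, hy⟩ : ∃ y, y = x ^ (2 + ε / 4) := ⟨_, rfl⟩
  -- Both hypotheses meet here: one factor x of y is replaced by (ε/16) D log(d/lam), and the
  -- remaining x^(1 + ε/4) log(d/lam) is at most (4/ε) d/lam.
  have hylam : y * (lam / d) ≤ D / 4 := by
    have h1 := rpow_mul_log_le hε hε1 (by linarith) hr
    have h2 : y = x ^ (1 + ε / 4) * x := by
      rw [hy, show 2 + ε / 4 = (1 + ε / 4) + 1 by ring, Real.rpow_add hx0, Real.rpow_one]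
    have h3 : y ≤ D / 4 * (d / lam) := by
      calc y = x ^ (1 + ε / 4) * x := h2
        _ ≤ x ^ (1 + ε / 4) * (ε / 16 * (D * Real.log (d / lam))) := by gcongr
        _ = ε / 16 * D * (x ^ (1 + ε / 4) * Real.log (d / lam)) := by ring
        _ ≤ ε / 16 * D * (4 / ε * (d / lam)) := by gcongr
        _ = _ := by field_simp; ring
    calc y * (lam / d) ≤ D / 4 * (d / lam) * (lam / d) := by gcongr
      _ = D / 4 := by field_simp
  obtain ⟨L, hLdef⟩ : ∃ L, L = ⌊y⌋₊ := ⟨_, rfl⟩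
  obtain ⟨t, htdef⟩ : ∃ t, t = ⌊(n : ℝ) / x ^ 5⌋₊ := ⟨_, rfl⟩
  obtain ⟨hL, ht, hbad⟩ := short_orbit_exponent_le hε hε1 (by linarith) (hNx ▸ hxexp') hd' hDd hD100
    hy hylam hlam0 hLdef htdef
  rw [hDd] at hbad
  obtain ⟨A, hA⟩ := hG.exists_isSide
  obtain ⟨ρ, hρdef⟩ : ∃ ρ, ρ = Nat.log 2 n + 1 := ⟨_, rfl⟩
  have hρ : (ρ : ℝ) ≤ 2 * x + 1 := by
    have := natLog_le_two_mul_log hcard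
    rw [hρdef, hxn]
    push_cast
    linarith
  -- The number of orbits is at most t + n/L: the short ones number fewer than `t`, and each of the
  -- others has more than `L` vertices.
  have hlow := hA.le_numHamiltonCycles_mul hreg hd hlam0 hlam (ρ := ρ)
    (by rw [hρdef]; exact Nat.lt_pow_succ_log_self (by norm_num) _)
    (by
      have : 128 * (3 * (ρ : ℝ) + 3) * lam ≤ 1000 * x * lam :=
        mul_le_mul_of_nonneg_right (by linarith) hlam0.le
      linarith)
    (by
      have : 20000 * (3 * (ρ : ℝ) + 3) ≤ n := by linarith
      exact_mod_cast this) hL ht (s := t + n / L)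
    (by
      have := Nat.lt_mul_div_succ n hL
      nlinarith) hbad
  rw [← hn] at hlow
  have hpos : 0 < G.numHamiltonCycles := by
    by_contra h0
    have h0 : G.numHamiltonCycles = 0 := by omega
    rw [h0] at hlow
    have : 0 < ((d : ℝ) / Real.exp 1) ^ n := by positivity
    simp at hlow
    linarith
  have hpos' : (0 : ℝ) < G.numHamiltonCycles := by exact_mod_cast hpos
  refine ⟨hpos, hd, ?_, ?_⟩
  · have h1 := Real.log_le_log (by positivity) hlow
    rw [Real.log_pow, Real.log_div hd'.ne' (Real.exp_pos 1).ne', Real.log_exp,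
      Real.log_mul two_ne_zero (by positivity), Real.log_mul hpos'.ne' (by positivity),
      Real.log_pow, ← hDd] at h1
    have h2 : Real.log ((n : ℝ) ^ 2 + 1) ≤ 3 * x := by
      have h3 := sq_add_one_le_cube (by linarith : (2 : ℝ) ≤ n)
      calc _ ≤ Real.log ((n : ℝ) ^ 3) := Real.log_le_log (by positivity) h3
        _ = 3 * x := by rw [Real.log_pow, hxn]; norm_num
    have hy1 : 1 ≤ y := by rw [hy]; exact Real.one_le_rpow (by linarith) (by linarith)
    have hLy : y ≤ 2 * L := by
      have := Nat.lt_floor_add_one y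
      rw [← hLdef] at this
      have : (1 : ℝ) ≤ L := by exact_mod_cast hL
      linarith
    have hs : ((t + n / L : ℕ) : ℝ) ≤ n / x ^ 5 + 2 * n / y := by
      push_cast
      have h3 : (t : ℝ) ≤ n / x ^ 5 := by rw [htdef]; exact Nat.floor_le (by positivity)
      have h4 : ((n / L : ℕ) : ℝ) ≤ n / L := Nat.cast_div_le
      have h5 : (n : ℝ) / L ≤ 2 * n / y := by
        rw [div_le_div_iff₀ (by exact_mod_cast hL) (by linarith)]
        nlinarith
      linarith
    have h3 := edit_exponent_le hε1 hx hN0 hy (Nat.cast_nonneg _) hs hρ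
    have h4 : ((2 * ((4 * ρ + 3) * (t + n / L) + 1) + (t + n / L) : ℕ) : ℝ) *
        Real.log ((n : ℝ) ^ 2 + 1) ≤ n * (180 * x ^ (-(ε / 4))) + 6 * x := by
      refine le_trans ?_ h3
      push_cast
      gcongr
    rw [mul_sub]
    linarith [Real.log_two_lt_d9]
  · exact log_numHamiltonCycles_le hreg hd hlam hlt hDd hlx hD100 hpos

end SimpleGraph

/-! ### Passage to the limit. -/

/-- The first term is the coding error. The second collects 6x + 1 from the lower bound and x + 1
from Stirling's formula, divided by n = exp x. -/
theorem tendsto_numHamiltonCycles_error {ε : ℝ} (hε : 0 < ε) :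
    Tendsto (fun x : ℝ => -(180 * x ^ (-(ε / 4)) + (7 * x + 2) / Real.exp x)) atTop (𝓝 0) := by
  have h1 : Tendsto (fun x : ℝ => x ^ (-(ε / 4))) atTop (𝓝 0) :=
    tendsto_rpow_neg_atTop (by linarith)
  have h2 : Tendsto (fun x : ℝ => x / Real.exp x) atTop (𝓝 0) := by
    simpa using Real.tendsto_pow_mul_exp_neg_atTop_nhds_zero 1 |>.congr fun x => by
      rw [Real.exp_neg, pow_one, div_eq_mul_inv]
  have h3 : Tendsto (fun x : ℝ => 1 / Real.exp x) atTop (𝓝 0) := by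
    simpa [Real.exp_neg] using Real.tendsto_exp_neg_atTop_nhds_zero
  have h4 := ((h1.const_mul 180).add ((h2.const_mul 7).add (h3.const_mul 2))).neg
  simp only [mul_zero, add_zero, neg_zero] at h4
  refine h4.congr fun x => ?_
  ring

theorem eventually_growth_conditions {ε : ℝ} (hε : 0 < ε) : ∀ᶠ x : ℝ in atTop, 8 ≤ x ∧
    1000 < x ^ ε ∧ 140000 * x ≤ Real.exp x ∧ 2 * x ^ 5 ≤ Real.exp x ∧
      100 * Real.log x + 100 ≤ Real.sqrt x - 1 := by
  have hpow : ∀ (k : ℕ) (C : ℝ), 0 < C → ∀ᶠ x : ℝ in atTop, C * x ^ k ≤ Real.exp x :=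
    fun k C hC => by
      filter_upwards [(Real.tendsto_exp_div_pow_atTop k).eventually_ge_atTop C,
        eventually_gt_atTop 0] with x hx hx0
      rwa [le_div_iff₀ (by positivity)] at hx
  have hlog : ∀ᶠ x : ℝ in atTop, 100 * Real.log x + 101 ≤ Real.sqrt x := by
    have h1 : ∀ᶠ x : ℝ in atTop, ‖Real.log x‖ ≤ 1 / 200 * ‖x ^ (1 / 2 : ℝ)‖ :=
      (isLittleO_log_rpow_atTop (by norm_num)).def (by norm_num)
    have h2 : ∀ᶠ x : ℝ in atTop, 202 ≤ x ^ (1 / 2 : ℝ) :=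
      (tendsto_rpow_atTop (by norm_num)).eventually_ge_atTop 202
    filter_upwards [h1, h2] with x h1 h2
    rw [Real.sqrt_eq_rpow]
    rw [Real.norm_of_nonneg (by linarith : 0 ≤ x ^ (1 / 2 : ℝ))] at h1
    have := (Real.le_norm_self (Real.log x)).trans h1
    linarith
  filter_upwards [eventually_ge_atTop 8, (tendsto_rpow_atTop hε).eventually_gt_atTop 1000,
    hpow 1 140000 (by norm_num), hpow 5 2 (by norm_num), hlog] with x h1 h2 h3 h4 h5
  exact ⟨h1, h2, by simpa using h3, h4, by linarith⟩

theorem theorem7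
    (V : ℕ → Type*) [∀ k, Fintype (V k)] [∀ k, DecidableEq (V k)]
    (G : ∀ k, SimpleGraph (V k)) [∀ k, DecidableRel (G k).Adj]
    (n d : ℕ → ℕ) (lam : ℕ → ℝ) (ε : ℝ) (hε : 0 < ε)
    (hcard : ∀ k, Fintype.card (V k) = n k)
    (hn : Tendsto n atTop atTop)
    (hbip : ∀ k, (G k).IsBipartite)
    (hreg : ∀ k, (G k).IsRegularOfDegree (d k))
    (hlam_pos : ∀ k, 0 < lam k)
    (hlam : ∀ k, (G k).NontrivialEigenvaluesLE (lam k))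
    (h5 : ∀ᶠ k in atTop, Real.log (n k) ^ (1 + ε) ≤ (d k : ℝ) / lam k)
    (h6 : (fun k => Real.log (n k)) =o[atTop]
      fun k => Real.log (d k) * Real.log ((d k : ℝ) / lam k)) :
    ∃ δ : ℕ → ℝ, Tendsto δ atTop (𝓝 0) ∧
      ∀ᶠ k in atTop, ((G k).numHamiltonCycles : ℝ) =
        ((n k).factorial : ℝ) * ((d k : ℝ) / (n k : ℝ)) ^ n k * (1 + δ k) ^ n k := by

  -- Lowering ε to at most 1 only weakens the first hypothesis, as log n ≥ 1 eventually.
  set ε' := min ε 1 with hε'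
  have hε'0 : 0 < ε' := lt_min hε one_pos
  have hx : Tendsto (fun k => Real.log (n k)) atTop atTop :=
    Real.tendsto_log_atTop.comp (tendsto_natCast_atTop_atTop.comp hn)
  have hbounds : ∀ᶠ k in atTop, 0 < n k ∧ 0 < (G k).numHamiltonCycles ∧ 0 < d k ∧
      n k * (Real.log (d k) - 1 - 180 * Real.log (n k) ^ (-(ε' / 4))) - (6 * Real.log (n k) + 1) ≤
        Real.log (G k).numHamiltonCycles ∧
      Real.log (G k).numHamiltonCycles ≤
        n k * (Real.log (d k) - 1 + 8 / Real.log (Real.log (n k))) := by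
    filter_upwards [hx.eventually (eventually_growth_conditions hε'0), h5,
      h6.def (by positivity : 0 < ε' / 16), hn.eventually_gt_atTop 0] with k hk h5k h6k hnk
    obtain ⟨hx8, h2, h3, h4, h5'⟩ := hk
    have hr : Real.log (n k) ^ (1 + ε') ≤ d k / lam k :=
      (Real.rpow_le_rpow_of_exponent_le (by linarith)
        (add_le_add_right (min_le_left _ _) _)).trans h5k
    have hr1 : 1 ≤ (d k : ℝ) / lam k :=
      (Real.one_le_rpow (by linarith) (by linarith)).trans hr
    have hnn : 0 ≤ Real.log (d k) * Real.log (d k / lam k) :=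
      mul_nonneg (Real.log_natCast_nonneg _) (Real.log_nonneg hr1)
    rw [Real.norm_of_nonneg (by linarith), Real.norm_of_nonneg hnn] at h6k
    have := SimpleGraph.log_numHamiltonCycles_bounds (hbip k) (hreg k) (hlam_pos k) (hlam k) hε'0
      (min_le_right _ _) (by rw [hcard]; exact hnk) (by rw [hcard]) rfl hx8 h2 h3 h4 h5' hr h6k
    rw [hcard] at this
    exact ⟨hnk, this⟩
  set B : ℕ → ℝ := fun k => (n k).factorial * ((d k : ℝ) / n k) ^ n k with hB
  -- δ is obtained by solving the identity exactly, so the content is that the difference of the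
  -- logarithms is o(n).
  refine ⟨fun k => Real.exp ((Real.log (G k).numHamiltonCycles - Real.log (B k)) / n k) - 1, ?_, ?_⟩
  · have hlim : Tendsto (fun k => (Real.log (G k).numHamiltonCycles - Real.log (B k)) / n k) atTop
        (𝓝 0) := by
      have hup : Tendsto (fun k => 8 / Real.log (Real.log (n k))) atTop (𝓝 0) :=
        tendsto_const_nhds.div_atTop (Real.tendsto_log_atTop.comp hx)
      refine tendsto_of_tendsto_of_tendsto_of_le_of_le'
        ((tendsto_numHamiltonCycles_error hε'0).comp hx) hup ?_ ?_
      all_goals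
        filter_upwards [hbounds] with k hk
        obtain ⟨hnk, hpos, hdk, hlow, hupp⟩ := hk
        have hn0 : (0 : ℝ) < n k := by exact_mod_cast hnk
        have hd0 : (0 : ℝ) < d k := by exact_mod_cast hdk
        have hlogB : Real.log (B k) = Real.log (n k).factorial +
            n k * (Real.log (d k) - Real.log (n k)) := by
          rw [hB, Real.log_mul (by exact_mod_cast (n k).factorial_ne_zero) (by positivity),
            Real.log_pow, Real.log_div hd0.ne' hn0.ne']
        have h1 := Nat.le_log_factorial hnk
        have h2 := Nat.log_factorial_le (n k) hnk
      · rw [Function.comp_apply, Real.exp_log hn0, le_div_iff₀ hn0, hlogB]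
        have e : -(180 * Real.log (n k) ^ (-(ε' / 4)) + (7 * Real.log (n k) + 2) / n k) * n k =
            -(n k * (180 * Real.log (n k) ^ (-(ε' / 4)))) - (7 * Real.log (n k) + 2) := by
          field_simp
          ring
        rw [e]
        linarith
      · rw [div_le_iff₀ hn0, hlogB]
        linarith
    have h := ((Real.continuous_exp.tendsto 0).comp hlim).sub_const 1
    simpa using h
  · filter_upwards [hbounds] with k hk
    obtain ⟨hnk, hpos, hdk, -, -⟩ := hk
    have hn0 : (0 : ℝ) < n k := by exact_mod_cast hnk
    have hd0 : (0 : ℝ) < d k := by exact_mod_cast hdk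
    have hB0 : 0 < B k := by
      have : (0 : ℝ) < (n k).factorial := by exact_mod_cast (n k).factorial_pos
      positivity
    have hH0 : (0 : ℝ) < (G k).numHamiltonCycles := by exact_mod_cast hpos
    rw [add_sub_cancel, ← Real.exp_nat_mul, mul_div_cancel₀ _ hn0.ne', Real.exp_sub,
      Real.exp_log hH0, Real.exp_log hB0]
    exact (mul_div_cancel₀ _ hB0.ne').symm
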